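/- Let $d\ge 1$, let $\Omega\subset\mathbb R^d$ be a bounded domain (open, connected, non-empty), let $\rho_0\in C^1(\overline\Omega)$ with $\rho_0>0$ on $\overline\Omega$, let $U\in C^2(0,\infty)$ satisfy $U(s)/s\to\infty$ as $s\to\infty$ (for example $U(s)=s\log s$), and let $V\in C^1(\mathbb R^d)$ and $W\in C^1(\mathbb R^d\times\mathbb R^d)$ with $W(\bm x,\bm y)=W(\bm y,\bm x)$. Let $\mathcal D$ be the set of maps $\bm x\in C^2(\overline\Omega;\mathbb R^d)$ with $\bm x(\bm X)=\bm X$ on $\partial\Omega$; here $C^k(\overline\Omega)$ consists of the restrictions to $\overline\Omega$ of $C^k$ functions on $\mathbb R^d$. For $\bm x\in\mathcal D$ put $$E(\bm x)=\int_\Omega U\Big(\tfrac{\rho_0}{\det\frac{\partial\bm x}{\partial\bm X}}\Big)\det\tfrac{\partial\bm x}{\partial\bm X}\,d\bm X+\int_\Omega V(\bm x(\bm X))\rho_0(\bm X)\,d\bm X+\frac12\int_\Omega\int_\Omega W(\bm x(\bm X),\bm x(\bm Y))\rho_0(\bm X)\rho_0(\bm Y)\,d\bm X\,d\bm Y ,$$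 where $E(\bm x)=+\infty$ unless $\det\frac{\partial\bm x}{\partial\bm X}>0$ a.e. in $\Omega$ and the first integrand is integrable; let $\operatorname{dom}E\subset\mathcal D$ be the set where $E<\infty$. Let $\tau,r>0$ (the time step $\tau_{n+1}$ and the ratio $r_{n+1}=\tau_{n+1}/\tau_n$) and let $\bm x^{n-1},\bm x^n\in\mathcal D$ have positive Jacobian determinant in $\Omega$. A solution of the semi-discrete scheme is a pair $(\bm x^{n+1},\rho^{n+1})$, with $\bm x^{n+1}\in\mathcal D$, $\det\frac{\partial\bm x^{n+1}}{\partial\bm X}\neq0$ in $\Omega$ and $\rho^{n+1}:\Omega\to\mathbb R$, such that at every $\bm X\in\Omega$ $$\rho_0\,\frac{(1+2r)\bm x^{n+1}-(1+r)^2\bm x^n+r^2\bm x^{n-1}}{\tau(1+r)}-\tau\,\Delta_{\bm X}(\bm x^{n+1}-\bm x^n)+\rho_0\,\nabla_{\bm x}\mu^{n+1}=0,\qquad \rho^{n+1}=\frac{\rho_0}{\det\frac{\partial\bm x^{n+1}}{\partial\bm X}},$$ where $\mu^{n+1}(\bm X)=U'(\rho^{n+1}(\bm X))+V(\bm x^{n+1}(\bm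 X))+\int_\Omega W(\bm x^{n+1}(\bm X),\bm x^{n+1}(\bm Y))\rho_0(\bm Y)\,d\bm Y$ is the variational derivative $F'=\delta E/\delta\rho$ and $\nabla_{\bm x}=\big(\frac{\partial\bm x^{n+1}}{\partial\bm X}\big)^{-T}\nabla_{\bm X}$. Let $$J(\bm x)=\frac1{2\tau}\int_\Omega\rho_0\frac{|(1+2r)\bm x-(1+r)^2\bm x^n+r^2\bm x^{n-1}|^2}{(1+r)(1+2r)}\,d\bm X+E(\bm x)+\frac\tau2\int_\Omega|\nabla_{\bm X}(\bm x-\bm x^n)|^2\,d\bm X .$$ Assume that $E$ is convex with respect to $\bm x$, i.e. that $\operatorname{dom}E$ is convex and $E$ is convex on it. Then $J$ is convex on $\operatorname{dom}E$; the scheme has exactly one solution $(\bm x^{n+1},\rho^{n+1})$ ($\bm x^{n+1}$ being unique on $\overline\Omega$ and $\rho^{n+1}$ on $\Omega$); and $\bm x^{n+1}$ lies in $\operatorname{dom}E$ and is the unique minimizer of $J$ there. Moreover, in particular for $U(s)=s\log s$, $\det\frac{\partial\bm x^{n+1}}{\partial\bm X}>0$ in $\Omega$, $\rho^{n+1}$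 is positive, $\bm x^{n+1}$ is injective on $\Omega$, so that $\rho^{n+1}$ defines an Eulerian density on $\bm x^{n+1}(\Omega)$ through $\rho^{n+1}(\bm x^{n+1}(\bm X))=\rho_0(\bm X)/\det\frac{\partial\bm x^{n+1}}{\partial\bm X}(\bm X)$; this density is positive and integrable, and mass is conserved: $$\int_{\bm x^{n+1}(\Omega)}\rho^{n+1}(\bm x)\,d\bm x=\int_\Omega\rho_0(\bm X)\,d\bm X .$$ -/

import Mathlib

open MeasureTheory Filter Topology
open scoped InnerProductSpace Laplacian

noncomputable section

namespace WassersteinBDF2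

/-- `ℝᵈ` with its Euclidean norm. -/
abbrev Space (d : ℕ) := EuclideanSpace ℝ (Fin d)

/-- The data of a Wasserstein gradient flow: the reference domain `Ω`, the initial density `ρ₀`,
the internal energy density `U`, the drift potential `V` and the interaction potential `W`
(the case of a convolution kernel is `W x y = w (x - y)`). -/
structure FlowData (d : ℕ) where
  Ω : Set (Space d)
  ρ₀ : Space d → ℝ
  U : ℝ → ℝ
  V : Space d → ℝ
  W : Space d → Space d → ℝ

/-- The data of one time step: the new time step `τ = τₙ₊₁`, the ratio `r = τₙ₊₁ / τₙ`, and the two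
preceding maps `xPrev = xⁿ⁻¹` and `xCur = xⁿ`. -/
structure StepData (d : ℕ) where
  τ : ℝ
  r : ℝ
  xPrev : Space d → Space d
  xCur : Space d → Space d

variable {d : ℕ}

/-- The Jacobian determinant `det (∂x/∂X)`. -/
def jac (x : Space d → Space d) (X : Space d) : ℝ := (fderiv ℝ x X).det

/-- Maps of class `C²` up to the boundary (represented by `C²` maps of `ℝᵈ`) that satisfy the
boundary condition `x = X` on `∂Ω`. -/
def IsDirichletMap (Ω : Set (Space d)) (x : Space d → Space d) : Prop :=
  ContDiff ℝ 2 x ∧ ∀ X ∈ frontier Ω, x X = X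

/-- Flow maps: Dirichlet maps with positive Jacobian determinant. -/
def IsFlowMap (Ω : Set (Space d)) (x : Space d → Space d) : Prop :=
  IsDirichletMap Ω x ∧ ∀ X ∈ Ω, 0 < jac x X

/-- The density of the internal energy, pulled back to the reference domain. -/
def internalDensity (D : FlowData d) (x : Space d → Space d) (X : Space d) : ℝ :=
  D.U (D.ρ₀ X / jac x X) * jac x X

/-- The set of Dirichlet maps at which the energy is finite: the energy counts as `+∞` unless the
Jacobian determinant is positive almost everywhere and the internal energy density is integrable. -/
def energyDomain (D : FlowData d) : Set (Space d → Space d) :=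
  {x | IsDirichletMap D.Ω x ∧ (∀ᵐ X ∂(volume.restrict D.Ω), 0 < jac x X) ∧
    IntegrableOn (internalDensity D x) D.Ω}

/-- The energy
`E = ∫ U(ρ) + V ρ dx + ½ ∬ W(x, y) ρ(x) ρ(y) dx dy` of the density `ρ = ρ₀ / det (∂x/∂X)`,
as a functional of the map `x`, in Lagrangian coordinates. -/
def energy (D : FlowData d) (x : Space d → Space d) : ℝ :=
  (∫ X in D.Ω, internalDensity D x X) + (∫ X in D.Ω, D.V (x X) * D.ρ₀ X) +
    1 / 2 * ∫ X in D.Ω, ∫ Y in D.Ω, D.W (x X) (x Y) * D.ρ₀ X * D.ρ₀ Y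

/-- The chemical potential `F'(ρ) = δE/δρ = U'(ρ) + V + ∫ W(·, y) ρ(y) dy`, evaluated at `x(X)`,
where `ρ` is the Lagrangian density and `ρ(y) dy = ρ₀(Y) dY`. -/
def potential (D : FlowData d) (x : Space d → Space d) (ρ : Space d → ℝ) (X : Space d) : ℝ :=
  deriv D.U (ρ X) + D.V (x X) + ∫ Y in D.Ω, D.W (x X) (x Y) * D.ρ₀ Y

/-- The gradient `∇ₓ f = (∂x/∂X)⁻ᵀ ∇_X f` with respect to the Eulerian variable of a function `f`
given in the Lagrangian variable. -/
def eulerianGradient (x : Space d → Space d) (f : Space d → ℝ) (X : Space d) : Space d :=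
  (ContinuousLinearMap.adjoint (fderiv ℝ x X)).inverse (gradient f X)

/-- The combination `(1 + 2r) x - (1 + r)² xⁿ + r² xⁿ⁻¹`. -/
def bdf2 (S : StepData d) (x : Space d → Space d) (X : Space d) : Space d :=
  (1 + 2 * S.r) • x X - (1 + S.r) ^ 2 • S.xCur X + S.r ^ 2 • S.xPrev X

/-- `(x, ρ)` is a (classical) solution of the semi-discrete scheme for one time step. The Jacobian
determinant is only required not to vanish, so that the quotient in the last line makes sense. -/
structure IsSchemeSolution (D : FlowData d) (S : StepData d)
    (x : Space d → Space d) (ρ : Space d → ℝ) : Prop where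
  dirichlet : IsDirichletMap D.Ω x
  jac_ne_zero : ∀ X ∈ D.Ω, jac x X ≠ 0
  momentum : ∀ X ∈ D.Ω,
    (D.ρ₀ X / (S.τ * (1 + S.r))) • bdf2 S x X
      - S.τ • (Δ (fun Y => x Y - S.xCur Y)) X
      + D.ρ₀ X • eulerianGradient x (potential D x ρ) X = 0
  density : ∀ X ∈ D.Ω, ρ X = D.ρ₀ X / jac x X

/-- The squared Frobenius norm of the derivative, `|∇_X u|²`. -/
def gradNormSq (u : Space d → Space d) (X : Space d) : ℝ :=
  ∑ i : Fin d, ‖fderiv ℝ u X (EuclideanSpace.single i 1)‖ ^ 2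

/-- The functional of the variational problem. -/
def stepFunctional (D : FlowData d) (S : StepData d) (x : Space d → Space d) : ℝ :=
  1 / (2 * S.τ) *
      (∫ X in D.Ω, D.ρ₀ X * (‖bdf2 S x X‖ ^ 2 / ((1 + S.r) * (1 + 2 * S.r))))
    + energy D x
    + S.τ / 2 * ∫ X in D.Ω, gradNormSq (fun Y => x Y - S.xCur Y) X

/-- The Eulerian density on `x(Ω)`: the function whose value at `x(X)`, `X ∈ Ω`, is `ρ(X)`
(for `x` injective on `Ω`). -/
def eulerianDensity (Ω : Set (Space d)) (x : Space d → Space d) (ρ : Space d → ℝ)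
    (y : Space d) : ℝ :=
  ρ (Function.invFunOn x Ω y)

end WassersteinBDF2

end

/-! ### Stress laws on an interval and the correspondence between stresses and maps. -/

namespace WassersteinBDF2

open Set intervalIntegral

/-! In dimension at least two the convexity hypothesis on `E` cannot hold
(`not_convex_energyDomain`). Compare the identity with a twist that is trivial outside a small ball
and rotates an inner ball by `π` in a coordinate plane. Both have positive Jacobian and finite
energy, but their midpoint collapses that plane on the inner ball, so its Jacobian vanishes on a set
of positive measure. All the content is therefore in dimension one, where `Ω` is an interval.

There, let `p = x'` be the slope. Internal energy and gradient penalty have the common density `Ψ(X,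
p) = U(ρ₀/p) p + τ/2 (p - (xⁿ)')²`, whose `p`-derivative is a stress `σ`. The scheme says that the
derivative of `σ(X, x')` is the force `f`, the gradient of inertia, drift and interaction. Convexity
of `E` forces `U'' ≥ 0` (`deriv2_U_nonneg`): on a narrow bump of bounded slope the internal energy
dominates the second difference of the energy. Hence `σ` increases in `p` at rate at least `τ`, and
superlinearity of `U` gives `σ → -∞` as `p → 0`. So `σ(X, ·)` is a bijection of `(0, ∞)` onto `ℝ`,
and a map can be encoded by its stress, positivity of the slope being automatic.

For existence (`exists_isMinimizer`, `exists_equilibrium`), minimize the total energy over the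
stresses `g` of maps fixing the endpoints whose Lipschitz constant is at most `K`, a bound for the
force; this set is compact by Arzelà–Ascoli. The constraint is harmless: the primitive `G` of the
force is itself `K`-Lipschitz, so moving `g` towards `G` up to a constant stays in the class, and
minimality yields that `g - G` is constant. Implicit differentiation of `σ(X, p) = g` then makes the
map `C²` up to the boundary (`exists_isEquilibrium`).

For uniqueness, an equilibrium has bounded stress, so its slope is bounded away from `0`
(`deriv_pos_of_isEquilibrium`). Convexity of `J` along segments and the first variation show that it
minimizes `J` (`isMinOn_of_isEquilibrium`), and the inertia makes the minimizer unique on the closed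
interval. A nonvanishing slope is positive because the endpoints are fixed, and mass conservation is
the change of variables formula. -/

/-- A stress law `σ(X, p)` on `[a, b] × (0, ∞)`, strongly increasing in `p` and tending to `-∞` as
`p → 0`, together with its potential `Ψ`. -/
structure StressLaw (a b τ : ℝ) where
  Ψ : ℝ → ℝ → ℝ
  σ : ℝ → ℝ → ℝ
  lt : a < b
  pos : 0 < τ
  hasDerivAt : ∀ X ∈ Icc a b, ∀ p, 0 < p → HasDerivAt (Ψ X) (σ X p) p
  continuousOn_energy : ContinuousOn (Function.uncurry Ψ) (Icc a b ×ˢ Ioi 0)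
  continuousOn : ContinuousOn (Function.uncurry σ) (Icc a b ×ˢ Ioi 0)
  mono : ∀ X ∈ Icc a b, ∀ p q, 0 < p → p ≤ q → τ * (q - p) ≤ σ X q - σ X p
  bot : ∀ M, ∃ m > 0, ∀ X ∈ Icc a b, ∀ p, 0 < p → p ≤ m → σ X p < M
  lip : ∀ m M, 0 < m → ∃ L, 0 ≤ L ∧ ∀ X ∈ Icc a b, ∀ p q, m ≤ p → p ≤ q → q ≤ M →
    σ X q - σ X p ≤ L * (q - p)

/-- Continuous maps that send `[a, b]` to itself. -/
def IsAdmissible (a b : ℝ) (x : ℝ → ℝ) : Prop := Continuous x ∧ MapsTo x (Icc a b) (Icc a b)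

/-- A functional `B` of admissible maps with a bounded continuous gradient `f`, the first-order
expansion being uniform. -/
structure ForceLaw (a b : ℝ) where
  B : (ℝ → ℝ) → ℝ
  f : (ℝ → ℝ) → ℝ → ℝ
  K : ℝ
  bound : ∀ x, IsAdmissible a b x → ∀ X ∈ Icc a b, |f x X| ≤ K
  continuous : ∀ x, IsAdmissible a b x → Continuous (f x)
  expansion : ∀ ε > 0, ∃ δ₀ > 0, ∀ x y, IsAdmissible a b x → IsAdmissible a b y →
    ∀ δ ≤ δ₀, (∀ X ∈ Icc a b, |y X - x X| ≤ δ) →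
      |B y - B x - ∫ X in a..b, f x X * (y X - x X)| ≤ ε * δ

/-- The projection of `ℝ` to `[a, b]`. -/
def clamp (a b X : ℝ) : ℝ := max a (min b X)

lemma clamp_mem {a b : ℝ} (h : a ≤ b) (X : ℝ) : clamp a b X ∈ Icc a b :=
  ⟨le_max_left _ _, max_le h (min_le_left _ _)⟩

lemma clamp_of_mem {a b X : ℝ} (h : X ∈ Icc a b) : clamp a b X = X := by
  simp [clamp, h.1, h.2]

@[fun_prop]
lemma continuous_clamp (a b : ℝ) : Continuous (clamp a b) := by
  unfold clamp; fun_prop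

namespace StressLaw

variable {a b τ : ℝ} (S : StressLaw a b τ)

include S in
lemma le : a ≤ b := S.lt.le

/-- The stress is below `y` for small slopes and grows at least linearly with rate `τ`, so the
intermediate value theorem applies. -/
lemma exists_eq {X : ℝ} (hX : X ∈ Icc a b) (y : ℝ) : ∃ p, 0 < p ∧ S.σ X p = y := by
  obtain ⟨m, hm, h⟩ := S.bot y
  have h0 := h X hX m hm le_rfl
  -- At rate `τ`, the increment `q - m` suffices to make up the missing stress `y - σ X m`.
  set q := m + (y - S.σ X m) / τ with hq
  have hmq : m ≤ q := by
    have : 0 ≤ (y - S.σ X m) / τ := div_nonneg (by linarith) S.pos.le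
    linarith
  have h1 := S.mono X hX m q hm hmq
  have h2 : τ * (q - m) = y - S.σ X m := by
    rw [hq]; have := S.pos.ne'; field_simp; ring
  have hc : ContinuousOn (S.σ X) (Icc m q) := by
    have : ContinuousOn (fun p => Function.uncurry S.σ (X, p)) (Icc m q) :=
      S.continuousOn.comp (by fun_prop) fun p hp => ⟨hX, lt_of_lt_of_le hm hp.1⟩
    exact this
  obtain ⟨p, hp, hpy⟩ := intermediate_value_Icc hmq hc ⟨h0.le, by linarith⟩
  exact ⟨p, hm.trans_le hp.1, hpy⟩

/-- The inverse of the stress law in its second variable. -/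
noncomputable def inv (X y : ℝ) : ℝ := (S.exists_eq (clamp_mem S.le X) y).choose

lemma inv_pos (X y : ℝ) : 0 < S.inv X y := (S.exists_eq (clamp_mem S.le X) y).choose_spec.1

lemma σ_inv_clamp (X y : ℝ) : S.σ (clamp a b X) (S.inv X y) = y :=
  (S.exists_eq (clamp_mem S.le X) y).choose_spec.2

lemma σ_inv {X : ℝ} (hX : X ∈ Icc a b) (y : ℝ) : S.σ X (S.inv X y) = y := by
  have := S.σ_inv_clamp X y
  rwa [clamp_of_mem hX] at this

lemma strong_mono {X : ℝ} (hX : X ∈ Icc a b) {p q : ℝ} (hp : 0 < p) (hq : 0 < q) :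
    τ * (q - p) ^ 2 ≤ (S.σ X q - S.σ X p) * (q - p) := by
  rcases le_total p q with h | h
  · nlinarith [mul_le_mul_of_nonneg_right (S.mono X hX p q hp h) (sub_nonneg.2 h)]
  · nlinarith [mul_le_mul_of_nonneg_right (S.mono X hX q p hq h) (sub_nonneg.2 h)]

lemma abs_sub_le {X : ℝ} (hX : X ∈ Icc a b) {p q : ℝ} (hp : 0 < p) (hq : 0 < q) :
    |q - p| ≤ |S.σ X q - S.σ X p| / τ := by
  rw [le_div_iff₀ S.pos]
  rcases le_total p q with h | h
  · have := S.mono X hX p q hp h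
    rw [abs_of_nonneg (sub_nonneg.2 h)]
    linarith [le_abs_self (S.σ X q - S.σ X p)]
  · have := S.mono X hX q p hq h
    rw [abs_of_nonpos (sub_nonpos.2 h)]
    linarith [neg_abs_le (S.σ X q - S.σ X p)]

lemma inv_σ {X p : ℝ} (hX : X ∈ Icc a b) (hp : 0 < p) : S.inv X (S.σ X p) = p := by
  have := S.abs_sub_le hX hp (S.inv_pos X (S.σ X p))
  rw [S.σ_inv hX, sub_self, abs_zero, zero_div] at this
  exact sub_eq_zero.1 (abs_eq_zero.1 (le_antisymm this (abs_nonneg _)))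

lemma inv_strong_mono (X y z : ℝ) :
    τ * (S.inv X y - S.inv X z) ^ 2 ≤ (y - z) * (S.inv X y - S.inv X z) := by
  have := S.strong_mono (clamp_mem S.le X) (S.inv_pos X z) (S.inv_pos X y)
  rwa [σ_inv_clamp, σ_inv_clamp] at this

lemma inv_mono (X : ℝ) {y z : ℝ} (h : y ≤ z) : S.inv X y ≤ S.inv X z := by
  by_contra! hc
  have := S.inv_strong_mono X y z
  nlinarith [S.pos, mul_pos S.pos (pow_pos (sub_pos.2 hc) 2)]

lemma inv_lipschitz (X y z : ℝ) : |S.inv X y - S.inv X z| ≤ |y - z| / τ := by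
  have := S.abs_sub_le (clamp_mem S.le X) (S.inv_pos X z) (S.inv_pos X y)
  rwa [σ_inv_clamp, σ_inv_clamp] at this

lemma continuous_σ_clamp {p : ℝ} (hp : 0 < p) : Continuous fun X => S.σ (clamp a b X) p := by
  rw [← continuousOn_univ]
  exact S.continuousOn.comp (f := fun X => (clamp a b X, p)) (by fun_prop)
    fun X _ => ⟨clamp_mem S.le X, hp⟩

/-- With `p` the value at `(X₀, y₀)`, strong monotonicity bounds the distance of `inv X y` from `p`
by `|y - σ(X, p)| / τ`, which is continuous in `(X, y)` and vanishes at the base point. Clamping `X`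
makes this work on the whole plane. -/
lemma continuous_inv : Continuous (Function.uncurry S.inv) := by
  rw [continuous_iff_continuousAt]
  rintro ⟨X₀, y₀⟩
  set p := S.inv X₀ y₀ with hp
  have hp0 : 0 < p := S.inv_pos _ _
  have h1 : Tendsto (fun z : ℝ × ℝ => |z.2 - S.σ (clamp a b z.1) p| / τ) (𝓝 (X₀, y₀)) (𝓝 0) := by
    have hc : Continuous fun z : ℝ × ℝ => |z.2 - S.σ (clamp a b z.1) p| / τ := by
      have := (S.continuous_σ_clamp hp0).comp (continuous_fst (X := ℝ) (Y := ℝ))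
      exact ((continuous_snd.sub this).abs).div_const _
    have := hc.tendsto (X₀, y₀)
    simpa [hp, σ_inv_clamp] using this
  rw [ContinuousAt, tendsto_iff_dist_tendsto_zero]
  refine squeeze_zero (fun _ => dist_nonneg) (fun z => ?_) h1
  rw [Real.dist_eq]
  have := S.abs_sub_le (clamp_mem S.le z.1) hp0 (S.inv_pos z.1 z.2)
  rwa [σ_inv_clamp] at this

lemma continuous_inv_comp {g : ℝ → ℝ} (hg : Continuous g) : Continuous fun X => S.inv X (g X) :=
  S.continuous_inv.comp (continuous_id.prodMk hg)

/-- The map with stress `g` that fixes `a`. -/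
noncomputable def flow (g : ℝ → ℝ) (X : ℝ) : ℝ := a + ∫ Y in a..X, S.inv Y (g Y)

lemma hasDerivAt_flow {g : ℝ → ℝ} (hg : Continuous g) (X : ℝ) :
    HasDerivAt (S.flow g) (S.inv X (g X)) X :=
  ((S.continuous_inv_comp hg).integral_hasStrictDerivAt a X).hasDerivAt.const_add a

lemma flow_left (g : ℝ → ℝ) : S.flow g a = a := by simp [flow]

lemma continuous_flow {g : ℝ → ℝ} (hg : Continuous g) : Continuous (S.flow g) :=
  continuous_iff_continuousAt.2 fun X => (S.hasDerivAt_flow hg X).continuousAt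

/-- The stresses of the maps that fix both endpoints. -/
def IsNormalized (g : ℝ → ℝ) : Prop := ∫ X in a..b, S.inv X (g X) = b - a

lemma flow_right {g : ℝ → ℝ} (h : S.IsNormalized g) : S.flow g b = b := by
  have h' : ∫ X in a..b, S.inv X (g X) = b - a := h
  rw [flow, h']; ring

lemma monotone_flow {g : ℝ → ℝ} (hg : Continuous g) : Monotone (S.flow g) :=
  monotone_of_hasDerivAt_nonneg (S.hasDerivAt_flow hg) fun _ => (S.inv_pos _ _).le

lemma isAdmissible_flow {g : ℝ → ℝ} (hg : Continuous g) (h : S.IsNormalized g) :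
    IsAdmissible a b (S.flow g) := by
  refine ⟨S.continuous_flow hg, fun X hX => ?_⟩
  have h1 := S.monotone_flow hg hX.1
  have h2 := S.monotone_flow hg hX.2
  rw [flow_left] at h1
  rw [S.flow_right h] at h2
  exact ⟨h1, h2⟩

lemma exists_bound_one : ∃ M, ∀ X ∈ Icc a b, |S.σ X 1| ≤ M := by
  have hc : ContinuousOn (fun X => S.σ X 1) (Icc a b) :=
    S.continuousOn.comp (f := fun X => (X, (1 : ℝ))) (by fun_prop) fun X hX => ⟨hX, by simp⟩
  obtain ⟨M, hM⟩ := isCompact_Icc.exists_bound_of_continuousOn hc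
  exact ⟨M, fun X hX => by simpa using hM X hX⟩

/-- The mean slope depends continuously on the added constant. It is at most `1` once the stress
lies below `σ(·, 1)` and at least `1` once it lies above. -/
lemma exists_isNormalized_add {g : ℝ → ℝ} (hg : Continuous g) :
    ∃ c, S.IsNormalized fun X => g X + c := by
  obtain ⟨M, hM⟩ := S.exists_bound_one
  obtain ⟨N, hN⟩ := isCompact_Icc.exists_bound_of_continuousOn (hg.continuousOn (s := Icc a b))
  have hcont : Continuous fun c => ∫ X in a..b, S.inv X (g X + c) := by
    apply continuous_parametric_intervalIntegral_of_continuous'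
    exact S.continuous_inv.comp (by fun_prop : Continuous fun z : ℝ × ℝ => (z.2, g z.2 + z.1))
  have hone : ∀ X ∈ Icc a b, S.inv X (S.σ X 1) = 1 := fun X hX => S.inv_σ hX one_pos
  have hint : ∀ c, IntervalIntegrable (fun X => S.inv X (g X + c)) volume a b := fun c =>
    (S.continuous_inv_comp (by fun_prop : Continuous fun X => g X + c)).intervalIntegrable _ _
  have h1 : ∫ X in a..b, S.inv X (g X + -(M + N)) ≤ b - a := by
    calc _ ≤ ∫ X in a..b, (1 : ℝ) := by
          refine integral_mono_on S.le (hint _) (by simp) fun X hX => ?_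
          rw [← hone X hX]
          refine S.inv_mono X ?_
          have h1 := abs_le.1 (hM X hX)
          have h2 := abs_le.1 (hN X hX)
          linarith
      _ = b - a := by simp
  have h2 : b - a ≤ ∫ X in a..b, S.inv X (g X + (M + N)) := by
    calc b - a = ∫ X in a..b, (1 : ℝ) := by simp
      _ ≤ _ := by
          refine integral_mono_on S.le (by simp) (hint _) fun X hX => ?_
          rw [← hone X hX]
          refine S.inv_mono X ?_
          have h1 := abs_le.1 (hM X hX)
          have h2 := abs_le.1 (hN X hX)
          linarith
  obtain ⟨c, hc⟩ := mem_range_of_exists_le_of_exists_ge hcont ⟨_, h1⟩ ⟨_, h2⟩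
  exact ⟨c, hc⟩

/-- Convexity of `Ψ X`: the tangent at `q` lies below the graph, by the mean value theorem and
monotonicity of `σ`. -/
lemma sub_le {X p q : ℝ} (hX : X ∈ Icc a b) (hp : 0 < p) (hq : 0 < q) :
    S.Ψ X q - S.Ψ X p ≤ S.σ X q * (q - p) := by
  have hd : ∀ z, 0 < z → HasDerivAt (S.Ψ X) (S.σ X z) z := S.hasDerivAt X hX
  rcases lt_trichotomy p q with h | h | h
  · obtain ⟨c, hc, he⟩ := exists_hasDerivAt_eq_slope (S.Ψ X) (S.σ X) h
      (fun z hz => (hd z (hp.trans_le hz.1)).continuousAt.continuousWithinAt)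
      fun z hz => hd z (hp.trans hz.1)
    have hm := S.mono X hX c q (hp.trans hc.1) hc.2.le
    have hpq : 0 < q - p := sub_pos.2 h
    rw [eq_div_iff hpq.ne'] at he
    rw [← he]
    have : 0 ≤ τ * (q - c) := mul_nonneg S.pos.le (sub_nonneg.2 hc.2.le)
    exact mul_le_mul_of_nonneg_right (by linarith) hpq.le
  · simp [h]
  · obtain ⟨c, hc, he⟩ := exists_hasDerivAt_eq_slope (S.Ψ X) (S.σ X) h
      (fun z hz => (hd z (hq.trans_le hz.1)).continuousAt.continuousWithinAt)
      fun z hz => hd z (hq.trans hz.1)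
    have hm := S.mono X hX q c hq hc.1.le
    have hpq : 0 < p - q := sub_pos.2 h
    rw [eq_div_iff hpq.ne'] at he
    have : 0 ≤ τ * (c - q) := mul_nonneg S.pos.le (sub_nonneg.2 hc.1.le)
    nlinarith [mul_le_mul_of_nonneg_right (by linarith : S.σ X q ≤ S.σ X c) hpq.le]

lemma continuousOn_energy_comp {p : ℝ → ℝ} (hp : ContinuousOn p (Icc a b))
    (h0 : ∀ X ∈ Icc a b, 0 < p X) : ContinuousOn (fun X => S.Ψ X (p X)) (Icc a b) :=
  S.continuousOn_energy.comp (f := fun X => (X, p X)) (continuousOn_id.prodMk hp)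
    fun X hX => ⟨hX, h0 X hX⟩

lemma intervalIntegrable_energy {p : ℝ → ℝ} (hp : ContinuousOn p (Icc a b))
    (h0 : ∀ X ∈ Icc a b, 0 < p X) : IntervalIntegrable (fun X => S.Ψ X (p X)) volume a b :=
  (S.continuousOn_energy_comp hp h0).intervalIntegrable_of_Icc S.le

/-- The stored energy of the map with stress `g`. -/
noncomputable def stored (g : ℝ → ℝ) : ℝ := ∫ X in a..b, S.Ψ X (S.inv X (g X))

lemma stored_sub_le {g k : ℝ → ℝ} (hg : Continuous g) (hk : Continuous k) :
    S.stored g - S.stored k ≤ ∫ X in a..b, g X * (S.inv X (g X) - S.inv X (k X)) := by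
  have i1 := S.intervalIntegrable_energy (S.continuous_inv_comp hg).continuousOn
    fun X _ => S.inv_pos X (g X)
  have i2 := S.intervalIntegrable_energy (S.continuous_inv_comp hk).continuousOn
    fun X _ => S.inv_pos X (k X)
  rw [stored, stored, ← intervalIntegral.integral_sub i1 i2]
  refine integral_mono_on S.le (i1.sub i2) ?_ fun X hX => ?_
  · exact (hg.mul ((S.continuous_inv_comp hg).sub (S.continuous_inv_comp hk))).intervalIntegrable _ _
  · have := S.sub_le hX (S.inv_pos X (k X)) (S.inv_pos X (g X))
    rwa [S.σ_inv hX] at this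

end StressLaw
end WassersteinBDF2

/-! ### Force laws and existence of a stress in balance with the force. -/

namespace WassersteinBDF2

open Set intervalIntegral

lemma eqOn_zero_of_integral_eq_zero {a b : ℝ} (hab : a < b) {f : ℝ → ℝ}
    (hf : ContinuousOn f (Icc a b)) (h0 : ∀ X ∈ Icc a b, 0 ≤ f X) (h : ∫ X in a..b, f X ≤ 0) :
    ∀ X ∈ Icc a b, f X = 0 := by
  by_contra! hc
  obtain ⟨X, hX, hne⟩ := hc
  have := intervalIntegral.integral_pos hab hf (fun Y hY => h0 Y (Ioc_subset_Icc_self hY))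
    ⟨X, hX, (h0 X hX).lt_of_ne' hne⟩
  linarith

/-- Used to replace constants that depend on an error `ε` by one fixed constant, the mean. -/
lemma integral_sq_sub_average_le {a b : ℝ} (hab : a < b) {u : ℝ → ℝ} (hu : Continuous u) (c : ℝ) :
    ∫ X in a..b, (u X - (∫ Y in a..b, u Y) / (b - a)) ^ 2 ≤ ∫ X in a..b, (u X - c) ^ 2 := by
  set m := (∫ Y in a..b, u Y) / (b - a) with hm
  have hba : b - a ≠ 0 := by linarith
  have h1 : ∫ Y in a..b, u Y = m * (b - a) := by rw [hm]; field_simp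
  have key : ∀ c : ℝ, ∫ X in a..b, (u X - c) ^ 2 =
      (∫ X in a..b, u X ^ 2) - 2 * c * (m * (b - a)) + c ^ 2 * (b - a) := by
    intro c
    have : ∀ X, (u X - c) ^ 2 = u X ^ 2 - 2 * c * u X + c ^ 2 := fun X => by ring
    simp_rw [this]
    rw [intervalIntegral.integral_add, intervalIntegral.integral_sub,
      intervalIntegral.integral_const_mul, h1]
    · simp; ring
    all_goals exact Continuous.intervalIntegrable (by fun_prop) _ _
  rw [key m, key c]
  nlinarith [mul_nonneg (sq_nonneg (m - c)) (sub_nonneg.2 hab.le)]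

lemma sq_integral_le {a b : ℝ} (hab : a < b) {u : ℝ → ℝ} (hu : Continuous u) :
    (∫ X in a..b, u X) ^ 2 ≤ (b - a) * ∫ X in a..b, u X ^ 2 := by
  set m := (∫ Y in a..b, u Y) / (b - a) with hm
  have hba : b - a ≠ 0 := by linarith
  have h1 : ∫ Y in a..b, u Y = m * (b - a) := by rw [hm]; field_simp
  have h0 : 0 ≤ ∫ X in a..b, (u X - m) ^ 2 :=
    intervalIntegral.integral_nonneg hab.le fun X _ => sq_nonneg _
  have : ∀ X, (u X - m) ^ 2 = u X ^ 2 - 2 * m * u X + m ^ 2 := fun X => by ring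
  simp_rw [this] at h0
  rw [intervalIntegral.integral_add, intervalIntegral.integral_sub,
      intervalIntegral.integral_const_mul, h1] at h0
  · simp only [intervalIntegral.integral_const, smul_eq_mul] at h0
    rw [h1]
    nlinarith [mul_le_mul_of_nonneg_left h0 (sub_nonneg.2 hab.le)]
  all_goals exact Continuous.intervalIntegrable (by fun_prop) _ _

lemma abs_integral_le_of_mem {a b : ℝ} {u : ℝ → ℝ} (hu : Continuous u) {X : ℝ}
    (hX : X ∈ Icc a b) : |∫ Y in a..X, u Y| ≤ ∫ Y in a..b, |u Y| := by
  refine (intervalIntegral.abs_integral_le_integral_abs hX.1).trans ?_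
  rw [← integral_add_adjacent_intervals (hu.abs.intervalIntegrable a X)
    (hu.abs.intervalIntegrable X b)]
  have : 0 ≤ ∫ Y in X..b, |u Y| := intervalIntegral.integral_nonneg hX.2 fun Y _ => abs_nonneg _
  linarith

lemma isAdmissible_id (a b : ℝ) : IsAdmissible a b id := ⟨continuous_id, fun _ h => h⟩

namespace ForceLaw

variable {a b : ℝ} (F : ForceLaw a b)

lemma K_nonneg (hab : a ≤ b) : 0 ≤ F.K :=
  (abs_nonneg _).trans (F.bound _ (isAdmissible_id a b) a (left_mem_Icc.2 hab))

lemma abs_integral_f_mul_le (hab : a ≤ b) {x : ℝ → ℝ} (hx : IsAdmissible a b x) {v : ℝ → ℝ} {δ : ℝ}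
    (hv : ∀ X ∈ Icc a b, |v X| ≤ δ) : |∫ X in a..b, F.f x X * v X| ≤ F.K * δ * (b - a) := by
  have := intervalIntegral.norm_integral_le_of_norm_le_const (a := a) (b := b)
    (f := fun X => F.f x X * v X) (C := F.K * δ) fun X hX => by
      rw [uIoc_of_le hab] at hX
      have hX' := Ioc_subset_Icc_self hX
      rw [Real.norm_eq_abs, abs_mul]
      exact mul_le_mul (F.bound x hx X hX') (hv X hX') (abs_nonneg _) (F.K_nonneg hab)
  rwa [Real.norm_eq_abs, abs_of_nonneg (sub_nonneg.2 hab)] at this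

/-- The expansion with error `1` together with the bound on the gradient; in particular `B` sees
only the values on `[a, b]`. -/
lemma exists_lipschitz (hab : a ≤ b) : ∃ δ₀ > 0, ∃ C, 0 ≤ C ∧ ∀ x y, IsAdmissible a b x →
    IsAdmissible a b y → ∀ δ, 0 ≤ δ → δ ≤ δ₀ → (∀ X ∈ Icc a b, |y X - x X| ≤ δ) →
    |F.B y - F.B x| ≤ C * δ := by
  obtain ⟨δ₀, h0, h⟩ := F.expansion 1 one_pos
  have hK := mul_nonneg (F.K_nonneg hab) (sub_nonneg.2 hab)
  refine ⟨δ₀, h0, 1 + F.K * (b - a), by linarith, fun x y hx hy δ _ hδ hd => ?_⟩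
  have h1 := h x y hx hy δ hδ hd
  have h2 := F.abs_integral_f_mul_le hab hx hd
  rw [abs_le] at *
  constructor <;> nlinarith

end ForceLaw

namespace StressLaw

variable {a b τ : ℝ} (S : StressLaw a b τ)

lemma flow_sub {g k : ℝ → ℝ} (hg : Continuous g) (hk : Continuous k) (X : ℝ) :
    S.flow k X - S.flow g X = ∫ Y in a..X, (S.inv Y (k Y) - S.inv Y (g Y)) := by
  rw [intervalIntegral.integral_sub ((S.continuous_inv_comp hk).intervalIntegrable _ _)
    ((S.continuous_inv_comp hg).intervalIntegrable _ _), flow, flow]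
  ring

lemma abs_flow_sub_le {g k : ℝ → ℝ} (hg : Continuous g) (hk : Continuous k) {X : ℝ}
    (hX : X ∈ Icc a b) :
    |S.flow k X - S.flow g X| ≤ ∫ Y in a..b, |S.inv Y (k Y) - S.inv Y (g Y)| := by
  rw [S.flow_sub hg hk]
  exact abs_integral_le_of_mem ((S.continuous_inv_comp hk).sub (S.continuous_inv_comp hg)) hX

lemma integral_abs_inv_sub_le {g k : ℝ → ℝ} (hg : Continuous g) (hk : Continuous k) {η : ℝ}
    (h : ∀ X ∈ Icc a b, |k X - g X| ≤ η) :
    ∫ Y in a..b, |S.inv Y (k Y) - S.inv Y (g Y)| ≤ η / τ * (b - a) := by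
  calc _ ≤ ∫ Y in a..b, η / τ := by
        refine integral_mono_on S.le ?_ (by simp) fun X hX =>
          (S.inv_lipschitz X _ _).trans (div_le_div_of_nonneg_right (h X hX) S.pos.le)
        exact ((S.continuous_inv_comp hk).sub (S.continuous_inv_comp hg)).abs.intervalIntegrable _ _
    _ = _ := by simp; ring

/-- Two normalized stresses agree at some point. -/
lemma exists_eq_of_isNormalized {g k : ℝ → ℝ} (hg : Continuous g) (hk : Continuous k)
    (hgn : S.IsNormalized g) (hkn : S.IsNormalized k) : ∃ X ∈ Icc a b, k X = g X := by
  obtain ⟨c, hc, h⟩ := exists_hasDerivAt_eq_slope (fun X => S.flow k X - S.flow g X)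
    (fun X => S.inv X (k X) - S.inv X (g X)) S.lt
    ((S.continuous_flow hk).sub (S.continuous_flow hg)).continuousOn
    fun X _ => (S.hasDerivAt_flow hk X).sub (S.hasDerivAt_flow hg X)
  have hc' := Ioo_subset_Icc_self hc
  simp only [S.flow_left, S.flow_right hgn, S.flow_right hkn, sub_self, zero_div] at h
  refine ⟨c, hc', ?_⟩
  rw [← S.σ_inv hc' (k c), ← S.σ_inv hc' (g c), sub_eq_zero.1 h]

/-- The mean slope is `1`. This pins the stress at one point, which turns a Lipschitz bound into a
uniform bound. -/
lemma exists_eq_one_of_isNormalized {g : ℝ → ℝ} (hg : Continuous g)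
    (hgn : S.IsNormalized g) : ∃ X ∈ Icc a b, g X = S.σ X 1 := by
  obtain ⟨c, hc, h⟩ := exists_hasDerivAt_eq_slope (S.flow g)
    (fun X => S.inv X (g X)) S.lt (S.continuous_flow hg).continuousOn
    fun X _ => S.hasDerivAt_flow hg X
  have hc' := Ioo_subset_Icc_self hc
  rw [S.flow_left, S.flow_right hgn, div_self (sub_pos.2 S.lt).ne'] at h
  exact ⟨c, hc', by rw [← h, S.σ_inv hc']⟩

/-- On a bounded range of stresses the stress law is Lipschitz. -/
lemma exists_sq_sub_le (R : ℝ) : ∃ L, 0 ≤ L ∧ ∀ X ∈ Icc a b, ∀ y z, |y| ≤ R → |z| ≤ R →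
    (y - z) ^ 2 ≤ L * ((y - z) * (S.inv X y - S.inv X z)) := by
  -- Stresses in `[-R, R]` correspond to slopes in a compact subinterval of `(0, ∞)`: `bot` gives
  -- the lower end, growth at rate `τ` from slope `1` the upper end.
  obtain ⟨m, hm, hbot⟩ := S.bot (-R)
  obtain ⟨M, hM⟩ := S.exists_bound_one
  obtain ⟨L, hL, h⟩ := S.lip m (1 + (R + M) / τ) hm
  have hlow : ∀ X ∈ Icc a b, ∀ y, |y| ≤ R → m ≤ S.inv X y := by
    intro X hX y hy
    by_contra! hc
    have := hbot X hX _ (S.inv_pos X y) hc.le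
    rw [S.σ_inv hX] at this
    linarith [(abs_le.1 hy).1]
  have hup : ∀ X ∈ Icc a b, ∀ y, |y| ≤ R → S.inv X y ≤ 1 + (R + M) / τ := by
    intro X hX y hy
    have h1 := S.abs_sub_le hX one_pos (S.inv_pos X y)
    rw [S.σ_inv hX] at h1
    have h2 : |y - S.σ X 1| / τ ≤ (R + M) / τ :=
      div_le_div_of_nonneg_right ((abs_sub _ _).trans (add_le_add hy (hM X hX))) S.pos.le
    linarith [le_abs_self (S.inv X y - 1)]
  have main : ∀ X ∈ Icc a b, ∀ y z, |y| ≤ R → |z| ≤ R → z ≤ y →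
      (y - z) ^ 2 ≤ L * ((y - z) * (S.inv X y - S.inv X z)) := by
    intro X hX y z hy hz hzy
    have := h X hX _ _ (hlow X hX z hz) (S.inv_mono X hzy) (hup X hX y hy)
    rw [S.σ_inv hX, S.σ_inv hX] at this
    nlinarith [mul_le_mul_of_nonneg_left this (sub_nonneg.2 hzy)]
  refine ⟨L, hL, fun X hX y z hy hz => ?_⟩
  rcases le_total z y with h | h
  · exact main X hX y z hy hz h
  · have := main X hX z y hz hy h
    nlinarith

open BoundedContinuousFunction in
/-- The total energy attains its minimum among normalized stresses with Lipschitz constant `K`. -/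
lemma exists_isMinimizer (F : ForceLaw a b) : ∃ g, Continuous g ∧ S.IsNormalized g ∧
    (∀ X ∈ Icc a b, ∀ Y ∈ Icc a b, |g X - g Y| ≤ F.K * |X - Y|) ∧
    ∀ k, Continuous k → S.IsNormalized k →
      (∀ X ∈ Icc a b, ∀ Y ∈ Icc a b, |k X - k Y| ≤ F.K * |X - Y|) →
      S.stored g + F.B (S.flow g) ≤ S.stored k + F.B (S.flow k) := by
  have hK := F.K_nonneg S.le
  -- Stresses are functions on the compact interval, extended by constants so that the integrals and
  -- flows on the line make sense.
  let e : (Icc a b →ᵇ ℝ) → ℝ → ℝ := fun g => IccExtend S.le g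
  have he : ∀ g, Continuous (e g) := fun g => g.continuous.Icc_extend'
  have heX : ∀ g, ∀ X (hX : X ∈ Icc a b), e g X = g ⟨X, hX⟩ := fun g X hX => IccExtend_of_mem _ _ hX
  have he2 : Continuous fun z : (Icc a b →ᵇ ℝ) × ℝ => e z.1 z.2 := by
    have : Continuous fun z : (Icc a b →ᵇ ℝ) × ℝ => (z.1, projIcc a b S.le z.2) := by fun_prop
    exact continuous_eval.comp this
  have hinv2 : Continuous fun z : (Icc a b →ᵇ ℝ) × ℝ => S.inv z.2 (e z.1 z.2) :=
    S.continuous_inv.comp (continuous_snd.prodMk he2)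
  -- The constant `K` is the bound for the force, so primitives of forces satisfy the same Lipschitz
  -- condition.
  let A : Set (Icc a b →ᵇ ℝ) := {g | (∀ X Y, |g X - g Y| ≤ F.K * dist X Y) ∧ S.IsNormalized (e g)}
  have hAlip : ∀ g ∈ A, ∀ X ∈ Icc a b, ∀ Y ∈ Icc a b, |e g X - e g Y| ≤ F.K * |X - Y| := by
    intro g hg X hX Y hY
    rw [heX g X hX, heX g Y hY]
    exact hg.1 ⟨X, hX⟩ ⟨Y, hY⟩
  have hclosed : IsClosed A := by
    refine IsClosed.inter ?_ ?_
    · have : {g : Icc a b →ᵇ ℝ | ∀ X Y, |g X - g Y| ≤ F.K * dist X Y} =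
          ⋂ X, ⋂ Y, {g | |g X - g Y| ≤ F.K * dist X Y} := by ext g; simp only [mem_iInter]; rfl
      change IsClosed {g : Icc a b →ᵇ ℝ | ∀ X Y, |g X - g Y| ≤ F.K * dist X Y}
      rw [this]
      refine isClosed_iInter fun X => isClosed_iInter fun Y => isClosed_le ?_ continuous_const
      exact ((continuous_eval_const X).sub (continuous_eval_const Y)).abs
    · exact isClosed_eq (continuous_parametric_intervalIntegral_of_continuous'
        (f := fun g X => S.inv X (e g X)) hinv2 a b) continuous_const
  obtain ⟨M, hM⟩ := S.exists_bound_one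
  have hbound : ∀ g ∈ A, ∀ X, g X ∈ Icc (-(M + F.K * (b - a))) (M + F.K * (b - a)) := by
    intro g hg X
    obtain ⟨c, hc, hgc⟩ := S.exists_eq_one_of_isNormalized (he g) hg.2
    rw [heX g c hc] at hgc
    have h1 := hg.1 X ⟨c, hc⟩
    have h2 := hM c hc
    have h3 : dist X ⟨c, hc⟩ ≤ b - a := by
      rw [Subtype.dist_eq, Real.dist_eq, abs_le]
      have := X.2.1; have := X.2.2; have := hc.1; have := hc.2
      constructor <;> dsimp only <;> linarith
    have h4 := mul_le_mul_of_nonneg_left h3 hK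
    rw [hgc] at h1
    rw [abs_le] at h1 h2
    constructor <;> linarith
  have hcomp : IsCompact A := by
    refine arzela_ascoli₂ _ isCompact_Icc A hclosed (fun g X hg => hbound g hg X) ?_
    refine Metric.equicontinuous_of_continuity_modulus (fun t => F.K * t) ?_ _ ?_
    · have : Continuous fun t : ℝ => F.K * t := by fun_prop
      simpa using this.tendsto 0
    · exact fun X Y g => g.2.1 X Y
  have hne : A.Nonempty := by
    obtain ⟨c, hc⟩ := S.exists_isNormalized_add (g := fun _ => 0) continuous_const
    refine ⟨BoundedContinuousFunction.const _ c, fun X Y => ?_, ?_⟩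
    · simpa using mul_nonneg hK dist_nonneg
    · simp only [zero_add] at hc
      exact hc
  have hstored : Continuous fun g => S.stored (e g) := by
    have h1 : Continuous fun z : (Icc a b →ᵇ ℝ) × ℝ =>
        S.Ψ (clamp a b z.2) (S.inv z.2 (e z.1 z.2)) := by
      rw [← continuousOn_univ]
      refine S.continuousOn_energy.comp
        (f := fun z : (Icc a b →ᵇ ℝ) × ℝ => (clamp a b z.2, S.inv z.2 (e z.1 z.2))) ?_
        fun z _ => ⟨clamp_mem S.le _, S.inv_pos _ _⟩
      exact ((continuous_clamp a b).comp continuous_snd).prodMk hinv2 |>.continuousOn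
    have h2 := continuous_parametric_intervalIntegral_of_continuous' (μ := volume)
      (f := fun g X => S.Ψ (clamp a b X) (S.inv X (e g X))) h1 a b
    refine h2.congr fun g => ?_
    refine intervalIntegral.integral_congr fun X hX => ?_
    rw [uIcc_of_le S.le] at hX
    simp only [clamp_of_mem hX]
  have hB : ContinuousOn (fun g => F.B (S.flow (e g))) A := by
    obtain ⟨δ₀, hδ₀, C, hC, hlip⟩ := F.exists_lipschitz S.le
    intro g hg
    rw [ContinuousWithinAt, tendsto_iff_dist_tendsto_zero]
    have hd : Tendsto (fun k : Icc a b →ᵇ ℝ => dist k g / τ * (b - a)) (𝓝[A] g) (𝓝 0) := by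
      have : Continuous fun k : Icc a b →ᵇ ℝ => dist k g / τ * (b - a) := by fun_prop
      simpa using (this.tendsto g).mono_left nhdsWithin_le_nhds
    refine squeeze_zero' (.of_forall fun _ => dist_nonneg) ?_ (by simpa using hd.const_mul C)
    filter_upwards [hd.eventually_le_const hδ₀, self_mem_nhdsWithin] with k hk hkA
    refine hlip _ _ (S.isAdmissible_flow (he g) hg.2) (S.isAdmissible_flow (he k) hkA.2) _
      (mul_nonneg (div_nonneg dist_nonneg S.pos.le) (sub_nonneg.2 S.le)) hk fun X hX => ?_
    refine (S.abs_flow_sub_le (he g) (he k) hX).trans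
      (S.integral_abs_inv_sub_le (he g) (he k) fun Y hY => ?_)
    rw [heX k Y hY, heX g Y hY]
    exact BoundedContinuousFunction.dist_coe_le_dist (f := k) (g := g) ⟨Y, hY⟩
  obtain ⟨g, hg, hmin⟩ := hcomp.exists_isMinOn hne (hstored.continuousOn.add hB)
  refine ⟨e g, he g, hg.2, hAlip g hg, fun k hk hkn hkl => ?_⟩
  let k' : Icc a b →ᵇ ℝ := BoundedContinuousFunction.mkOfCompact ⟨fun X => k X, by fun_prop⟩
  have hkk : ∀ X ∈ Icc a b, e k' X = k X := fun X hX => by rw [heX k' X hX]; rfl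
  have hn : S.IsNormalized (e k') := by
    rw [IsNormalized, ← hkn.symm.symm]
    refine intervalIntegral.integral_congr fun X hX => ?_
    rw [uIcc_of_le S.le] at hX
    simp only [hkk X hX]
  have hk'A : k' ∈ A := ⟨fun X Y => hkl X X.2 Y Y.2, hn⟩
  have h1 : S.stored (e k') = S.stored k := by
    refine intervalIntegral.integral_congr fun X hX => ?_
    rw [uIcc_of_le S.le] at hX
    simp only [hkk X hX]
  obtain ⟨δ₀, hδ₀, C, hC, hlip⟩ := F.exists_lipschitz S.le
  -- The two flows agree on `[a, b]` but need not be equal functions; the Lipschitz estimate with `δ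
  -- = 0` identifies the values of `B`.
  have h2 : F.B (S.flow (e k')) = F.B (S.flow k) := by
    have := hlip _ _ (S.isAdmissible_flow hk hkn) (S.isAdmissible_flow (he k') hn) 0 le_rfl hδ₀.le
      fun X hX => by
        refine (S.abs_flow_sub_le hk (he k') hX).trans
          ((S.integral_abs_inv_sub_le hk (he k') (η := 0) fun Y hY => ?_).trans (by simp))
        rw [hkk Y hY]; simp
    rw [mul_zero] at this
    exact sub_eq_zero.1 (abs_eq_zero.1 (le_antisymm this (abs_nonneg _)))
  have := hmin hk'A
  change S.stored (e g) + F.B (S.flow (e g)) ≤ S.stored (e k') + F.B (S.flow (e k')) at this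
  rwa [h1, h2] at this

/-- A map whose stress balances the force. -/
theorem exists_equilibrium (F : ForceLaw a b) : ∃ g c, Continuous g ∧ S.IsNormalized g ∧
    ∀ X ∈ Icc a b, g X = c + ∫ Y in a..X, F.f (S.flow g) Y := by
  obtain ⟨g, hg, hgn, hgl, hmin⟩ := S.exists_isMinimizer F
  have hadm := S.isAdmissible_flow hg hgn
  set f := F.f (S.flow g) with hf
  have hfc : Continuous f := F.continuous _ hadm
  -- The goal is that `u = G - g` is constant. `G` is `K`-Lipschitz, so the segment from `g` to `G`
  -- does not leave the admissible class.
  set G : ℝ → ℝ := fun X => ∫ Y in a..X, f Y with hG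
  have hGd : ∀ X, HasDerivAt G (f X) X := fun X => (hfc.integral_hasStrictDerivAt a X).hasDerivAt
  have hGc : Continuous G := continuous_iff_continuousAt.2 fun X => (hGd X).continuousAt
  have hGl : ∀ X ∈ Icc a b, ∀ Y ∈ Icc a b, |G X - G Y| ≤ F.K * |X - Y| := by
    intro X hX Y hY
    have h1 : G X - G Y = ∫ Z in Y..X, f Z :=
      integral_interval_sub_left (hfc.intervalIntegrable _ _) (hfc.intervalIntegrable _ _)
    rw [h1]
    refine intervalIntegral.norm_integral_le_of_norm_le_const (f := f) fun Z hZ => ?_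
    exact F.bound _ hadm Z ((ordConnected_Icc.uIcc_subset hY hX) (uIoc_subset_uIcc hZ))
  set u : ℝ → ℝ := fun X => G X - g X with hu
  have huc : Continuous u := hGc.sub hg
  obtain ⟨N, hN⟩ := isCompact_Icc.exists_bound_of_continuousOn (huc.continuousOn (s := Icc a b))
  obtain ⟨R, hR⟩ := isCompact_Icc.exists_bound_of_continuousOn (hg.continuousOn (s := Icc a b))
  simp only [Real.norm_eq_abs] at hN hR
  have hN0 : 0 ≤ N := (abs_nonneg _).trans (hN a (left_mem_Icc.2 S.le))
  obtain ⟨L, hL, hLip⟩ := S.exists_sq_sub_le (R + 2 * N)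
  set C₀ := (b - a) / τ with hC₀
  have hC₀p : 0 < C₀ := div_pos (sub_pos.2 S.lt) S.pos
  -- Only a first-order expansion of `B` is available, so `u` is shown to be within `O(ε)` of some
  -- constant in `L²`. The bound is obtained with the step `t` fixed, small in terms of `ε`.
  have key : ∀ ε > 0, ∃ c, ∫ X in a..b, (u X - c) ^ 2 ≤ 4 * L * C₀ * ε ^ 2 := by
    intro ε hε
    obtain ⟨δ₀, hδ₀, hexp⟩ := F.expansion ε hε
    obtain ⟨t, ht0, ht2, htδ⟩ : ∃ t : ℝ, 0 < t ∧ t ≤ 1 / 2 ∧ t * (2 * N * C₀) ≤ δ₀ := by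
      refine ⟨min (1 / 2) (δ₀ / (2 * N * C₀ + 1)), by positivity, min_le_left _ _, ?_⟩
      calc _ ≤ δ₀ / (2 * N * C₀ + 1) * (2 * N * C₀) :=
            mul_le_mul_of_nonneg_right (min_le_right _ _) (by positivity)
        _ = δ₀ * (2 * N * C₀ / (2 * N * C₀ + 1)) := by ring
        _ ≤ δ₀ * 1 := mul_le_mul_of_nonneg_left
            ((div_le_one (by positivity)).2 (by linarith)) hδ₀.le
        _ = δ₀ := mul_one _
    -- The constant `c` restores the right endpoint and does not affect the Lipschitz bound.
    obtain ⟨c, hc⟩ := S.exists_isNormalized_add (g := fun X => g X + t * u X) (by fun_prop)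
    set k : ℝ → ℝ := fun X => g X + t * u X + c with hk
    have hkc : Continuous k := by fun_prop
    have hkl : ∀ X ∈ Icc a b, ∀ Y ∈ Icc a b, |k X - k Y| ≤ F.K * |X - Y| := by
      intro X hX Y hY
      have : k X - k Y = (1 - t) * (g X - g Y) + t * (G X - G Y) := by simp only [hk, hu]; ring
      rw [this]
      refine (abs_add_le _ _).trans ?_
      rw [abs_mul, abs_mul, abs_of_pos ht0, abs_of_pos (by linarith : 0 < 1 - t)]
      have h1 := mul_le_mul_of_nonneg_left (hgl X hX Y hY) (by linarith : 0 ≤ 1 - t)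
      have h2 := mul_le_mul_of_nonneg_left (hGl X hX Y hY) ht0.le
      linarith
    have hle := hmin k hkc hc hkl
    have hc_le : |c| ≤ t * N := by
      obtain ⟨X, hX, he⟩ := S.exists_eq_of_isNormalized hg hkc hgn hc
      have : c = -(t * u X) := by simp only [hk] at he; linarith
      rw [this, abs_neg, abs_mul, abs_of_pos ht0]
      exact mul_le_mul_of_nonneg_left (hN X hX) ht0.le
    have hkg : ∀ X ∈ Icc a b, |k X - g X| ≤ 2 * t * N := by
      intro X hX
      have h1 : k X - g X = t * u X + c := by simp only [hk]; ring
      rw [h1]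
      refine (abs_add_le _ _).trans ?_
      rw [abs_mul, abs_of_pos ht0]
      linarith [mul_le_mul_of_nonneg_left (hN X hX) ht0.le]
    set D : ℝ → ℝ := fun X => S.inv X (k X) - S.inv X (g X) with hD
    have hDc : Continuous D := (S.continuous_inv_comp hkc).sub (S.continuous_inv_comp hg)
    set I := ∫ X in a..b, |D X| with hI
    have hI0 : 0 ≤ I := intervalIntegral.integral_nonneg S.le fun X _ => abs_nonneg _
    have hIδ : I ≤ δ₀ := by
      refine (S.integral_abs_inv_sub_le hg hkc hkg).trans (le_trans (le_of_eq ?_) htδ)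
      rw [hC₀]; ring
    set Q := ∫ X in a..b, (k X - g X) * D X with hQ
    have hstored : S.stored k - S.stored g ≤ ∫ X in a..b, k X * D X := S.stored_sub_le hkc hg
    -- The sup distance of the flows is at most `I`, the `L¹` norm of the change of slope, so the
    -- error in `B` is at most `ε * I`.
    have hBle := (abs_le.1 (hexp _ _ hadm (S.isAdmissible_flow hkc hc) I hIδ
      fun X hX => S.abs_flow_sub_le hg hkc hX)).2
    have hparts : ∫ X in a..b, f X * (S.flow k X - S.flow g X) = -∫ X in a..b, G X * D X := by
      have := integral_mul_deriv_eq_deriv_mul (a := a) (b := b) (u := G) (u' := f)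
        (v := fun X => S.flow k X - S.flow g X) (v' := D)
        (fun X _ => hGd X) (fun X _ => (S.hasDerivAt_flow hkc X).sub (S.hasDerivAt_flow hg X))
        (hfc.intervalIntegrable _ _) (hDc.intervalIntegrable _ _)
      rw [this]
      simp [S.flow_left, S.flow_right hgn, S.flow_right hc]
    have hDint : ∫ X in a..b, D X = 0 := by
      rw [hD, intervalIntegral.integral_sub ((S.continuous_inv_comp hkc).intervalIntegrable _ _)
        ((S.continuous_inv_comp hg).intervalIntegrable _ _), hgn, hc, sub_self]
    -- From `t (k - G) = -(1 - t)(k - g) + c`, where the constant disappears because `D` has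
    -- integral zero.
    have hcomb : t * ((∫ X in a..b, k X * D X) - ∫ X in a..b, G X * D X) = -(1 - t) * Q := by
      rw [← intervalIntegral.integral_sub
        (Continuous.intervalIntegrable (by fun_prop : Continuous fun X => k X * D X) _ _)
        (Continuous.intervalIntegrable (by fun_prop : Continuous fun X => G X * D X) _ _), ← intervalIntegral.integral_const_mul]
      have : ∀ X, t * (k X * D X - G X * D X) = -(1 - t) * ((k X - g X) * D X) + c * D X := by
        intro X; simp only [hk, hu]; ring
      simp_rw [this]
      rw [intervalIntegral.integral_add, intervalIntegral.integral_const_mul,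
        intervalIntegral.integral_const_mul, hDint]
      · ring
      all_goals exact Continuous.intervalIntegrable (by fun_prop) _ _
    have hQle : Q ≤ 2 * t * ε * I := by
      have h1 : 0 ≤ ((∫ X in a..b, k X * D X) - ∫ X in a..b, G X * D X) + ε * I := by
        rw [hparts] at hBle; linarith
      have h2 := mul_nonneg ht0.le h1
      have h3 : (1 - t) * Q ≤ t * ε * I := by nlinarith
      have h4 : 0 ≤ t * ε * I := by positivity
      by_cases hQ0 : 0 ≤ Q
      · nlinarith
      · linarith
    have hQge : τ * ∫ X in a..b, D X ^ 2 ≤ Q := by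
      rw [hQ, ← intervalIntegral.integral_const_mul]
      refine integral_mono_on S.le (Continuous.intervalIntegrable (by fun_prop) _ _)
        (Continuous.intervalIntegrable (by fun_prop) _ _) fun X _ => S.inv_strong_mono X _ _
    have hI2 : I ^ 2 ≤ C₀ * Q := by
      have h1 := sq_integral_le S.lt hDc.abs
      simp only [sq_abs] at h1
      refine h1.trans ?_
      rw [hC₀, div_mul_eq_mul_div, le_div_iff₀ S.pos]
      nlinarith [mul_le_mul_of_nonneg_left hQge (sub_pos.2 S.lt).le]
    -- Self-improvement: `I ^ 2 ≤ C₀ Q ≤ 2 C₀ t ε I`, and dividing by `I` makes `Q` quadratic in `t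
    -- ε`. This matches the factor `t ^ 2` in `∫ (k - g) ^ 2`, which then cancels.
    have hIle : I ≤ 2 * C₀ * t * ε := by
      by_contra! hcon
      have h1 : 0 < I := lt_of_le_of_lt (by positivity) hcon
      nlinarith [mul_le_mul_of_nonneg_left hQle hC₀p.le, mul_lt_mul_of_pos_left hcon h1]
    have hQ2 : Q ≤ 4 * C₀ * ε ^ 2 * t ^ 2 := by
      have : 2 * t * ε * I ≤ 2 * t * ε * (2 * C₀ * t * ε) :=
        mul_le_mul_of_nonneg_left hIle (by positivity)
      nlinarith
    have hsq : ∫ X in a..b, (k X - g X) ^ 2 ≤ L * Q := by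
      rw [hQ, ← intervalIntegral.integral_const_mul]
      refine integral_mono_on S.le (Continuous.intervalIntegrable (by fun_prop) _ _)
        (Continuous.intervalIntegrable (by fun_prop) _ _) fun X hX => hLip X hX _ _ ?_ ?_
      · have h1 := hkg X hX
        have h2 : 2 * t * N ≤ 2 * N := by nlinarith
        have h3 : |k X| ≤ |k X - g X| + |g X| := by
          simpa using abs_add_le (k X - g X) (g X)
        linarith [hR X hX]
      · linarith [hR X hX]
    refine ⟨-(c / t), ?_⟩
    have hrw : ∀ X, (k X - g X) ^ 2 = t ^ 2 * (u X - -(c / t)) ^ 2 := by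
      intro X; simp only [hk]; field_simp; ring
    simp_rw [hrw] at hsq
    rw [intervalIntegral.integral_const_mul] at hsq
    have h5 : t ^ 2 * ∫ X in a..b, (u X - -(c / t)) ^ 2 ≤ t ^ 2 * (4 * L * C₀ * ε ^ 2) := by
      nlinarith [mul_le_mul_of_nonneg_left hQ2 hL]
    exact le_of_mul_le_mul_left h5 (by positivity)
  set m := (∫ Y in a..b, u Y) / (b - a) with hm
  have hzero : ∫ X in a..b, (u X - m) ^ 2 ≤ 0 := by
    have h1 : ∀ ε > 0, ∫ X in a..b, (u X - m) ^ 2 ≤ 4 * L * C₀ * ε ^ 2 := fun ε hε => by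
      obtain ⟨c, hc⟩ := key ε hε
      exact (integral_sq_sub_average_le S.lt huc c).trans hc
    have h2 : Tendsto (fun ε : ℝ => 4 * L * C₀ * ε ^ 2) (𝓝[>] 0) (𝓝 0) := by
      have : Continuous fun ε : ℝ => 4 * L * C₀ * ε ^ 2 := by fun_prop
      simpa using (this.tendsto 0).mono_left nhdsWithin_le_nhds
    exact ge_of_tendsto h2 (by filter_upwards [self_mem_nhdsWithin] with ε hε using h1 ε hε)
  have hall := eqOn_zero_of_integral_eq_zero S.lt
    (by fun_prop : Continuous fun X => (u X - m) ^ 2).continuousOn (fun X _ => sq_nonneg _) hzero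
  refine ⟨g, -m, hg, hgn, fun X hX => ?_⟩
  have := pow_eq_zero_iff (two_ne_zero) |>.1 (hall X hX)
  simp only [hu, hG] at this
  linarith

end StressLaw
end WassersteinBDF2

/-! ### The one-dimensional data and uniform first-order expansions of inertia, drift and
interaction. -/

namespace WassersteinBDF2

open Set intervalIntegral

/-- The derivative is uniformly continuous on `K`; apply the mean value inequality on the segment
from `u` to `v`, which convexity keeps in `K`. -/
lemma uniform_expansion {E : Type*} [NormedAddCommGroup E] [NormedSpace ℝ E] {F : E → ℝ}
    (hF : ContDiff ℝ 1 F) {K : Set E} (hK : IsCompact K) (hc : Convex ℝ K) {ε : ℝ} (hε : 0 < ε) :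
    ∃ δ > 0, ∀ u ∈ K, ∀ v ∈ K, ‖v - u‖ ≤ δ →
      |F v - F u - fderiv ℝ F u (v - u)| ≤ ε * ‖v - u‖ := by
  have hu := hK.uniformContinuousOn_of_continuous (hF.continuous_fderiv one_ne_zero).continuousOn
  obtain ⟨δ, hδ, h⟩ := Metric.uniformContinuousOn_iff.1 hu ε hε
  refine ⟨δ / 2, half_pos hδ, fun u hu v hv huv => ?_⟩
  have hseg : segment ℝ u v ⊆ K := hc.segment_subset hu hv
  refine (convex_segment u v).norm_image_sub_le_of_norm_hasFDerivWithin_le'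
    (f := F) (f' := fderiv ℝ F) (fun z _ => (hF.differentiable one_ne_zero z).hasFDerivAt.hasFDerivWithinAt)
    (fun z hz => ?_) (left_mem_segment ℝ u v) (right_mem_segment ℝ u v)
  rw [← dist_eq_norm]
  refine (h z (hseg hz) u hu ?_).le
  have h1 : dist z u ≤ dist v u := by
    obtain ⟨p, q, hp, hq, hpq, rfl⟩ := hz
    have : p • u + q • v - u = q • (v - u) := by
      rw [← eq_sub_iff_add_eq] at hpq; rw [hpq]; module
    rw [dist_eq_norm, dist_eq_norm, this, norm_smul, Real.norm_of_nonneg hq]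
    exact mul_le_of_le_one_left (norm_nonneg _) (by linarith)
  rw [dist_eq_norm v u] at h1
  linarith

lemma abs_integral_le {a b : ℝ} (hab : a ≤ b) {f : ℝ → ℝ} {C : ℝ}
    (h : ∀ X ∈ Icc a b, |f X| ≤ C) : |∫ X in a..b, f X| ≤ C * (b - a) := by
  have := intervalIntegral.norm_integral_le_of_norm_le_const (a := a) (b := b) (f := f) (C := C)
    fun X hX => h X (by rw [uIoc_of_le hab] at hX; exact Ioc_subset_Icc_self hX)
  rwa [Real.norm_eq_abs, abs_of_nonneg (sub_nonneg.2 hab)] at this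

lemma integral_swap_of_continuous {a b : ℝ} {F : ℝ → ℝ → ℝ}
    (hF : Continuous (Function.uncurry F)) :
    ∫ X in a..b, ∫ Y in a..b, F X Y = ∫ Y in a..b, ∫ X in a..b, F X Y :=
  intervalIntegral_intervalIntegral_swap ((hF.continuousOn.integrableOn_compact
    (isCompact_uIcc.prod isCompact_uIcc)).mono_set (prod_mono uIoc_subset_uIcc uIoc_subset_uIcc))

lemma continuous_uncurry_sub {F G : ℝ → ℝ → ℝ} (hF : Continuous (Function.uncurry F))
    (hG : Continuous (Function.uncurry G)) : Continuous (Function.uncurry (F - G)) := hF.sub hG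

lemma continuous_uncurry_add {F G : ℝ → ℝ → ℝ} (hF : Continuous (Function.uncurry F))
    (hG : Continuous (Function.uncurry G)) : Continuous (Function.uncurry (F + G)) := hF.add hG

lemma integral₂_sub {a b : ℝ} {F G : ℝ → ℝ → ℝ} (hF : Continuous (Function.uncurry F))
    (hG : Continuous (Function.uncurry G)) :
    ∫ X in a..b, ∫ Y in a..b, (F - G) X Y =
      (∫ X in a..b, ∫ Y in a..b, F X Y) - ∫ X in a..b, ∫ Y in a..b, G X Y := by
  rw [← intervalIntegral.integral_sub
    ((continuous_parametric_intervalIntegral_of_continuous' hF _ _).intervalIntegrable _ _)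
    ((continuous_parametric_intervalIntegral_of_continuous' hG _ _).intervalIntegrable _ _)]
  refine intervalIntegral.integral_congr fun X _ => ?_
  exact intervalIntegral.integral_sub
    ((hF.comp (by fun_prop : Continuous fun Y : ℝ => (X, Y))).intervalIntegrable _ _)
    ((hG.comp (by fun_prop : Continuous fun Y : ℝ => (X, Y))).intervalIntegrable _ _)

lemma integral₂_add {a b : ℝ} {F G : ℝ → ℝ → ℝ} (hF : Continuous (Function.uncurry F))
    (hG : Continuous (Function.uncurry G)) :
    ∫ X in a..b, ∫ Y in a..b, (F + G) X Y =
      (∫ X in a..b, ∫ Y in a..b, F X Y) + ∫ X in a..b, ∫ Y in a..b, G X Y := by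
  rw [← intervalIntegral.integral_add
    ((continuous_parametric_intervalIntegral_of_continuous' hF _ _).intervalIntegrable _ _)
    ((continuous_parametric_intervalIntegral_of_continuous' hG _ _).intervalIntegrable _ _)]
  refine intervalIntegral.integral_congr fun X _ => ?_
  exact intervalIntegral.integral_add
    ((hF.comp (by fun_prop : Continuous fun Y : ℝ => (X, Y))).intervalIntegrable _ _)
    ((hG.comp (by fun_prop : Continuous fun Y : ℝ => (X, Y))).intervalIntegrable _ _)

/-- The one-dimensional data: an interval `(a, b)`, the densities and potentials, and the time
step. -/
structure LineData where
  a : ℝ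
  b : ℝ
  τ : ℝ
  r : ℝ
  ρ : ℝ → ℝ
  U : ℝ → ℝ
  V : ℝ → ℝ
  W : ℝ → ℝ → ℝ
  prev : ℝ → ℝ
  cur : ℝ → ℝ

namespace LineData

/-- The regularity assumptions. -/
structure Regular (L : LineData) : Prop where
  lt : L.a < L.b
  τ_pos : 0 < L.τ
  r_pos : 0 < L.r
  ρ : ContDiff ℝ 1 L.ρ
  ρ_pos : ∀ X ∈ Icc L.a L.b, 0 < L.ρ X
  U : ContDiffOn ℝ 2 L.U (Ioi 0)
  superlinear : Tendsto (fun s => L.U s / s) atTop atTop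
  V : ContDiff ℝ 1 L.V
  W : ContDiff ℝ 1 (fun p : ℝ × ℝ => L.W p.1 p.2)
  symm : ∀ x y, L.W x y = L.W y x
  prev : Continuous L.prev
  cur : ContDiff ℝ 2 L.cur

variable (L : LineData)

/-- The BDF2 combination. -/
def bdf (x : ℝ → ℝ) (X : ℝ) : ℝ :=
  (1 + 2 * L.r) * x X - (1 + L.r) ^ 2 * L.cur X + L.r ^ 2 * L.prev X

/-- The internal energy density. -/
noncomputable def internal (x : ℝ → ℝ) (X : ℝ) : ℝ := L.U (L.ρ X / deriv x X) * deriv x X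

/-- The maps of finite energy. -/
def dom : Set (ℝ → ℝ) :=
  {x | (ContDiff ℝ 2 x ∧ x L.a = L.a ∧ x L.b = L.b) ∧
    (∀ᵐ X ∂(volume.restrict (Ioo L.a L.b)), 0 < deriv x X) ∧
    IntegrableOn (L.internal x) (Ioo L.a L.b)}

/-- The drift and interaction energy. -/
noncomputable def potentialEnergy (x : ℝ → ℝ) : ℝ :=
  (∫ X in L.a..L.b, L.V (x X) * L.ρ X) +
    1 / 2 * ∫ X in L.a..L.b, ∫ Y in L.a..L.b, L.W (x X) (x Y) * L.ρ X * L.ρ Y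

/-- The energy. -/
noncomputable def energy (x : ℝ → ℝ) : ℝ := (∫ X in L.a..L.b, L.internal x X) + L.potentialEnergy x

/-- The kinetic part of the step functional. -/
noncomputable def inertia (x : ℝ → ℝ) : ℝ :=
  1 / (2 * L.τ) * ∫ X in L.a..L.b, L.ρ X * (L.bdf x X ^ 2 / ((1 + L.r) * (1 + 2 * L.r)))

/-- The step functional. -/
noncomputable def functional (x : ℝ → ℝ) : ℝ :=
  L.inertia x + L.energy x + L.τ / 2 * ∫ X in L.a..L.b, (deriv x X - deriv L.cur X) ^ 2

/-- The partial derivative of the interaction potential in its first argument. -/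
noncomputable def W₁ (y z : ℝ) : ℝ := fderiv ℝ (fun p : ℝ × ℝ => L.W p.1 p.2) (y, z) (1, 0)

/-- The gradient of the drift and interaction energy. -/
noncomputable def potentialForce (x : ℝ → ℝ) (X : ℝ) : ℝ :=
  L.ρ X * (deriv L.V (x X) + ∫ Y in L.a..L.b, L.W₁ (x X) (x Y) * L.ρ Y)

/-- The gradient of the kinetic part. -/
noncomputable def inertiaForce (x : ℝ → ℝ) (X : ℝ) : ℝ :=
  L.ρ X / (L.τ * (1 + L.r)) * L.bdf x X

namespace Regular

variable {L} (H : L.Regular)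
include H

lemma le : L.a ≤ L.b := H.lt.le

lemma continuous_ρ : Continuous L.ρ := H.ρ.continuous

lemma continuous_W₁ : Continuous fun p : ℝ × ℝ => L.W₁ p.1 p.2 := by
  have := H.W.continuous_fderiv one_ne_zero
  exact (this.comp (by fun_prop : Continuous fun p : ℝ × ℝ => (p.1, p.2))).clm_apply continuous_const

lemma continuous_deriv_V : Continuous (deriv L.V) := H.V.continuous_deriv le_rfl

/-- Symmetry of `W` expresses the second partial derivative through the first one with its arguments
exchanged. -/
lemma fderiv_W (y z h k : ℝ) :
    fderiv ℝ (fun p : ℝ × ℝ => L.W p.1 p.2) (y, z) (h, k) = L.W₁ y z * h + L.W₁ z y * k := by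
  have hd : DifferentiableAt ℝ (fun p : ℝ × ℝ => L.W p.1 p.2) (z, y) :=
    H.W.differentiable one_ne_zero _
  have hs : fderiv ℝ (fun p : ℝ × ℝ => L.W p.1 p.2) (y, z) (0, 1) = L.W₁ z y := by
    have h1 : (fun p : ℝ × ℝ => L.W p.1 p.2) =
        (fun p : ℝ × ℝ => L.W p.1 p.2) ∘ (ContinuousLinearEquiv.prodComm ℝ ℝ ℝ) := by
      funext p; exact H.symm _ _
    rw [h1, fderiv_comp _ (by exact hd) (by fun_prop), ContinuousLinearEquiv.fderiv]
    simp [W₁]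
  have : ((h, k) : ℝ × ℝ) = h • (1, 0) + k • (0, 1) := by simp
  rw [this, map_add, map_smul, map_smul, hs]
  simp [W₁, mul_comm]

lemma exists_ρ_le : ∃ M, 0 < M ∧ ∀ X ∈ Icc L.a L.b, |L.ρ X| ≤ M := by
  obtain ⟨M, hM⟩ := isCompact_Icc.exists_bound_of_continuousOn
    (H.continuous_ρ.continuousOn (s := Icc L.a L.b))
  exact ⟨max M 1, lt_max_of_lt_right one_pos, fun X hX => (hM X hX).trans (le_max_left _ _)⟩

lemma continuous_interaction {x : ℝ → ℝ} (hx : Continuous x) :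
    Continuous fun X => ∫ Y in L.a..L.b, L.W₁ (x X) (x Y) * L.ρ Y := by
  have := H.continuous_ρ
  have h := H.continuous_W₁
  exact continuous_parametric_intervalIntegral_of_continuous'
    (f := fun X Y => L.W₁ (x X) (x Y) * L.ρ Y)
    ((h.comp (by fun_prop : Continuous fun p : ℝ × ℝ => (x p.1, x p.2))).mul (by fun_prop)) _ _

lemma continuous_potentialForce {x : ℝ → ℝ} (hx : Continuous x) :
    Continuous (L.potentialForce x) := by
  have h1 := H.continuous_ρ
  have h2 := H.continuous_deriv_V
  have h3 := H.continuous_interaction hx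
  unfold potentialForce
  fun_prop

lemma exists_potentialForce_bound : ∃ K, ∀ x, IsAdmissible L.a L.b x → ∀ X ∈ Icc L.a L.b,
    |L.potentialForce x X| ≤ K := by
  obtain ⟨M, hM, hρ⟩ := H.exists_ρ_le
  obtain ⟨N, hN⟩ := isCompact_Icc.exists_bound_of_continuousOn
    (H.continuous_deriv_V.continuousOn (s := Icc L.a L.b))
  obtain ⟨P, hP⟩ := (isCompact_Icc.prod isCompact_Icc).exists_bound_of_continuousOn
    (H.continuous_W₁.continuousOn (s := Icc L.a L.b ×ˢ Icc L.a L.b))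
  refine ⟨M * (N + P * M * (L.b - L.a)), fun x hx X hX => ?_⟩
  have hP0 : 0 ≤ P := (norm_nonneg _).trans (hP (X, X) ⟨hX, hX⟩)
  have h1 : |∫ Y in L.a..L.b, L.W₁ (x X) (x Y) * L.ρ Y| ≤ P * M * (L.b - L.a) := by
    refine abs_integral_le H.le fun Y hY => ?_
    rw [abs_mul]
    exact mul_le_mul (hP (x X, x Y) ⟨hx.2 hX, hx.2 hY⟩) (hρ Y hY) (abs_nonneg _) hP0
  have h2 : |deriv L.V (x X)| ≤ N := hN _ (hx.2 hX)
  rw [potentialForce, abs_mul]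
  exact mul_le_mul (hρ X hX) ((abs_add_le _ _).trans (add_le_add h2 h1)) (abs_nonneg _) hM.le

/-- Expand `V` and `W` uniformly on the compact range and integrate. The two first-order terms of
the interaction coincide by Fubini's theorem and symmetry, which absorbs the factor `1/2`. -/
lemma potential_expansion {ε : ℝ} (hε : 0 < ε) : ∃ δ₀ > 0, ∀ x y, IsAdmissible L.a L.b x →
    IsAdmissible L.a L.b y → ∀ δ ≤ δ₀, (∀ X ∈ Icc L.a L.b, |y X - x X| ≤ δ) →
    |L.potentialEnergy y - L.potentialEnergy x -
      ∫ X in L.a..L.b, L.potentialForce x X * (y X - x X)| ≤ ε * δ := by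
  obtain ⟨M, hM, hρ⟩ := H.exists_ρ_le
  have hba : 0 < L.b - L.a := sub_pos.2 H.lt
  set C := M * (L.b - L.a) with hC
  have hCp : 0 < C := mul_pos hM hba
  -- The tolerances leave `ε / 2` for the drift after one integration against `ρ`, and `ε` for the
  -- interaction after two, halved by its prefactor.
  obtain ⟨δ₁, hδ₁, h₁⟩ := uniform_expansion H.V (isCompact_Icc (a := L.a) (b := L.b))
    (convex_Icc _ _) (ε := ε / (2 * C)) (by positivity)
  obtain ⟨δ₂, hδ₂, h₂⟩ := uniform_expansion H.W
    ((isCompact_Icc (a := L.a) (b := L.b)).prod (isCompact_Icc (a := L.a) (b := L.b)))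
    ((convex_Icc _ _).prod (convex_Icc _ _)) (ε := ε / C ^ 2) (by positivity)
  refine ⟨min δ₁ δ₂, lt_min hδ₁ hδ₂, fun x y hx hy δ hδ hxy => ?_⟩
  have hδ1 := hδ.trans (min_le_left _ _)
  have hδ2 := hδ.trans (min_le_right _ _)
  have hx0 := hx.1
  have hy0 := hy.1
  have hρc := H.continuous_ρ
  have hVc := H.V.continuous
  have hV'c := H.continuous_deriv_V
  have hWc := H.W.continuous
  have hW1 := H.continuous_W₁
  have hint := H.continuous_interaction hx0
  set h : ℝ → ℝ := fun X => y X - x X with hh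
  have hhc : Continuous h := hy0.sub hx0
  have hWy : Continuous fun p : ℝ × ℝ => L.W (y p.1) (y p.2) :=
    hWc.comp (by fun_prop : Continuous fun p : ℝ × ℝ => (y p.1, y p.2))
  have hWx : Continuous fun p : ℝ × ℝ => L.W (x p.1) (x p.2) :=
    hWc.comp (by fun_prop : Continuous fun p : ℝ × ℝ => (x p.1, x p.2))
  have hW1x : Continuous fun p : ℝ × ℝ => L.W₁ (x p.1) (x p.2) :=
    hW1.comp (by fun_prop : Continuous fun p : ℝ × ℝ => (x p.1, x p.2))
  have hW2x : Continuous fun p : ℝ × ℝ => L.W₁ (x p.2) (x p.1) :=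
    hW1.comp (by fun_prop : Continuous fun p : ℝ × ℝ => (x p.2, x p.1))
  -- first-order remainders
  have hRV : |∫ X in L.a..L.b, (L.V (y X) - L.V (x X) - deriv L.V (x X) * h X) * L.ρ X| ≤
      ε / 2 * δ := by
    refine (abs_integral_le H.le (C := ε / (2 * C) * δ * M) fun X hX => ?_).trans (le_of_eq ?_)
    · have h1 := hxy X hX
      have h2 := h₁ (x X) (hx.2 hX) (y X) (hy.2 hX) (h1.trans hδ1)
      rw [fderiv_eq_smul_deriv, smul_eq_mul, mul_comm (y X - x X)] at h2
      rw [abs_mul]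
      refine mul_le_mul (h2.trans ?_) (hρ X hX) (abs_nonneg _) ?_
      · exact mul_le_mul_of_nonneg_left h1 (by positivity)
      · exact mul_nonneg (by positivity) ((abs_nonneg _).trans h1)
    · rw [hC]; field_simp
  have hRW : |∫ X in L.a..L.b, ∫ Y in L.a..L.b, (L.W (y X) (y Y) - L.W (x X) (x Y) -
      (L.W₁ (x X) (x Y) * h X + L.W₁ (x Y) (x X) * h Y)) * L.ρ X * L.ρ Y| ≤ ε * δ := by
    refine (abs_integral_le H.le (C := ε / C ^ 2 * δ * M * M * (L.b - L.a)) fun X hX =>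
      abs_integral_le H.le fun Y hY => ?_).trans (le_of_eq ?_)
    · have h1 := hxy X hX
      have h2 := hxy Y hY
      have hn : ‖((y X, y Y) : ℝ × ℝ) - (x X, x Y)‖ ≤ δ := by
        rw [Prod.mk_sub_mk, Prod.norm_mk]; exact max_le h1 h2
      have h3 := h₂ (x X, x Y) ⟨hx.2 hX, hx.2 hY⟩ (y X, y Y) ⟨hy.2 hX, hy.2 hY⟩ (hn.trans hδ2)
      rw [Prod.mk_sub_mk, H.fderiv_W] at h3
      have hδ0 : 0 ≤ δ := (abs_nonneg _).trans h1
      rw [abs_mul, abs_mul]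
      refine mul_le_mul (mul_le_mul (h3.trans ?_) (hρ X hX) (abs_nonneg _) (by positivity))
        (hρ Y hY) (abs_nonneg _) (by positivity)
      exact mul_le_mul_of_nonneg_left hn (by positivity)
    · rw [hC]; field_simp
  have hsym : ∫ X in L.a..L.b, ∫ Y in L.a..L.b, L.W₁ (x Y) (x X) * h Y * L.ρ X * L.ρ Y =
      ∫ X in L.a..L.b, ∫ Y in L.a..L.b, L.W₁ (x X) (x Y) * h X * L.ρ X * L.ρ Y := by
    rw [integral_swap_of_continuous]
    · refine intervalIntegral.integral_congr fun X _ => intervalIntegral.integral_congr fun Y _ => ?_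
      ring
    · exact ((hW2x.mul (by fun_prop)).mul (by fun_prop)).mul (by fun_prop)
  have c1 : ∀ G : ℝ → ℝ → ℝ, Continuous (Function.uncurry G) →
      Continuous fun X => ∫ Y in L.a..L.b, G X Y := fun G hG =>
    continuous_parametric_intervalIntegral_of_continuous' hG _ _
  have g1 : Continuous (Function.uncurry fun X Y => L.W (y X) (y Y) * L.ρ X * L.ρ Y) :=
    (hWy.mul (by fun_prop)).mul (by fun_prop)
  have g2 : Continuous (Function.uncurry fun X Y => L.W (x X) (x Y) * L.ρ X * L.ρ Y) :=
    (hWx.mul (by fun_prop)).mul (by fun_prop)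
  have g3 : Continuous (Function.uncurry fun X Y => L.W₁ (x X) (x Y) * h X * L.ρ X * L.ρ Y) :=
    ((hW1x.mul (by fun_prop)).mul (by fun_prop)).mul (by fun_prop)
  have g4 : Continuous (Function.uncurry fun X Y => L.W₁ (x Y) (x X) * h Y * L.ρ X * L.ρ Y) :=
    ((hW2x.mul (by fun_prop)).mul (by fun_prop)).mul (by fun_prop)
  have eW : ∫ X in L.a..L.b, ∫ Y in L.a..L.b, (L.W (y X) (y Y) - L.W (x X) (x Y) -
      (L.W₁ (x X) (x Y) * h X + L.W₁ (x Y) (x X) * h Y)) * L.ρ X * L.ρ Y =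
      (∫ X in L.a..L.b, ∫ Y in L.a..L.b, L.W (y X) (y Y) * L.ρ X * L.ρ Y) -
      (∫ X in L.a..L.b, ∫ Y in L.a..L.b, L.W (x X) (x Y) * L.ρ X * L.ρ Y) -
      2 * ∫ X in L.a..L.b, ∫ Y in L.a..L.b, L.W₁ (x X) (x Y) * h X * L.ρ X * L.ρ Y := by
    -- One of the two equal first-order terms is swapped back, so that the identity holds pointwise
    -- under the integrals.
    rw [two_mul]
    nth_rewrite 2 [← hsym]
    rw [← integral₂_sub g1 g2, ← integral₂_add g3 g4, 
      ← integral₂_sub (continuous_uncurry_sub g1 g2) (continuous_uncurry_add g3 g4)]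
    refine intervalIntegral.integral_congr fun X _ => intervalIntegral.integral_congr fun Y _ => ?_
    simp only [Pi.sub_apply, Pi.add_apply]
    ring
  have eV : ∫ X in L.a..L.b, (L.V (y X) - L.V (x X) - deriv L.V (x X) * h X) * L.ρ X =
      (∫ X in L.a..L.b, L.V (y X) * L.ρ X) - (∫ X in L.a..L.b, L.V (x X) * L.ρ X) -
      ∫ X in L.a..L.b, deriv L.V (x X) * h X * L.ρ X := by
    rw [← intervalIntegral.integral_sub, ← intervalIntegral.integral_sub]
    · refine intervalIntegral.integral_congr fun X _ => ?_
      ring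
    all_goals exact Continuous.intervalIntegrable (by fun_prop) _ _
  have ef : ∫ X in L.a..L.b, L.potentialForce x X * h X =
      (∫ X in L.a..L.b, deriv L.V (x X) * h X * L.ρ X) +
      ∫ X in L.a..L.b, ∫ Y in L.a..L.b, L.W₁ (x X) (x Y) * h X * L.ρ X * L.ρ Y := by
    rw [← intervalIntegral.integral_add (Continuous.intervalIntegrable (by fun_prop) _ _)
      ((c1 _ g3).intervalIntegrable _ _)]
    refine intervalIntegral.integral_congr fun X _ => ?_
    have : ∫ Y in L.a..L.b, L.W₁ (x X) (x Y) * h X * L.ρ X * L.ρ Y =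
        (h X * L.ρ X) * ∫ Y in L.a..L.b, L.W₁ (x X) (x Y) * L.ρ Y := by
      rw [← intervalIntegral.integral_const_mul]
      refine intervalIntegral.integral_congr fun Y _ => ?_
      ring
    simp only [this, potentialForce]
    ring
  rw [eW] at hRW
  rw [eV] at hRV
  rw [ef]
  simp only [potentialEnergy]
  rw [abs_le] at *
  constructor <;> linarith [hRV.1, hRV.2, hRW.1, hRW.2]

lemma exists_inertiaForce_bound : ∃ K, ∀ x, IsAdmissible L.a L.b x → ∀ X ∈ Icc L.a L.b,
    |L.inertiaForce x X| ≤ K := by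
  have hρ := H.continuous_ρ
  have h1 := H.prev
  have h2 := H.cur.continuous
  have hc : Continuous fun p : ℝ × ℝ => L.ρ p.1 / (L.τ * (1 + L.r)) *
      ((1 + 2 * L.r) * p.2 - (1 + L.r) ^ 2 * L.cur p.1 + L.r ^ 2 * L.prev p.1) := by fun_prop
  obtain ⟨K, hK⟩ := (isCompact_Icc.prod isCompact_Icc).exists_bound_of_continuousOn
    (hc.continuousOn (s := Icc L.a L.b ×ˢ Icc L.a L.b))
  exact ⟨K, fun x hx X hX => hK (X, x X) ⟨hX, hx.2 hX⟩⟩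

lemma continuous_bdf {x : ℝ → ℝ} (hx : Continuous x) : Continuous (L.bdf x) := by
  have h1 := H.prev
  have h2 := H.cur.continuous
  unfold bdf; fun_prop

lemma continuous_inertiaForce {x : ℝ → ℝ} (hx : Continuous x) : Continuous (L.inertiaForce x) := by
  have hρ := H.continuous_ρ
  have h1 := H.continuous_bdf hx
  unfold inertiaForce; fun_prop

/-- The inertia is quadratic: its second-order expansion is exact. -/
lemma inertia_eq {x y : ℝ → ℝ} (hx : Continuous x) (hy : Continuous y) :
    L.inertia y = L.inertia x + (∫ X in L.a..L.b, L.inertiaForce x X * (y X - x X)) +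
      (1 + 2 * L.r) / (2 * L.τ * (1 + L.r)) * ∫ X in L.a..L.b, L.ρ X * (y X - x X) ^ 2 := by
  have hρ := H.continuous_ρ
  have h1 := H.continuous_bdf hx
  have h2 := H.continuous_bdf hy
  have h3 := H.continuous_inertiaForce hx
  have hτ := H.τ_pos.ne'
  have hr : 1 + L.r ≠ 0 := by linarith [H.r_pos]
  have hr2 : 1 + 2 * L.r ≠ 0 := by linarith [H.r_pos]
  simp only [inertia]
  rw [← intervalIntegral.integral_const_mul, ← intervalIntegral.integral_const_mul,
    ← intervalIntegral.integral_const_mul, ← intervalIntegral.integral_add,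
    ← intervalIntegral.integral_add]
  · refine intervalIntegral.integral_congr fun X _ => ?_
    have e : L.bdf y X = L.bdf x X + (1 + 2 * L.r) * (y X - x X) := by simp only [bdf]; ring
    simp only [e, inertiaForce]
    field_simp
    ring
  all_goals exact Continuous.intervalIntegrable (by fun_prop) _ _

/-- The remainder in `inertia_eq` is at most `c * M * (b - a) * δ ^ 2`, hence at most `ε * δ` for
`δ` below the chosen `δ₀`. -/
lemma inertia_expansion {ε : ℝ} (hε : 0 < ε) : ∃ δ₀ > 0, ∀ x y, IsAdmissible L.a L.b x →
    IsAdmissible L.a L.b y → ∀ δ ≤ δ₀, (∀ X ∈ Icc L.a L.b, |y X - x X| ≤ δ) →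
    |L.inertia y - L.inertia x -
      ∫ X in L.a..L.b, L.inertiaForce x X * (y X - x X)| ≤ ε * δ := by
  obtain ⟨M, hM, hρ⟩ := H.exists_ρ_le
  have hba : 0 < L.b - L.a := sub_pos.2 H.lt
  set c := (1 + 2 * L.r) / (2 * L.τ * (1 + L.r)) with hc
  have hcp : 0 < c := by have := H.τ_pos; have := H.r_pos; positivity
  refine ⟨ε / (c * M * (L.b - L.a)), by positivity, fun x y hx hy δ hδ hxy => ?_⟩
  have hδ0 : 0 ≤ δ := (abs_nonneg _).trans (hxy L.a (left_mem_Icc.2 H.le))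
  rw [H.inertia_eq hx.1 hy.1]
  have h1 : |∫ X in L.a..L.b, L.ρ X * (y X - x X) ^ 2| ≤ M * δ ^ 2 * (L.b - L.a) := by
    refine abs_integral_le H.le fun X hX => ?_
    rw [abs_mul, abs_pow]
    have := hxy X hX
    gcongr
    exact hρ X hX
  rw [le_div_iff₀ (by positivity)] at hδ
  rw [show ∀ A B C : ℝ, A + B + C - A - B = C from fun _ _ _ => by ring, abs_mul, abs_of_pos hcp]
  calc c * |∫ X in L.a..L.b, L.ρ X * (y X - x X) ^ 2| ≤ c * (M * δ ^ 2 * (L.b - L.a)) := by gcongr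
    _ = (δ * (c * M * (L.b - L.a))) * δ := by ring
    _ ≤ ε * δ := by gcongr

/-- All forces, including inertia. -/
noncomputable def forceLaw : ForceLaw L.a L.b where
  B x := L.inertia x + L.potentialEnergy x
  f x X := L.inertiaForce x X + L.potentialForce x X
  K := H.exists_inertiaForce_bound.choose + H.exists_potentialForce_bound.choose
  bound x hx X hX := (abs_add_le _ _).trans (add_le_add
    (H.exists_inertiaForce_bound.choose_spec x hx X hX)
    (H.exists_potentialForce_bound.choose_spec x hx X hX))
  continuous _ hx := (H.continuous_inertiaForce hx.1).add (H.continuous_potentialForce hx.1)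
  expansion ε hε := by
    obtain ⟨δ₁, h1, e1⟩ := H.inertia_expansion (half_pos hε)
    obtain ⟨δ₂, h2, e2⟩ := H.potential_expansion (half_pos hε)
    refine ⟨min δ₁ δ₂, lt_min h1 h2, fun x y hx hy δ hδ hxy => ?_⟩
    have f1 := e1 x y hx hy δ (hδ.trans (min_le_left _ _)) hxy
    have f2 := e2 x y hx hy δ (hδ.trans (min_le_right _ _)) hxy
    have c1 := H.continuous_inertiaForce hx.1
    have c2 := H.continuous_potentialForce hx.1
    have hx0 := hx.1
    have hy0 := hy.1
    simp_rw [add_mul]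
    rw [intervalIntegral.integral_add (Continuous.intervalIntegrable (by fun_prop) _ _)
      (Continuous.intervalIntegrable (by fun_prop) _ _)]
    rw [abs_le] at *
    constructor <;> linarith [f1.1, f1.2, f2.1, f2.2]

end Regular
end LineData
end WassersteinBDF2

/-! ### Convexity of the energy implies convexity of `U`. -/

namespace WassersteinBDF2

open Set intervalIntegral

/-- Bumps of height and width `ε` with uniformly bounded slope. -/
lemma exists_scaled_bump : ∃ M > 0, ∀ X₀ ε : ℝ, 0 < ε → ∃ h : ℝ → ℝ, ContDiff ℝ 2 h ∧
    (∀ X, 0 ≤ h X ∧ h X ≤ ε) ∧ (∀ X, ε ≤ |X - X₀| → h X = 0 ∧ deriv h X = 0) ∧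
    (∀ X, |deriv h X| ≤ M) ∧ h X₀ = ε ∧ ε ≤ ∫ X in (X₀ - ε)..X₀, deriv h X ^ 2 := by
  let f : ContDiffBump (0 : ℝ) := ⟨1 / 2, 1, by norm_num, by norm_num⟩
  have hd : ContDiff ℝ 2 f := f.contDiff
  have hdd : ∀ z, HasDerivAt f (deriv f z) z := fun z =>
    (hd.differentiable (by norm_num) z).hasDerivAt
  have hz : ∀ z : ℝ, 1 ≤ |z| → f z = 0 := fun z hz => f.zero_of_le_dist (by simpa using hz)
  -- The bump is nonnegative, so each of its zeros is a minimum; this includes the edge of the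
  -- support.
  have hz' : ∀ z : ℝ, 1 ≤ |z| → deriv f z = 0 := fun z h =>
    IsLocalMin.deriv_eq_zero (.of_forall fun w => by rw [hz z h]; exact f.nonneg)
  obtain ⟨M, hM⟩ := (isCompact_Icc (a := (-1 : ℝ)) (b := 1)).exists_bound_of_continuousOn
    (hd.continuous_deriv (by norm_num)).continuousOn
  have hM' : ∀ z, |deriv f z| ≤ max M 1 := by
    intro z
    by_cases h : 1 ≤ |z|
    · rw [hz' z h]; simp
    · exact (hM z (abs_le.1 (not_le.1 h).le)).trans (le_max_left _ _)
  refine ⟨max M 1, lt_max_of_lt_right one_pos, fun X₀ ε hε => ?_⟩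
  have hder : ∀ X, HasDerivAt (fun X => ε * f ((X - X₀) / ε)) (deriv f ((X - X₀) / ε)) X := by
    intro X
    have h1 : HasDerivAt (fun X => (X - X₀) / ε) (1 / ε) X :=
      ((hasDerivAt_id X).sub_const X₀).div_const ε
    have h2 := ((hdd ((X - X₀) / ε)).comp X h1).const_mul ε
    exact h2.congr_deriv (by field_simp)
  have habs : ∀ X, ε ≤ |X - X₀| → 1 ≤ |(X - X₀) / ε| := fun X hX => by
    rwa [abs_div, abs_of_pos hε, le_div_iff₀ hε, one_mul]
  set h : ℝ → ℝ := fun X => ε * f ((X - X₀) / ε) with hh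
  have hh2 : ContDiff ℝ 2 h := contDiff_const.mul (hd.comp (by fun_prop))
  have hh0 : ∀ X, ε ≤ |X - X₀| → h X = 0 := fun X hX => by rw [hh]; simp [hz _ (habs X hX)]
  have hhX : h X₀ = ε := by
    have : f 0 = 1 := f.one_of_mem_closedBall (by simp [f.rIn_pos.le])
    simp [hh, this]
  have hh' : Continuous (deriv h) := hh2.continuous_deriv (by norm_num)
  refine ⟨h, hh2, fun X => ⟨mul_nonneg hε.le f.nonneg, mul_le_of_le_one_right hε.le f.le_one⟩,
    fun X hX => ⟨hh0 X hX, ?_⟩, fun X => ?_, hhX, ?_⟩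
  · rw [(hder X).deriv, hz' _ (habs X hX)]
  · rw [(hder X).deriv]; exact hM' _
  -- On the left half the bump rises by `ε` over a length `ε`; hence `∫ (2h' - 1) = ε`, and `2h' - 1
  -- ≤ h'²`.
  · calc ε = ∫ X in (X₀ - ε)..X₀, (2 * deriv h X - 1) := by
          rw [intervalIntegral.integral_sub (Continuous.intervalIntegrable (by fun_prop) _ _)
            (by simp), intervalIntegral.integral_const_mul, integral_deriv_eq_sub
            (fun X _ => (hder X).differentiableAt) (hh'.intervalIntegrable _ _), hhX,
            hh0 (X₀ - ε) (by
              rw [show X₀ - ε - X₀ = -ε by ring, abs_neg]; exact le_abs_self ε)]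
          simp; ring
      _ ≤ ∫ X in (X₀ - ε)..X₀, deriv h X ^ 2 := by
          refine integral_mono_on (by linarith) (Continuous.intervalIntegrable (by fun_prop) _ _)
            (Continuous.intervalIntegrable (by fun_prop) _ _) fun X _ => ?_
          nlinarith [sq_nonneg (deriv h X - 1)]

lemma hasDerivAt_density {R p : ℝ} (hp : 0 < p) :
    HasDerivAt (fun p => R / p) (-(R / p ^ 2)) p := by
  simpa [div_eq_mul_inv] using (hasDerivAt_inv hp.ne').const_mul R

namespace LineData
/-- The internal stress `U - s U'` as a function of the density. -/
noncomputable def pressure (L : LineData) (s : ℝ) : ℝ := L.U s - s * deriv L.U s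

namespace Regular

variable {L : LineData} (H : L.Regular)
include H

lemma contDiffOn_deriv_U : ContDiffOn ℝ 1 (deriv L.U) (Ioi 0) :=
  ((contDiffOn_succ_iff_deriv_of_isOpen (n := 1) isOpen_Ioi).1
    (by simpa [one_add_one_eq_two] using H.U)).2.2

lemma hasDerivAt_U {s : ℝ} (hs : 0 < s) : HasDerivAt L.U (deriv L.U s) s :=
  ((H.U.contDiffAt (Ioi_mem_nhds hs)).differentiableAt (by norm_num)).hasDerivAt

lemma hasDerivAt_deriv_U {s : ℝ} (hs : 0 < s) :
    HasDerivAt (deriv L.U) (deriv (deriv L.U) s) s :=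
  ((H.contDiffOn_deriv_U.contDiffAt (Ioi_mem_nhds hs)).differentiableAt (by norm_num)).hasDerivAt

lemma continuousOn_deriv2_U : ContinuousOn (deriv (deriv L.U)) (Ioi 0) :=
  H.contDiffOn_deriv_U.continuousOn_deriv_of_isOpen isOpen_Ioi le_rfl

lemma hasDerivAt_pressure {s : ℝ} (hs : 0 < s) :
    HasDerivAt L.pressure (-(s * deriv (deriv L.U) s)) s := by
  have := (H.hasDerivAt_U hs).sub ((hasDerivAt_id s).mul (H.hasDerivAt_deriv_U hs))
  exact this.congr_deriv (by simp only [id]; ring)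

lemma continuousOn_pressure : ContinuousOn L.pressure (Ioi 0) := fun _ hs =>
  (H.hasDerivAt_pressure hs).continuousAt.continuousWithinAt

/-- As a function of the slope the internal energy has derivative `U - s U'` at `s = R/p`. This is
minus the usual thermodynamic pressure and decreases in `s` when `U` is convex. -/
lemma hasDerivAt_internal {R p : ℝ} (hR : 0 < R) (hp : 0 < p) :
    HasDerivAt (fun p => L.U (R / p) * p) (L.pressure (R / p)) p := by
  have := ((H.hasDerivAt_U (div_pos hR hp)).comp p (hasDerivAt_density hp)).mul (hasDerivAt_id p)
  exact this.congr_deriv (by simp only [pressure, Function.comp, id]; field_simp; ring)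

lemma hasDerivAt_pressure_comp {R p : ℝ} (hR : 0 < R) (hp : 0 < p) :
    HasDerivAt (fun p => L.pressure (R / p))
      (deriv (deriv L.U) (R / p) * R ^ 2 / p ^ 3) p := by
  have := (H.hasDerivAt_pressure (div_pos hR hp)).comp p (hasDerivAt_density hp)
  exact this.congr_deriv (by field_simp)

lemma isAdmissible_of_deriv_nonneg {x : ℝ → ℝ} (hx : ContDiff ℝ 1 x) (ha : x L.a = L.a)
    (hb : x L.b = L.b) (h : ∀ X ∈ Icc L.a L.b, 0 ≤ deriv x X) : IsAdmissible L.a L.b x := by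
  have hm : MonotoneOn x (Icc L.a L.b) :=
    monotoneOn_of_deriv_nonneg (convex_Icc _ _) hx.continuous.continuousOn
      (hx.differentiable one_ne_zero).differentiableOn fun X hX => h X (interior_subset hX)
  refine ⟨hx.continuous, fun X hX => ⟨?_, ?_⟩⟩
  · rw [← ha]; exact hm (left_mem_Icc.2 H.le) hX hX.1
  · rw [← hb]; exact hm hX (right_mem_Icc.2 H.le) hX.2

lemma continuousOn_internal {x : ℝ → ℝ} (hx : ContDiff ℝ 1 x)
    (h : ∀ X ∈ Icc L.a L.b, 0 < deriv x X) : ContinuousOn (L.internal x) (Icc L.a L.b) := by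
  have hd : Continuous (deriv x) := hx.continuous_deriv le_rfl
  refine ContinuousOn.mul ?_ hd.continuousOn
  exact H.U.continuousOn.comp (H.continuous_ρ.continuousOn.div hd.continuousOn fun X hX =>
    (h X hX).ne') fun X hX => div_pos (H.ρ_pos X hX) (h X hX)

lemma mem_dom_of_deriv_pos {x : ℝ → ℝ} (hx : ContDiff ℝ 2 x) (ha : x L.a = L.a)
    (hb : x L.b = L.b) (h : ∀ X ∈ Icc L.a L.b, 0 < deriv x X) : x ∈ L.dom :=
  ⟨⟨hx, ha, hb⟩, (ae_restrict_iff' measurableSet_Ioo).2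
    (.of_forall fun X hX => h X (Ioo_subset_Icc_self hX)),
    ((H.continuousOn_internal (hx.of_le (by norm_num)) h).integrableOn_Icc).mono_set
      Ioo_subset_Icc_self⟩

/-- Every density is attained, at an interior point, by some regular map. -/
lemma exists_density_eq {s : ℝ} (hs : 0 < s) : ∃ x : ℝ → ℝ, ContDiff ℝ 2 x ∧ x L.a = L.a ∧
    x L.b = L.b ∧ (∀ X ∈ Icc L.a L.b, 0 < deriv x X) ∧
    ∃ X ∈ Ioo L.a L.b, L.ρ X / deriv x X = s := by
  have hba : 0 < L.b - L.a := sub_pos.2 H.lt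
  have hρa := H.ρ_pos L.a (left_mem_Icc.2 H.le)
  -- The map mixes a linear part of slope `θ` with a high power. At `a` the slope is `θ`, so small
  -- that the density exceeds `s`; at `b` it is at least `n / 2`, so large that the density is below
  -- `s`.
  obtain ⟨n, hn⟩ := exists_nat_gt (2 * L.ρ L.b / s)
  set θ := min (1 / 2) (L.ρ L.a / (2 * s)) with hθ
  have hθ0 : 0 < θ := by positivity
  have hθ1 : θ ≤ 1 / 2 := min_le_left _ _
  have hθ2 : θ * s < L.ρ L.a := by
    calc θ * s ≤ L.ρ L.a / (2 * s) * s := mul_le_mul_of_nonneg_right (min_le_right _ _) hs.le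
      _ = L.ρ L.a / 2 := by field_simp
      _ < L.ρ L.a := half_lt_self hρa
  let v : ℝ → ℝ := fun X => (X - L.a) / (L.b - L.a)
  let x : ℝ → ℝ := fun X => L.a + (L.b - L.a) * (θ * v X + (1 - θ) * v X ^ (n + 2))
  have hder : ∀ X, HasDerivAt x (θ + (1 - θ) * ((n + 2) * v X ^ (n + 1))) X := by
    intro X
    have h1 : HasDerivAt v (1 / (L.b - L.a)) X :=
      ((hasDerivAt_id X).sub_const L.a).div_const _
    have h2 := (((h1.const_mul θ).add ((h1.pow (n + 2)).const_mul (1 - θ))).const_mul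
      (L.b - L.a)).const_add L.a
    refine h2.congr_deriv ?_
    have : n + 2 - 1 = n + 1 := rfl
    rw [this]
    push_cast
    field_simp
  have hder' : deriv x = fun X => θ + (1 - θ) * ((n + 2) * v X ^ (n + 1)) :=
    funext fun X => (hder X).deriv
  have hva : v L.a = 0 := by simp [v]
  have hvb : v L.b = 1 := div_self hba.ne'
  have hx2 : ContDiff ℝ 2 x := by fun_prop
  have hpos : ∀ X ∈ Icc L.a L.b, 0 < deriv x X := by
    intro X hX
    have hv : 0 ≤ v X := div_nonneg (sub_nonneg.2 hX.1) hba.le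
    have h1 : 0 ≤ 1 - θ := by linarith
    rw [hder']
    positivity
  refine ⟨x, hx2, by simp [x, hva], by simp [x, hvb], hpos, ?_⟩
  have hcont : ContinuousOn (fun X => deriv x X * s - L.ρ X) (Icc L.a L.b) := by
    have h1 := H.continuous_ρ
    have h2 := hx2.continuous_deriv (by norm_num)
    fun_prop
  have hn' : 2 * L.ρ L.b < n * s := by rwa [div_lt_iff₀ hs] at hn
  obtain ⟨X, hX, he⟩ := intermediate_value_Ioo H.le hcont (show (0 : ℝ) ∈ _ by
    simp only [hder', hva, hvb, mem_Ioo]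
    constructor
    · simp; linarith
    · have : (1 / 2 : ℝ) * (n + 2) ≤ (1 - θ) * (n + 2) :=
        mul_le_mul_of_nonneg_right (by linarith) (by positivity)
      have h3 : (1 / 2 : ℝ) * n * s ≤ (θ + (1 - θ) * ((n + 2) * 1 ^ (n + 1))) * s := by
        refine mul_le_mul_of_nonneg_right ?_ hs.le
        rw [one_pow, mul_one]; linarith
      linarith)
  refine ⟨X, hX, ?_⟩
  simp only at he
  rw [div_eq_iff (hpos X (Ioo_subset_Icc_self hX)).ne']
  linarith

/-- The bound on the second derivative makes the energy density concave even after adding `κ/2 * p ^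
2`. Midpoint concavity at `p ± k` then leaves the term `-κ k ^ 2`. -/
lemma second_difference_le {R p₀ η κ : ℝ} (hR : 0 < R)
    (h : ∀ p ∈ Ioo (p₀ - η) (p₀ + η),
      0 < p ∧ deriv (deriv L.U) (R / p) * R ^ 2 / p ^ 3 < -κ) {p k : ℝ}
    (h1 : p + k ∈ Ioo (p₀ - η) (p₀ + η)) (h2 : p + -k ∈ Ioo (p₀ - η) (p₀ + η)) :
    L.U (R / (p + k)) * (p + k) + L.U (R / (p + -k)) * (p + -k) - 2 * (L.U (R / p) * p) ≤
      -κ * k ^ 2 := by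
  set I := Ioo (p₀ - η) (p₀ + η) with hI
  have hint : interior I = I := isOpen_Ioo.interior_eq
  have hconc : ConcaveOn ℝ I fun p => L.U (R / p) * p + κ / 2 * p ^ 2 := by
    have d1 : ∀ p ∈ I, HasDerivAt (fun p => L.U (R / p) * p + κ / 2 * p ^ 2)
        (L.pressure (R / p) + κ * p) p := fun p hp => by
      have := (H.hasDerivAt_internal hR (h p hp).1).add
        ((hasDerivAt_pow 2 p).const_mul (κ / 2))
      exact this.congr_deriv (by simp; ring)
    have d2 : ∀ p ∈ I, HasDerivAt (fun p => L.pressure (R / p) + κ * p)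
        (deriv (deriv L.U) (R / p) * R ^ 2 / p ^ 3 + κ) p := fun p hp => by
      have := (H.hasDerivAt_pressure_comp hR (h p hp).1).add
        ((hasDerivAt_id p).const_mul κ)
      exact this.congr_deriv (by simp)
    refine concaveOn_of_hasDerivWithinAt2_nonpos (convex_Ioo _ _)
      (f' := fun p => L.pressure (R / p) + κ * p)
      (f'' := fun p => deriv (deriv L.U) (R / p) * R ^ 2 / p ^ 3 + κ)
      (fun p hp => (d1 p hp).continuousAt.continuousWithinAt) ?_ ?_ ?_
    · rw [hint]; exact fun p hp => (d1 p hp).hasDerivWithinAt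
    · rw [hint]; exact fun p hp => (d2 p hp).hasDerivWithinAt
    · rw [hint]; exact fun p hp => by linarith [(h p hp).2]
  have := hconc.2 h1 h2 (by norm_num : (0 : ℝ) ≤ 1 / 2) (by norm_num : (0 : ℝ) ≤ 1 / 2)
    (by norm_num)
  simp only [smul_eq_mul] at this
  rw [show 1 / 2 * (p + k) + 1 / 2 * (p + -k) = p by ring] at this
  linarith

/-- Convexity of the energy forces the internal energy density to be convex. -/
theorem deriv2_U_nonneg (hE : ConvexOn ℝ L.dom L.energy) {s : ℝ} (hs : 0 < s) :
    0 ≤ deriv (deriv L.U) s := by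
  by_contra! hneg
  obtain ⟨x, hx, hxa, hxb, hxpos, X₀, hX₀, hρX⟩ := H.exists_density_eq hs
  have hx' : Continuous (deriv x) := hx.continuous_deriv (by norm_num)
  have hxd := hx.differentiable (by norm_num)
  set p₀ := deriv x X₀ with hp₀
  have hp₀pos : 0 < p₀ := hxpos X₀ (Ioo_subset_Icc_self hX₀)
  have hρ₀pos := H.ρ_pos X₀ (Ioo_subset_Icc_self hX₀)
  -- the second derivative of the energy density is negative near the point
  let Q : ℝ × ℝ → ℝ := fun z => deriv (deriv L.U) (L.ρ z.1 / z.2) * L.ρ z.1 ^ 2 / z.2 ^ 3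
  have hQc : ContinuousAt Q (X₀, p₀) := by
    have h1 : ContinuousAt (fun z : ℝ × ℝ => L.ρ z.1) (X₀, p₀) :=
      (H.continuous_ρ.comp continuous_fst).continuousAt
    have h2 : ContinuousAt (fun z : ℝ × ℝ => L.ρ z.1 / z.2) (X₀, p₀) :=
      h1.div continuousAt_snd hp₀pos.ne'
    have h3 : ContinuousAt (deriv (deriv L.U)) (L.ρ X₀ / p₀) :=
      H.continuousOn_deriv2_U.continuousAt (Ioi_mem_nhds (div_pos hρ₀pos hp₀pos))
    have h4 : ContinuousAt (fun z : ℝ × ℝ => deriv (deriv L.U) (L.ρ z.1 / z.2)) (X₀, p₀) :=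
      ContinuousAt.comp (g := deriv (deriv L.U)) (f := fun z : ℝ × ℝ => L.ρ z.1 / z.2) h3 h2
    exact (h4.mul (h1.pow 2)).div (continuousAt_snd.pow 3) (pow_pos hp₀pos 3).ne'
  have hQneg : Q (X₀, p₀) < 0 := by
    simp only [Q, hρX]
    exact div_neg_of_neg_of_pos (mul_neg_of_neg_of_pos hneg (pow_pos hρ₀pos 2)) (pow_pos hp₀pos 3)
  obtain ⟨κ, hκ, hκQ⟩ : ∃ κ > 0, Q (X₀, p₀) < -κ :=
    ⟨-Q (X₀, p₀) / 2, by linarith, by linarith⟩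
  have hev : ∀ᶠ z in 𝓝 X₀ ×ˢ 𝓝 p₀, Q z < -κ ∧ 0 < z.2 := by
    rw [← nhds_prod_eq]
    exact (hQc.eventually_lt_const hκQ).and (continuousAt_snd.eventually_const_lt hp₀pos)
  obtain ⟨pa, hpa, pb, hpb, hab⟩ := eventually_prod_iff.1 hev
  obtain ⟨η, hη, hηb⟩ := Metric.eventually_nhds_iff.1 hpb
  have hev2 : ∀ᶠ X in 𝓝 X₀, pa X ∧ |deriv x X - p₀| < η / 2 ∧ X ∈ Ioo L.a L.b :=
    hpa.and (((Metric.continuousAt_iff'.1 hx'.continuousAt) _ (half_pos hη)).and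
      (Ioo_mem_nhds hX₀.1 hX₀.2))
  obtain ⟨η', hη', hX⟩ := Metric.eventually_nhds_iff.1 hev2
  obtain ⟨M, hM, hbump⟩ := exists_scaled_bump
  -- The perturbation of the slope is at most `t * M = η / 4`; with `x'` within `η / 2` of `p₀`, the
  -- perturbed slopes stay in the region of negative second derivative.
  set t := η / (4 * M) with ht
  have ht0 : 0 < t := by positivity
  have htM : t * M < η / 2 := by rw [ht]; field_simp; linarith
  -- The bump has height `t * ε`, so each one-sided remainder is at most `κ t² ε / 4`. The two
  -- together do not outweigh the loss `κ t² ε` of internal energy, where `∫ h'² ≥ ε`.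
  obtain ⟨δ₀, hδ₀, hexp⟩ := H.potential_expansion (ε := κ * t / 4) (by positivity)
  -- The three bounds keep the bump in the neighbourhood of `X₀`, its left half inside `[a, b]`, and
  -- the sup distance `t * ε` below `δ₀`.
  set ε := min (min (η' / 2) (X₀ - L.a)) (δ₀ / t) with hε
  have hε0 : 0 < ε := lt_min (lt_min (half_pos hη') (sub_pos.2 hX₀.1)) (by positivity)
  have hεη : ε < η' := ((min_le_left _ _).trans (min_le_left _ _)).trans_lt (by linarith)
  have hX1 : ε ≤ X₀ - L.a := (min_le_left _ _).trans (min_le_right _ _)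
  have hεδ : t * ε ≤ δ₀ := by
    have := min_le_right (min (η' / 2) (X₀ - L.a)) (δ₀ / t)
    rw [← hε, le_div_iff₀ ht0] at this
    linarith
  obtain ⟨h, hh, hhb, hh0, hhM, -, hhsq⟩ := hbump X₀ ε hε0
  have hh' : Continuous (deriv h) := hh.continuous_deriv (by norm_num)
  have hhd := hh.differentiable (by norm_num)
  have hnear : ∀ X, |X - X₀| < ε → pa X ∧ |deriv x X - p₀| < η / 2 ∧ X ∈ Ioo L.a L.b :=
    fun X h => hX (lt_trans h hεη)
  have hfar : ∀ X, X ∉ Ioo L.a L.b → h X = 0 := fun X hXn =>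
    (hh0 X (not_lt.1 fun hlt => hXn (hnear X hlt).2.2)).1
  -- the two perturbed maps
  have pert : ∀ c : ℝ, |c| = t → ContDiff ℝ 2 (fun X => x X + c * h X) ∧
      (∀ X, deriv (fun X => x X + c * h X) X = deriv x X + c * deriv h X) ∧
      (x L.a + c * h L.a = L.a) ∧ (x L.b + c * h L.b = L.b) ∧
      ∀ X ∈ Icc L.a L.b, 0 < deriv x X + c * deriv h X := by
    intro c hc
    refine ⟨by fun_prop, fun X => ?_, ?_, ?_, fun X hX => ?_⟩
    · exact ((hxd X).hasDerivAt.add ((hhd X).hasDerivAt.const_mul c)).deriv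
    · rw [hfar _ (by simp), hxa]; ring
    · rw [hfar _ (by simp), hxb]; ring
    · by_cases hXe : |X - X₀| < ε
      · obtain ⟨h1, h2, -⟩ := hnear X hXe
        have h3 : |c * deriv h X| < η / 2 := by
          rw [abs_mul, hc]
          exact (mul_le_mul_of_nonneg_left (hhM X) ht0.le).trans_lt htM
        have h4 : dist (deriv x X + c * deriv h X) p₀ < η := by
          rw [Real.dist_eq, show deriv x X + c * deriv h X - p₀ =
            (deriv x X - p₀) + c * deriv h X by ring]
          exact (abs_add_le _ _).trans_lt (by linarith)
        exact (hab h1 (hηb h4)).2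
      · rw [(hh0 X (not_lt.1 hXe)).2, mul_zero, add_zero]
        exact hxpos X hX
  have pert' : ∀ c : ℝ, |c| = t → (fun X => x X + c * h X) ∈ L.dom ∧
      IsAdmissible L.a L.b (fun X => x X + c * h X) := by
    intro c hc
    obtain ⟨h1, h2, h3, h4, h5⟩ := pert c hc
    refine ⟨H.mem_dom_of_deriv_pos h1 h3 h4 fun X hX => ?_,
      H.isAdmissible_of_deriv_nonneg (h1.of_le (by norm_num)) h3 h4 fun X hX => ?_⟩
    · rw [h2]; exact h5 X hX
    · rw [h2]; exact (h5 X hX).le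
  have hxadm := H.isAdmissible_of_deriv_nonneg (hx.of_le (by norm_num)) hxa hxb
    fun X hX => (hxpos X hX).le
  have habst : |t| = t := abs_of_pos ht0
  have habst' : |-t| = t := by rw [abs_neg, habst]
  -- convexity of the energy
  have hconv := hE.2 (pert' t habst).1 (pert' (-t) habst').1 (by norm_num : (0 : ℝ) ≤ 1 / 2)
    (by norm_num : (0 : ℝ) ≤ 1 / 2) (by norm_num)
  have hmid : (1 / 2 : ℝ) • (fun X => x X + t * h X) + (1 / 2 : ℝ) • (fun X => x X + -t * h X) = x := by
    funext X; simp only [Pi.add_apply, Pi.smul_apply, smul_eq_mul]; ring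
  rw [hmid, smul_eq_mul, smul_eq_mul] at hconv
  -- drift and interaction
  have hpot : ∀ c : ℝ, |c| = t → L.potentialEnergy (fun X => x X + c * h X) -
      L.potentialEnergy x - c * ∫ X in L.a..L.b, L.potentialForce x X * h X ≤
      κ * t / 4 * (t * ε) := by
    intro c hc
    have h1 := (abs_le.1 (hexp x _ hxadm (pert' c hc).2 (t * ε) hεδ fun X _ => ?_)).2
    · have h2 : ∫ X in L.a..L.b, L.potentialForce x X * (x X + c * h X - x X) =
          c * ∫ X in L.a..L.b, L.potentialForce x X * h X := by
        rw [← intervalIntegral.integral_const_mul]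
        refine intervalIntegral.integral_congr fun X _ => ?_
        ring
      rwa [h2] at h1
    · rw [add_sub_cancel_left, abs_mul, hc, abs_of_nonneg (hhb X).1]
      exact mul_le_mul_of_nonneg_left (hhb X).2 ht0.le
  have hp1 := hpot t habst
  have hp2 := hpot (-t) habst'
  -- internal energy
  have hint : ∀ c : ℝ, |c| = t → IntervalIntegrable
      (fun X => L.internal (fun X => x X + c * h X) X) volume L.a L.b := by
    intro c hc
    obtain ⟨h1, h2, h3, h4, h5⟩ := pert c hc
    exact (H.continuousOn_internal (h1.of_le (by norm_num)) fun X hX => by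
      rw [h2]; exact h5 X hX).intervalIntegrable_of_Icc H.le
  have hint0 : IntervalIntegrable (L.internal x) volume L.a L.b :=
    (H.continuousOn_internal (hx.of_le (by norm_num)) hxpos).intervalIntegrable_of_Icc H.le
  have hpt : ∀ X ∈ Icc L.a L.b, L.internal (fun X => x X + t * h X) X +
      L.internal (fun X => x X + -t * h X) X - 2 * L.internal x X ≤
      -(κ * t ^ 2) * deriv h X ^ 2 := by
    intro X hXI
    simp only [internal, (pert t habst).2.1, (pert (-t) habst').2.1]
    by_cases hXe : |X - X₀| < ε
    · obtain ⟨h1, h2, -⟩ := hnear X hXe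
      have hR := H.ρ_pos X hXI
      have h3 := (mul_le_mul_of_nonneg_left (hhM X) ht0.le).trans_lt htM
      have h4 : |t * deriv h X| < η / 2 := by rwa [abs_mul, habst]
      rw [abs_lt] at h2 h4
      rw [neg_mul t]
      refine (H.second_difference_le hR (p₀ := p₀) (η := η) (κ := κ) (fun p hp => ?_)
        ⟨by linarith, by linarith⟩ ⟨by linarith, by linarith⟩).trans (le_of_eq (by ring))
      have : dist p p₀ < η := by
        rw [Real.dist_eq, abs_lt]; constructor <;> linarith [hp.1, hp.2]
      exact (hab h1 (hηb this)).symm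
    · rw [(hh0 X (not_lt.1 hXe)).2]
      simp only [mul_zero, add_zero]
      apply le_of_eq; ring
  have hsq : ε ≤ ∫ X in L.a..L.b, deriv h X ^ 2 := by
    calc ε ≤ ∫ X in (X₀ - ε)..X₀, deriv h X ^ 2 := hhsq
      _ ≤ _ := integral_mono_interval (by linarith) (by linarith) hX₀.2.le
          (.of_forall fun X => sq_nonneg _) (Continuous.intervalIntegrable (by fun_prop) _ _)
  have hI : (∫ X in L.a..L.b, L.internal (fun X => x X + t * h X) X) +
      (∫ X in L.a..L.b, L.internal (fun X => x X + -t * h X) X) -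
      2 * (∫ X in L.a..L.b, L.internal x X) ≤ -(κ * t ^ 2) * ε := by
    rw [← intervalIntegral.integral_const_mul,
      ← intervalIntegral.integral_add (hint t habst) (hint (-t) habst'),
      ← intervalIntegral.integral_sub ((hint t habst).add (hint (-t) habst')) (hint0.const_mul 2)]
    refine (integral_mono_on H.le (((hint t habst).add (hint (-t) habst')).sub
      (hint0.const_mul 2)) (Continuous.intervalIntegrable (by fun_prop) _ _) hpt).trans ?_
    rw [intervalIntegral.integral_const_mul]
    nlinarith [mul_pos hκ (pow_pos ht0 2)]
  simp only [energy] at hconv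
  -- Adding the expansions for `t` and `-t` cancels the first-order terms; the negative second
  -- difference contradicts midpoint convexity.
  have : 0 < κ * t ^ 2 * ε := by positivity
  have e1 : κ * t / 4 * (t * ε) = κ * t ^ 2 * ε / 4 := by ring
  have e2 : -(κ * t ^ 2) * ε = -(κ * t ^ 2 * ε) := by ring
  have e3 : -t * (∫ X in L.a..L.b, L.potentialForce x X * h X) =
    -(t * ∫ X in L.a..L.b, L.potentialForce x X * h X) := by ring
  rw [e1] at hp1 hp2
  rw [e2] at hI
  rw [e3] at hp2
  linarith

end Regular
end LineData
end WassersteinBDF2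

/-! ### The stress of the scheme and existence of a `C²` equilibrium. -/

namespace WassersteinBDF2

open Set intervalIntegral

/-- Implicit differentiation of `F (X, p X) = g X`. -/
lemma hasDerivAt_of_implicit {F : ℝ × ℝ → ℝ} {p g : ℝ → ℝ} {X₀ g' A B : ℝ}
    (hF : DifferentiableAt ℝ F (X₀, p X₀)) (hA : HasDerivAt (fun X => F (X, p X₀)) A X₀)
    (hB : HasDerivAt (fun q => F (X₀, q)) B (p X₀)) (hB0 : B ≠ 0)
    (hp : (fun X => p X - p X₀) =O[𝓝 X₀] fun X => X - X₀) (hg : HasDerivAt g g' X₀)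
    (he : ∀ᶠ X in 𝓝 X₀, F (X, p X) = g X) : HasDerivAt p ((g' - A) / B) X₀ := by
  have hF' := hF.hasFDerivAt
  set F' := fderiv ℝ F (X₀, p X₀) with hF'def
  have hA' : F' (1, 0) = A := by
    have h1 : HasDerivAt (fun X : ℝ => (X, p X₀)) ((1, 0) : ℝ × ℝ) X₀ :=
      (hasDerivAt_id X₀).prodMk (hasDerivAt_const X₀ _)
    exact (HasFDerivAt.comp_hasDerivAt (l := F) X₀ hF' h1).unique hA
  have hB' : F' (0, 1) = B := by
    have h1 : HasDerivAt (fun q : ℝ => (X₀, q)) ((0, 1) : ℝ × ℝ) (p X₀) :=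
      (hasDerivAt_const (p X₀) X₀).prodMk (hasDerivAt_id _)
    exact (HasFDerivAt.comp_hasDerivAt (l := F) (p X₀) hF' h1).unique hB
  have hlin : ∀ h k : ℝ, F' (h, k) = A * h + B * k := by
    intro h k
    have : ((h, k) : ℝ × ℝ) = h • (1, 0) + k • (0, 1) := by simp
    rw [this, map_add, map_smul, map_smul, hA', hB']
    simp [mul_comm]
  have hpc : Tendsto p (𝓝 X₀) (𝓝 (p X₀)) := by
    have h1 : Tendsto (fun X => X - X₀) (𝓝 X₀) (𝓝 0) :=
      tendsto_sub_nhds_zero_iff.2 tendsto_id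
    simpa using (hp.trans_tendsto h1).add_const (p X₀)
  have hu : Tendsto (fun X => (X, p X)) (𝓝 X₀) (𝓝 (X₀, p X₀)) := by
    rw [nhds_prod_eq]; exact tendsto_id.prodMk hpc
  -- The growth bound on `p` makes the remainder of `F` along the curve `o(X - X₀)`;
  -- differentiability of `F` at one point is thus enough.
  have r1 : (fun X => F (X, p X) - F (X₀, p X₀) - F' ((X, p X) - (X₀, p X₀))) =o[𝓝 X₀]
      fun X => X - X₀ := by
    refine (hF'.isLittleO.comp_tendsto hu).trans_isBigO ?_
    exact (Asymptotics.isBigO_refl _ _).prod_left hp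
  have r2 := hg.isLittleO
  rw [hasDerivAt_iff_isLittleO]
  refine ((r2.sub r1).const_mul_left B⁻¹).congr' ?_ .rfl
  have he0 := he.self_of_nhds
  filter_upwards [he] with X hX
  rw [hX, he0, Prod.mk_sub_mk, hlin]
  simp only [smul_eq_mul]
  field_simp
  ring

/-- A continuous function bounded below on an open interval is so on its closure. -/
lemma ge_on_Icc {a b c : ℝ} (hab : a < b) {f : ℝ → ℝ} (hf : Continuous f)
    (h : ∀ X ∈ Ioo a b, c ≤ f X) : ∀ X ∈ Icc a b, c ≤ f X := by
  have : closure (Ioo a b) ⊆ {X | c ≤ f X} :=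
    closure_minimal h (isClosed_le continuous_const hf)
  rwa [closure_Ioo hab.ne] at this

lemma nonneg_of_ae_pos {a b : ℝ} (hab : a < b) {f : ℝ → ℝ} (hf : Continuous f)
    (h : ∀ᵐ X ∂(volume.restrict (Ioo a b)), 0 < f X) : ∀ X ∈ Icc a b, 0 ≤ f X := by
  refine ge_on_Icc hab hf fun X hX => ?_
  by_contra! hneg
  have ho : IsOpen (Ioo a b ∩ {X | f X < 0}) := isOpen_Ioo.inter (isOpen_lt hf continuous_const)
  have hpos := ho.measure_pos volume ⟨X, hX, hneg⟩
  rw [ae_restrict_iff' measurableSet_Ioo] at h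
  have hz : volume (Ioo a b ∩ {X | f X < 0}) = 0 :=
    measure_mono_null (t := {Y | ¬(Y ∈ Ioo a b → 0 < f Y)})
      (fun Y hY hc => lt_asymm hY.2 (hc hY.1)) (ae_iff.1 h)
  exact hpos.ne' hz

namespace LineData

/-- Maps of class `C²` with positive derivative whose stress balances the force. -/
structure IsEquilibrium (L : LineData) (x : ℝ → ℝ) : Prop where
  contDiff : ContDiff ℝ 2 x
  left : x L.a = L.a
  right : x L.b = L.b
  pos : ∀ X ∈ Ioo L.a L.b, 0 < deriv x X
  balance : ∀ X ∈ Ioo L.a L.b, HasDerivAt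
    (fun X => L.pressure (L.ρ X / deriv x X) + L.τ * (deriv x X - deriv L.cur X))
    (L.inertiaForce x X + L.potentialForce x X) X

namespace Regular

variable {L : LineData} (H : L.Regular)
include H

lemma antitoneOn_pressure (hU : ∀ s, 0 < s → 0 ≤ deriv (deriv L.U) s) :
    AntitoneOn L.pressure (Ioi 0) := by
  refine antitoneOn_of_hasDerivWithinAt_nonpos (convex_Ioi 0) H.continuousOn_pressure
    (f' := fun s => -(s * deriv (deriv L.U) s)) (fun s hs => ?_) fun s hs => ?_
  · rw [interior_Ioi] at hs
    exact (H.hasDerivAt_pressure hs).hasDerivWithinAt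
  · rw [interior_Ioi] at hs
    have := mul_nonneg (le_of_lt hs) (hU s hs)
    linarith

/-- The derivative of `(U - M)/s` is `-(P - M)/s²`, with `P` the function `pressure`. If `P` never
went below `M`, then `U/s` would be bounded above on `[1, ∞)`, against superlinearity. Monotonicity
of `P` spreads one small value to all larger densities. -/
lemma exists_pressure_lt (hU : ∀ s, 0 < s → 0 ≤ deriv (deriv L.U) s) (M : ℝ) :
    ∃ s₀ > 0, ∀ s, s₀ ≤ s → L.pressure s < M := by
  have hanti := H.antitoneOn_pressure hU
  by_contra! hc
  have hge : ∀ s, 0 < s → M ≤ L.pressure s := fun s hs => by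
    obtain ⟨s', h1, h2⟩ := hc s hs
    exact h2.trans (hanti hs (hs.trans_le h1) h1)
  have hd : ∀ s, 0 < s → HasDerivAt (fun s => L.U s / s - M / s)
      (-(L.pressure s - M) / s ^ 2) s := fun s hs => by
    have h1 := ((H.hasDerivAt_U hs).div (hasDerivAt_id s) hs.ne').sub
      (hasDerivAt_density (R := M) hs)
    refine h1.congr_deriv ?_
    simp only [pressure, id]
    field_simp
    ring
  have hle : ∀ s, 1 ≤ s → L.U s / s - M / s ≤ L.U 1 - M := fun s hs => by
    have hA : AntitoneOn (fun s => L.U s / s - M / s) (Ici 1) := by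
      refine antitoneOn_of_hasDerivWithinAt_nonpos (convex_Ici 1)
        (fun s hs => (hd s (one_pos.trans_le hs)).continuousAt.continuousWithinAt)
        (f' := fun s => -(L.pressure s - M) / s ^ 2) (fun s hs => ?_) fun s hs => ?_
      · exact (hd s (one_pos.trans_le (interior_subset hs))).hasDerivWithinAt
      · have h1 := hge s (one_pos.trans_le (interior_subset hs))
        exact div_nonpos_of_nonpos_of_nonneg (by linarith) (sq_nonneg s)
    simpa using hA (self_mem_Ici (a := (1 : ℝ))) hs hs
  obtain ⟨s, hs1, hs2⟩ := ((H.superlinear.eventually_gt_atTop (L.U 1 - M + |M|)).and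
    (eventually_ge_atTop 1)).exists
  have h1 := hle s hs2
  have h2 : M / s ≤ |M| := by
    calc M / s ≤ |M| / s := div_le_div_of_nonneg_right (le_abs_self M) (by linarith)
      _ ≤ |M| := div_le_self (abs_nonneg M) hs2
  linarith

lemma continuous_deriv_cur : Continuous (deriv L.cur) := H.cur.continuous_deriv (by norm_num)

lemma exists_ρ_ge : ∃ m > 0, ∀ X ∈ Icc L.a L.b, m ≤ L.ρ X := by
  obtain ⟨X, hX, h⟩ := isCompact_Icc.exists_isMinOn (nonempty_Icc.2 H.le)
    (H.continuous_ρ.continuousOn (s := Icc L.a L.b))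
  exact ⟨L.ρ X, H.ρ_pos X hX, fun Y hY => h hY⟩

/-- The stress of the step functional. -/
noncomputable def stress (hU : ∀ s, 0 < s → 0 ≤ deriv (deriv L.U) s) :
    StressLaw L.a L.b L.τ where
  Ψ X p := L.U (L.ρ X / p) * p + L.τ / 2 * (p - deriv L.cur X) ^ 2
  σ X p := L.pressure (L.ρ X / p) + L.τ * (p - deriv L.cur X)
  lt := H.lt
  pos := H.τ_pos
  hasDerivAt X hX p hp := by
    have h1 := (H.hasDerivAt_internal (H.ρ_pos X hX) hp).add
      ((((hasDerivAt_id p).sub_const (deriv L.cur X)).pow 2).const_mul (L.τ / 2))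
    exact h1.congr_deriv (by simp; ring)
  continuousOn_energy := by
    have h1 := H.continuous_deriv_cur
    have h2 := H.continuous_ρ
    refine ContinuousOn.add (ContinuousOn.mul ?_ continuousOn_snd)
      (Continuous.continuousOn (by fun_prop))
    exact H.U.continuousOn.comp
      ((h2.comp continuous_fst).continuousOn.div continuousOn_snd fun z hz => (ne_of_gt hz.2))
      fun z hz => div_pos (H.ρ_pos _ hz.1) hz.2
  continuousOn := by
    have h1 := H.continuous_deriv_cur
    have h2 := H.continuous_ρ
    refine ContinuousOn.add ?_ (Continuous.continuousOn (by fun_prop))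
    exact H.continuousOn_pressure.comp
      ((h2.comp continuous_fst).continuousOn.div continuousOn_snd fun z hz => (ne_of_gt hz.2))
      fun z hz => div_pos (H.ρ_pos _ hz.1) hz.2
  mono X hX p q hp hpq := by
    have hR := H.ρ_pos X hX
    have := H.antitoneOn_pressure hU (div_pos hR (hp.trans_le hpq)) (div_pos hR hp)
      (div_le_div_of_nonneg_left hR.le hp hpq)
    linarith
  bot M := by
    obtain ⟨m, hm, hmρ⟩ := H.exists_ρ_ge
    obtain ⟨C, hC⟩ := isCompact_Icc.exists_bound_of_continuousOn
      (H.continuous_deriv_cur.continuousOn (s := Icc L.a L.b))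
    obtain ⟨s₀, hs₀, hs⟩ := H.exists_pressure_lt hU (M - L.τ * (1 + C))
    -- A slope below `m / s₀` pushes the density above `s₀`; a slope below `1` bounds the part of
    -- the stress that comes from the gradient penalty.
    refine ⟨min 1 (m / s₀), by positivity, fun X hX p hp hpm => ?_⟩
    have h1 : s₀ ≤ L.ρ X / p := by
      have := hpm.trans (min_le_right _ _)
      rw [le_div_iff₀ hs₀] at this
      rw [le_div_iff₀ hp]
      linarith [hmρ X hX]
    have h2 := hs _ h1
    have h3 : p - deriv L.cur X ≤ 1 + C := by
      have := (abs_le.1 (hC X hX)).1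
      linarith [hpm.trans (min_le_left _ _)]
    linarith [mul_le_mul_of_nonneg_left h3 H.τ_pos.le]
  lip m M hm := by
    have hc : ContinuousOn (fun z : ℝ × ℝ => deriv (deriv L.U) (L.ρ z.1 / z.2) * L.ρ z.1 ^ 2 /
        z.2 ^ 3) (Icc L.a L.b ×ˢ Icc m M) := by
      have h2 := H.continuous_ρ
      have hz : ∀ z ∈ Icc L.a L.b ×ˢ Icc m M, 0 < z.2 := fun z hz => hm.trans_le hz.2.1
      refine ContinuousOn.div (ContinuousOn.mul ?_ (Continuous.continuousOn (by fun_prop)))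
        (Continuous.continuousOn (by fun_prop)) fun z h => (pow_pos (hz z h) 3).ne'
      exact H.continuousOn_deriv2_U.comp
        ((h2.comp continuous_fst).continuousOn.div continuousOn_snd fun z h => (hz z h).ne')
        fun z h => div_pos (H.ρ_pos _ h.1) (hz z h)
    obtain ⟨C, hC⟩ := (isCompact_Icc.prod isCompact_Icc).exists_bound_of_continuousOn hc
    refine ⟨max C 0 + L.τ, add_nonneg (le_max_right _ _) H.τ_pos.le, fun X hX p q hmp hpq hqM => ?_⟩
    have hR := H.ρ_pos X hX
    have key := (convex_Icc p q).image_sub_le_mul_sub_of_deriv_le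
      (f := fun p => L.pressure (L.ρ X / p)) (C := max C 0)
      (fun z hz => (H.hasDerivAt_pressure_comp hR
        (hm.trans_le (hmp.trans hz.1))).continuousAt.continuousWithinAt)
      (fun z hz => (H.hasDerivAt_pressure_comp hR (hm.trans_le (hmp.trans
        (interior_subset hz).1))).differentiableAt.differentiableWithinAt)
      (fun z hz => by
        have hz' := interior_subset hz
        rw [(H.hasDerivAt_pressure_comp hR (hm.trans_le (hmp.trans hz'.1))).deriv]
        exact ((le_abs_self _).trans (hC (X, z) ⟨hX, hmp.trans hz'.1, hz'.2.trans hqM⟩)).trans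
          (le_max_left _ _))
      p (left_mem_Icc.2 hpq) q (right_mem_Icc.2 hpq) hpq
    linarith

lemma forceLaw_f_congr {x y : ℝ → ℝ} (h : EqOn x y (Icc L.a L.b)) {X : ℝ}
    (hX : X ∈ Icc L.a L.b) : H.forceLaw.f x X = H.forceLaw.f y X := by
  have h1 : L.inertiaForce x X = L.inertiaForce y X := by simp [inertiaForce, bdf, h hX]
  have h2 : L.potentialForce x X = L.potentialForce y X := by
    simp only [potentialForce, h hX]
    congr 2
    refine intervalIntegral.integral_congr fun Y hY => ?_
    rw [uIcc_of_le H.le] at hY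
    simp only [h hY]
  simp only [forceLaw, h1, h2]

/-- The stress `g` of `exists_equilibrium` is differentiable with derivative the force. Since the
stress has `p`-derivative at least `τ > 0`, the slope is differentiable inside with a derivative
that is continuous up to the endpoints. Freezing that derivative outside `[a, b]` extends the map to
a `C²` map of the line. -/
theorem exists_isEquilibrium (hU : ∀ s, 0 < s → 0 ≤ deriv (deriv L.U) s) :
    ∃ x, L.IsEquilibrium x := by
  set S := H.stress hU with hS
  obtain ⟨g, c, hg, hgn, hbal⟩ := S.exists_equilibrium H.forceLaw
  set f := H.forceLaw.f (S.flow g) with hf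
  have hfc : Continuous f := H.forceLaw.continuous _ (S.isAdmissible_flow hg hgn)
  set p : ℝ → ℝ := fun X => S.inv X (g X) with hp
  have hpc : Continuous p := S.continuous_inv_comp hg
  have hp0 : ∀ X, 0 < p X := fun X => S.inv_pos _ _
  have hσ : ∀ X ∈ Icc L.a L.b, L.pressure (L.ρ X / p X) + L.τ * (p X - deriv L.cur X) = g X :=
    fun X hX => S.σ_inv hX (g X)
  have hgd : ∀ X ∈ Ioo L.a L.b, HasDerivAt g (f X) X := fun X hX => by
    have h1 : HasDerivAt (fun X => c + ∫ Y in L.a..X, f Y) (f X) X :=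
      (hfc.integral_hasStrictDerivAt L.a X).hasDerivAt.const_add c
    refine h1.congr_of_eventuallyEq ?_
    filter_upwards [Ioo_mem_nhds hX.1 hX.2] with Y hY using hbal Y (Ioo_subset_Icc_self hY)
  have hρd : ∀ X, HasDerivAt L.ρ (deriv L.ρ X) X := fun X =>
    (H.ρ.differentiable one_ne_zero X).hasDerivAt
  have hcd : ∀ X, HasDerivAt (deriv L.cur) (deriv (deriv L.cur) X) X := fun X =>
    ((H.cur.iterate_deriv' 1 1).differentiable one_ne_zero X).hasDerivAt
  -- the derivative of the slope
  set A : ℝ → ℝ := fun X => -(L.ρ X / p X * deriv (deriv L.U) (L.ρ X / p X)) *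
    (deriv L.ρ X / p X) + L.τ * (-deriv (deriv L.cur) X) with hA
  set B : ℝ → ℝ := fun X => deriv (deriv L.U) (L.ρ X / p X) * L.ρ X ^ 2 / p X ^ 3 + L.τ with hB
  have hB0 : ∀ X ∈ Icc L.a L.b, 0 < B X := fun X hX => by
    have h1 := H.ρ_pos X hX
    have h2 := hU _ (div_pos h1 (hp0 X))
    have h3 := hp0 X
    have h4 := H.τ_pos
    positivity
  have hpd : ∀ X ∈ Ioo L.a L.b, HasDerivAt p ((f X - A X) / B X) X := by
    intro X hX
    have hXI := Ioo_subset_Icc_self hX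
    have hR := H.ρ_pos X hXI
    have hs := div_pos hR (hp0 X)
    have hAd : ∀ q, 0 < q → HasDerivAt
        (fun Y => L.pressure (L.ρ Y / q) + L.τ * (q - deriv L.cur Y))
        (-(L.ρ X / q * deriv (deriv L.U) (L.ρ X / q)) *
          (deriv L.ρ X / q) + L.τ * (-deriv (deriv L.cur) X)) X := fun q hq => by
      have h1 := (H.hasDerivAt_pressure (div_pos hR hq)).comp X ((hρd X).div_const q)
      exact h1.add (((hcd X).const_sub q).const_mul L.τ)
    refine hasDerivAt_of_implicit
      (F := fun z => L.pressure (L.ρ z.1 / z.2) + L.τ * (z.2 - deriv L.cur z.1)) (g := g)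
      ?_ (hAd _ (hp0 X)) ?_ (hB0 X hXI).ne' ?_ (hgd X hX) ?_
    · have h1 : DifferentiableAt ℝ (fun z : ℝ × ℝ => L.ρ z.1) (X, p X) :=
        DifferentiableAt.comp (g := L.ρ) (X, p X) (hρd X).differentiableAt differentiableAt_fst
      have h2 : DifferentiableAt ℝ (fun z : ℝ × ℝ => deriv L.cur z.1) (X, p X) :=
        DifferentiableAt.comp (g := deriv L.cur) (X, p X) (hcd X).differentiableAt
          differentiableAt_fst
      have h3 : DifferentiableAt ℝ (fun z : ℝ × ℝ => L.ρ z.1 / z.2) (X, p X) :=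
        h1.mul (DifferentiableAt.comp (g := fun q : ℝ => q⁻¹) (X, p X)
        (differentiableAt_inv (hp0 X).ne') differentiableAt_snd)
      have h4 : DifferentiableAt ℝ (fun z : ℝ × ℝ => L.pressure (L.ρ z.1 / z.2)) (X, p X) :=
        DifferentiableAt.comp (g := L.pressure) (X, p X)
          (H.hasDerivAt_pressure hs).differentiableAt h3
      exact h4.add ((differentiableAt_snd.sub h2).const_mul L.τ)
    · have h1 := (H.hasDerivAt_pressure_comp hR (hp0 X)).add
        (((hasDerivAt_id (p X)).sub_const (deriv L.cur X)).const_mul L.τ)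
      exact h1.congr_deriv (by simp [hB])
    -- By strong monotonicity the slope differs from `p X` by at most `1/τ` times a difference of
    -- stresses at fixed slope; that difference is differentiable and vanishes at `X`.
    · have h1 : (fun Y => (g Y - (L.pressure (L.ρ Y / p X) + L.τ * (p X - deriv L.cur Y))))
          =O[𝓝 X] fun Y => Y - X := by
        have h2 := ((hgd X hX).sub (hAd _ (hp0 X))).isBigO_sub
        refine h2.congr_left fun Y => ?_
        simp only [Pi.sub_apply]
        rw [hσ X hXI, sub_self, sub_zero]
      refine (Asymptotics.IsBigO.of_bound (1 / L.τ) ?_).trans h1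
      filter_upwards [Ioo_mem_nhds hX.1 hX.2] with Y hY
      have h3 := S.abs_sub_le (Ioo_subset_Icc_self hY) (hp0 X) (hp0 Y)
      rw [S.σ_inv (Ioo_subset_Icc_self hY)] at h3
      rw [Real.norm_eq_abs, Real.norm_eq_abs, one_div, inv_mul_eq_div]
      exact h3
    · filter_upwards [Ioo_mem_nhds hX.1 hX.2] with Y hY using hσ Y (Ioo_subset_Icc_self hY)
  have hp2 : ContinuousOn (fun X => (f X - A X) / B X) (Icc L.a L.b) := by
    have h1 := H.continuous_ρ
    have h2 : Continuous (deriv L.ρ) := H.ρ.continuous_deriv le_rfl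
    have h3 : Continuous (deriv (deriv L.cur)) :=
      (H.cur.iterate_deriv' 1 1).continuous_deriv le_rfl
    have h4 : ContinuousOn (fun X => deriv (deriv L.U) (L.ρ X / p X)) (Icc L.a L.b) :=
      H.continuousOn_deriv2_U.comp (h1.div hpc fun X => (hp0 X).ne').continuousOn
        fun X hX => div_pos (H.ρ_pos X hX) (hp0 X)
    have h5 : Continuous fun X => L.ρ X / p X := h1.div hpc fun X => (hp0 X).ne'
    have h6 : Continuous fun X => deriv L.ρ X / p X := h2.div hpc fun X => (hp0 X).ne'
    refine ContinuousOn.div (hfc.continuousOn.sub ?_) ?_ fun X hX => (hB0 X hX).ne'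
    · exact ((h5.continuousOn.mul h4).neg.mul h6.continuousOn).add
        (Continuous.continuousOn (by fun_prop))
    · refine ((h4.mul (Continuous.continuousOn (by fun_prop))).div
        (Continuous.continuousOn (by fun_prop)) fun X _ => (pow_pos (hp0 X) 3).ne').add
        continuousOn_const
  -- the `C²` extension
  set w : ℝ → ℝ := fun X => (f (clamp L.a L.b X) - A (clamp L.a L.b X)) / B (clamp L.a L.b X)
    with hw
  have hwc : Continuous w := by
    rw [← continuousOn_univ]
    exact hp2.comp (continuous_clamp _ _).continuousOn fun X _ => clamp_mem H.le X
  set q : ℝ → ℝ := fun X => p L.a + ∫ Y in L.a..X, w Y with hq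
  have hqd : ∀ X, HasDerivAt q (w X) X := fun X =>
    (hwc.integral_hasStrictDerivAt L.a X).hasDerivAt.const_add _
  have hqc : Continuous q := continuous_iff_continuousAt.2 fun X => (hqd X).continuousAt
  have hqp : EqOn q p (Icc L.a L.b) := fun X hX => by
    have h1 := integral_eq_sub_of_hasDerivAt_of_le hX.1 hpc.continuousOn (f' := w) (fun Y hY => by
      have hY' : Y ∈ Ioo L.a L.b := ⟨hY.1, hY.2.trans_le hX.2⟩
      have := hpd Y hY'
      rw [hw]; simp only [clamp_of_mem (Ioo_subset_Icc_self hY')]; exact this)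
      (hwc.intervalIntegrable _ _)
    rw [hq]; simp only [h1]; ring
  set x : ℝ → ℝ := fun X => L.a + ∫ Y in L.a..X, q Y with hx
  have hxd : ∀ X, HasDerivAt x (q X) X := fun X =>
    (hqc.integral_hasStrictDerivAt L.a X).hasDerivAt.const_add _
  have hxd' : deriv x = q := funext fun X => (hxd X).deriv
  have hxe : EqOn x (S.flow g) (Icc L.a L.b) := fun X hX => by
    simp only [hx, StressLaw.flow]
    congr 1
    refine intervalIntegral.integral_congr fun Y hY => ?_
    rw [uIcc_of_le hX.1] at hY
    exact hqp ⟨hY.1, hY.2.trans hX.2⟩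
  refine ⟨x, ?_, by simp [hx], ?_, fun X hX => ?_, fun X hX => ?_⟩
  · have h1 : ContDiff ℝ 1 q := contDiff_one_iff_deriv.2
      ⟨fun X => (hqd X).differentiableAt, by rwa [funext fun X => (hqd X).deriv]⟩
    have : ContDiff ℝ (1 + 1) x := contDiff_succ_iff_deriv.2
      ⟨fun X => (hxd X).differentiableAt, by simp, by rwa [hxd']⟩
    simpa [one_add_one_eq_two] using this
  · rw [hxe (right_mem_Icc.2 H.le), S.flow_right hgn]
  · rw [hxd', hqp (Ioo_subset_Icc_self hX)]; exact hp0 X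
  · have h1 : L.inertiaForce x X + L.potentialForce x X = f X :=
      H.forceLaw_f_congr hxe (Ioo_subset_Icc_self hX)
    rw [h1]
    refine (hgd X hX).congr_of_eventuallyEq ?_
    filter_upwards [Ioo_mem_nhds hX.1 hX.2] with Y hY
    rw [hxd', hqp (Ioo_subset_Icc_self hY)]
    exact hσ Y (Ioo_subset_Icc_self hY)

end Regular
end LineData
end WassersteinBDF2

/-! ### Equilibria are minimizers, minimizers are unique, and the residual of the scheme. -/

namespace WassersteinBDF2

open Set intervalIntegral

namespace LineData
namespace Regular

variable {L : LineData} (H : L.Regular)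
include H

lemma intervalIntegrable_iff_Ioo {f : ℝ → ℝ} :
    IntervalIntegrable f volume L.a L.b ↔ IntegrableOn f (Ioo L.a L.b) := by
  rw [intervalIntegrable_iff_integrableOn_Ioc_of_le H.le, integrableOn_Ioc_iff_integrableOn_Ioo]

/-- Separates the part that depends on the slope, convex through `Ψ`, from the part that depends on
values, which has a uniform expansion. Membership in the domain supplies the integrability, as the
slope may vanish. -/
lemma functional_eq (hU : ∀ s, 0 < s → 0 ≤ deriv (deriv L.U) s) {x : ℝ → ℝ} (hx : x ∈ L.dom) :
    IntervalIntegrable (fun X => (H.stress hU).Ψ X (deriv x X)) volume L.a L.b ∧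
      L.functional x = (∫ X in L.a..L.b, (H.stress hU).Ψ X (deriv x X)) + H.forceLaw.B x := by
  have h1 : IntervalIntegrable (L.internal x) volume L.a L.b :=
    H.intervalIntegrable_iff_Ioo.2 hx.2.2
  have h2 : Continuous fun X => L.τ / 2 * (deriv x X - deriv L.cur X) ^ 2 := by
    have := H.continuous_deriv_cur
    have := hx.1.1.continuous_deriv (by norm_num : (1 : WithTop ℕ∞) ≤ 2)
    fun_prop
  refine ⟨h1.add (h2.intervalIntegrable _ _), ?_⟩
  have h3 : ∫ X in L.a..L.b, (H.stress hU).Ψ X (deriv x X) =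
      (∫ X in L.a..L.b, L.internal x X) +
        ∫ X in L.a..L.b, L.τ / 2 * (deriv x X - deriv L.cur X) ^ 2 :=
    intervalIntegral.integral_add h1 (h2.intervalIntegrable _ _)
  rw [h3, intervalIntegral.integral_const_mul]
  simp only [functional, energy, forceLaw]
  ring

lemma isAdmissible_of_mem_dom {x : ℝ → ℝ} (hx : x ∈ L.dom) : IsAdmissible L.a L.b x :=
  H.isAdmissible_of_deriv_nonneg (hx.1.1.of_le (by norm_num)) hx.1.2.1 hx.1.2.2
    (nonneg_of_ae_pos H.lt (hx.1.1.continuous_deriv (by norm_num)) hx.2.1)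

/-- Quantitative convexity of the step functional. -/
lemma functional_combo_le (hE : ConvexOn ℝ L.dom L.energy) {x y : ℝ → ℝ} (hx : x ∈ L.dom)
    (hy : y ∈ L.dom) {s t : ℝ} (hs : 0 ≤ s) (ht : 0 ≤ t) (hst : s + t = 1) :
    L.functional (s • x + t • y) ≤ s * L.functional x + t * L.functional y -
      s * t * ((1 + 2 * L.r) / (2 * L.τ * (1 + L.r)) *
        ∫ X in L.a..L.b, L.ρ X * (x X - y X) ^ 2) := by
  have hE' := hE.2 hx hy hs ht hst
  simp only [smul_eq_mul] at hE'
  have hxc := hx.1.1.continuous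
  have hyc := hy.1.1.continuous
  have hxd : Continuous (deriv x) := hx.1.1.continuous_deriv (by norm_num)
  have hyd : Continuous (deriv y) := hy.1.1.continuous_deriv (by norm_num)
  have hcd := H.continuous_deriv_cur
  have hρ := H.continuous_ρ
  have hbx := H.continuous_bdf hxc
  have hby := H.continuous_bdf hyc
  have hτ := H.τ_pos
  have hr := H.r_pos
  have hsx : Continuous (s • x + t • y) := (hxc.const_smul s).add (hyc.const_smul t)
  have hbs := H.continuous_bdf hsx
  have hs' : s = 1 - t := by linarith
  have hder : ∀ X, deriv (s • x + t • y) X = s * deriv x X + t * deriv y X := fun X =>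
    ((((hx.1.1.differentiable (by norm_num)) X).hasDerivAt.const_smul s).add
      (((hy.1.1.differentiable (by norm_num)) X).hasDerivAt.const_smul t)).deriv
  -- For a quadratic functional the convexity defect is exact; this term is what later separates two
  -- minimizers.
  have hI : L.inertia (s • x + t • y) = s * L.inertia x + t * L.inertia y -
      s * t * ((1 + 2 * L.r) / (2 * L.τ * (1 + L.r)) *
        ∫ X in L.a..L.b, L.ρ X * (x X - y X) ^ 2) := by
    simp only [inertia]
    simp only [← intervalIntegral.integral_const_mul]
    rw [← intervalIntegral.integral_add, ← intervalIntegral.integral_sub]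
    · refine intervalIntegral.integral_congr fun X _ => ?_
      simp only [bdf, Pi.add_apply, Pi.smul_apply, smul_eq_mul]
      rw [hs']
      field_simp
      ring
    all_goals exact Continuous.intervalIntegrable (by fun_prop) _ _
  have hD : ∫ X in L.a..L.b, (deriv (s • x + t • y) X - deriv L.cur X) ^ 2 ≤
      s * (∫ X in L.a..L.b, (deriv x X - deriv L.cur X) ^ 2) +
        t * ∫ X in L.a..L.b, (deriv y X - deriv L.cur X) ^ 2 := by
    simp only [hder, ← intervalIntegral.integral_const_mul]
    rw [← intervalIntegral.integral_add (Continuous.intervalIntegrable (by fun_prop) _ _)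
      (Continuous.intervalIntegrable (by fun_prop) _ _)]
    refine integral_mono_on H.le (Continuous.intervalIntegrable (by fun_prop) _ _)
      (Continuous.intervalIntegrable (by fun_prop) _ _) fun X _ => ?_
    have : 0 ≤ s * t * (deriv x X - deriv y X) ^ 2 := by positivity
    subst hs'
    nlinarith
  have hD' := mul_le_mul_of_nonneg_left hD (half_pos hτ).le
  simp only [functional]
  rw [hI]
  linarith

lemma convexOn_functional (hE : ConvexOn ℝ L.dom L.energy) :
    ConvexOn ℝ L.dom L.functional := by
  refine ⟨hE.1, fun x hx y hy s t hs ht hst => ?_⟩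
  have h1 := H.functional_combo_le hE hx hy hs ht hst
  have h2 : 0 ≤ s * t * ((1 + 2 * L.r) / (2 * L.τ * (1 + L.r)) *
        ∫ X in L.a..L.b, L.ρ X * (x X - y X) ^ 2) := by
    have hτ := H.τ_pos
    have hr := H.r_pos
    refine mul_nonneg (mul_nonneg hs ht) (mul_nonneg (by positivity) ?_)
    exact intervalIntegral.integral_nonneg H.le fun X hX =>
      mul_nonneg (H.ρ_pos X hX).le (sq_nonneg _)
  simp only [smul_eq_mul]
  linarith

/-- At the midpoint of two minimizers the quantitative convexity leaves a gap proportional to `∫ ρ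
(x - y)²`, which must vanish. -/
lemma eqOn_of_isMinOn (hE : ConvexOn ℝ L.dom L.energy) {x y : ℝ → ℝ} (hx : x ∈ L.dom)
    (hy : y ∈ L.dom) (hmx : IsMinOn L.functional L.dom x) (hmy : IsMinOn L.functional L.dom y) :
    EqOn y x (Icc L.a L.b) := by
  have hh : (0 : ℝ) ≤ 1 / 2 := by norm_num
  have h1 := H.functional_combo_le hE hx hy hh hh (by norm_num)
  have h2 := hmx (hE.1 hx hy hh hh (by norm_num))
  have h3 := hmy hx
  have h4 := hmx hy
  have hτ := H.τ_pos
  have hr := H.r_pos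
  change L.functional x ≤ _ at h2
  change L.functional y ≤ _ at h3
  change L.functional x ≤ _ at h4
  have hc : 0 < (1 + 2 * L.r) / (2 * L.τ * (1 + L.r)) := by positivity
  have h5 : ∫ X in L.a..L.b, L.ρ X * (x X - y X) ^ 2 ≤ 0 := by
    by_contra! hpos
    have := mul_pos hc hpos
    linarith
  have hρ := H.continuous_ρ
  have hxc := hx.1.1.continuous
  have hyc := hy.1.1.continuous
  intro X hX
  have h6 := eqOn_zero_of_integral_eq_zero H.lt
    (by fun_prop : Continuous fun X => L.ρ X * (x X - y X) ^ 2).continuousOn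
    (fun X hX => mul_nonneg (H.ρ_pos X hX).le (sq_nonneg _)) h5 X hX
  have h7 := (mul_eq_zero.1 h6).resolve_left (H.ρ_pos X hX).ne'
  have h8 := (pow_eq_zero_iff two_ne_zero).1 h7
  linarith

lemma isAdmissible_of_isEquilibrium {x : ℝ → ℝ} (hx : L.IsEquilibrium x) :
    IsAdmissible L.a L.b x :=
  H.isAdmissible_of_deriv_nonneg (hx.contDiff.of_le (by norm_num)) hx.left hx.right
    (ge_on_Icc H.lt (hx.contDiff.continuous_deriv (by norm_num)) fun X hX => (hx.pos X hX).le)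

/-- The stress of an equilibrium is bounded, which keeps its slope away from `0`. -/
lemma deriv_pos_of_isEquilibrium (hU : ∀ s, 0 < s → 0 ≤ deriv (deriv L.U) s) {x : ℝ → ℝ}
    (hx : L.IsEquilibrium x) : ∀ X ∈ Icc L.a L.b, 0 < deriv x X := by
  set g : ℝ → ℝ := fun X => L.pressure (L.ρ X / deriv x X) + L.τ * (deriv x X - deriv L.cur X)
    with hg
  have hadm := H.isAdmissible_of_isEquilibrium hx
  set c := (L.a + L.b) / 2
  have hc : c ∈ Ioo L.a L.b := ⟨left_lt_add_div_two.2 H.lt, add_div_two_lt_right.2 H.lt⟩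
  have hK := H.forceLaw.K_nonneg H.le
  have hbd : ∀ X ∈ Ioo L.a L.b, |g X - g c| ≤ H.forceLaw.K * |X - c| := fun X hX =>
    (convex_Ioo L.a L.b).norm_image_sub_le_of_norm_hasDerivWithin_le (f := g)
      (f' := H.forceLaw.f x) (fun Y hY => (hx.balance Y hY).hasDerivWithinAt)
      (fun Y hY => H.forceLaw.bound x hadm Y (Ioo_subset_Icc_self hY)) hc hX
  -- The force is bounded by `K`, so inside the interval the stress stays above this level; slopes
  -- below `m` are therefore excluded.
  obtain ⟨m, hm, hbot⟩ := (H.stress hU).bot (g c - H.forceLaw.K * (L.b - L.a))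
  have hge : ∀ X ∈ Ioo L.a L.b, m ≤ deriv x X := by
    intro X hX
    by_contra! hlt
    have h1 : g X < _ := hbot X (Ioo_subset_Icc_self hX) _ (hx.pos X hX) hlt.le
    have h2 := (abs_le.1 (hbd X hX)).1
    have h3 : |X - c| ≤ L.b - L.a := by
      rw [abs_le]; constructor <;> linarith [hX.1, hX.2, hc.1, hc.2]
    linarith [mul_le_mul_of_nonneg_left h3 hK]
  exact fun X hX => hm.trans_le (ge_on_Icc H.lt
    (hx.contDiff.continuous_deriv (by norm_num)) hge X hX)

lemma mem_dom_of_isEquilibrium (hU : ∀ s, 0 < s → 0 ≤ deriv (deriv L.U) s) {x : ℝ → ℝ}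
    (hx : L.IsEquilibrium x) : x ∈ L.dom :=
  H.mem_dom_of_deriv_pos hx.contDiff hx.left hx.right (H.deriv_pos_of_isEquilibrium hU hx)

/-- Equilibria minimize the step functional. -/
theorem isMinOn_of_isEquilibrium (hE : ConvexOn ℝ L.dom L.energy) {y : ℝ → ℝ}
    (hy : L.IsEquilibrium y) : IsMinOn L.functional L.dom y := by
  have hU : ∀ s, 0 < s → 0 ≤ deriv (deriv L.U) s := fun s hs => H.deriv2_U_nonneg hE hs
  set S := H.stress hU with hS
  have hypos := H.deriv_pos_of_isEquilibrium hU hy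
  have hydom := H.mem_dom_of_isEquilibrium hU hy
  have hyadm := H.isAdmissible_of_mem_dom hydom
  have hyd : Continuous (deriv y) := hy.contDiff.continuous_deriv (by norm_num)
  set g : ℝ → ℝ := fun X => S.σ X (deriv y X) with hg
  have hgc : ContinuousOn g (Icc L.a L.b) :=
    S.continuousOn.comp (f := fun X => (X, deriv y X)) (by fun_prop) fun X hX => ⟨hX, hypos X hX⟩
  set f := H.forceLaw.f y with hf
  have hfc : Continuous f := H.forceLaw.continuous y hyadm
  have hgd : ∀ X ∈ Ioo L.a L.b, HasDerivAt g (f X) X := hy.balance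
  intro z hz
  change L.functional y ≤ L.functional z
  have hzadm := H.isAdmissible_of_mem_dom hz
  have hzd : Continuous (deriv z) := hz.1.1.continuous_deriv (by norm_num)
  have hznn : ∀ X ∈ Icc L.a L.b, 0 ≤ deriv z X := nonneg_of_ae_pos H.lt hzd hz.2.1
  have hyc := hyadm.1
  have hzc := hzadm.1
  have hba := sub_pos.2 H.lt
  have hyD : ∀ X, HasDerivAt y (deriv y X) X := fun X =>
    (hy.contDiff.differentiable (by norm_num) X).hasDerivAt
  have hzD : ∀ X, HasDerivAt z (deriv z X) X := fun X =>
    (hz.1.1.differentiable (by norm_num) X).hasDerivAt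
  have hparts : ∫ X in L.a..L.b, g X * (deriv z X - deriv y X) =
      -∫ X in L.a..L.b, f X * (z X - y X) := by
    have := integral_mul_deriv_eq_deriv_mul_of_hasDerivAt (a := L.a) (b := L.b) (u := g)
      (v := fun X => z X - y X) (u' := f) (v' := fun X => deriv z X - deriv y X)
      (by rwa [uIcc_of_le H.le]) (by fun_prop)
      (by rw [min_eq_left H.le, max_eq_right H.le]; exact hgd)
      (fun X _ => (hzD X).sub (hyD X)) (hfc.intervalIntegrable _ _)
      (Continuous.intervalIntegrable (by fun_prop) _ _)
    rw [this, hy.left, hy.right, hz.1.2.1, hz.1.2.2]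
    ring
  -- Convexity of the functional gives `J(w) - J(y) ≤ t (J(z) - J(y))` for `w = (1 - t) y + t z`.
  -- The tangent inequality for `Ψ` and the expansion of `B` at `y` bound the left side below; their
  -- linear terms cancel by `hparts`, leaving the error `-ε t (b - a)`.
  have key : ∀ ε > 0, -(ε * (L.b - L.a)) ≤ L.functional z - L.functional y := by
    intro ε hε
    obtain ⟨δ₀, hδ₀, hexp⟩ := H.forceLaw.expansion ε hε
    set t := min (1 / 2) (δ₀ / (L.b - L.a)) with ht
    have ht0 : 0 < t := by positivity
    have ht1 : t ≤ 1 / 2 := min_le_left _ _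
    have htδ : t * (L.b - L.a) ≤ δ₀ := by
      rw [← le_div_iff₀ hba]; exact min_le_right _ _
    set w : ℝ → ℝ := (1 - t) • y + t • z with hw
    have hwdom : w ∈ L.dom := hE.1 hydom hz (by linarith) ht0.le (by ring)
    have hwadm := H.isAdmissible_of_mem_dom hwdom
    have hwX : ∀ X, w X - y X = t * (z X - y X) := fun X => by
      simp only [hw, Pi.add_apply, Pi.smul_apply, smul_eq_mul]; ring
    have hwd : ∀ X, deriv w X = (1 - t) * deriv y X + t * deriv z X := fun X =>
      (((hyD X).const_smul (1 - t)).add ((hzD X).const_smul t)).deriv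
    have hconv : L.functional w ≤ (1 - t) * L.functional y + t * L.functional z :=
      (H.convexOn_functional hE).2 hydom hz (by linarith) ht0.le (by ring)
    obtain ⟨iw, ew⟩ := H.functional_eq hU hwdom
    obtain ⟨iy, ey⟩ := H.functional_eq hU hydom
    have hgi : IntervalIntegrable (fun X => g X * (deriv z X - deriv y X)) volume L.a L.b :=
      (hgc.mul (by fun_prop)).intervalIntegrable_of_Icc H.le
    have hΨ : t * ∫ X in L.a..L.b, g X * (deriv z X - deriv y X) ≤
        (∫ X in L.a..L.b, S.Ψ X (deriv w X)) - ∫ X in L.a..L.b, S.Ψ X (deriv y X) := by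
      rw [← intervalIntegral.integral_const_mul, ← intervalIntegral.integral_sub iw iy]
      refine integral_mono_on H.le (hgi.const_mul t) (iw.sub iy) fun X hX => ?_
      have h1 := hypos X hX
      have h2 := mul_nonneg ht0.le (hznn X hX)
      -- The slope of `z` may vanish, but the share `1 - t` of the positive slope of `y` keeps `w`
      -- where the stress law applies.
      have h3 : 0 < deriv w X := by
        rw [hwd]
        have : 0 < (1 - t) * deriv y X := mul_pos (by linarith) h1
        linarith
      have h4 := S.sub_le hX h3 h1
      have h5 : deriv y X - deriv w X = -(t * (deriv z X - deriv y X)) := by rw [hwd]; ring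
      rw [h5] at h4
      simp only [hg]
      linarith
    have hB := (abs_le.1 (hexp y w hyadm hwadm (t * (L.b - L.a)) htδ fun X hX => ?_)).1
    · have h6 : ∫ X in L.a..L.b, f X * (w X - y X) = t * ∫ X in L.a..L.b, f X * (z X - y X) := by
        rw [← intervalIntegral.integral_const_mul]
        refine intervalIntegral.integral_congr fun X _ => ?_
        simp only [hwX]; ring
      rw [← hf, h6] at hB
      rw [hparts] at hΨ
      have h7 : t * (-(ε * (L.b - L.a))) ≤ t * (L.functional z - L.functional y) := by
        rw [ew] at hconv
        rw [ey] at hconv ⊢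
        linarith
      exact le_of_mul_le_mul_left h7 ht0
    · rw [hwX, abs_mul, abs_of_pos ht0]
      refine mul_le_mul_of_nonneg_left ?_ ht0.le
      have h1 := hyadm.2 hX
      have h2 := hzadm.2 hX
      rw [abs_le]; constructor <;> linarith [h1.1, h1.2, h2.1, h2.2]
  have hlim : Tendsto (fun ε : ℝ => -(ε * (L.b - L.a))) (𝓝[>] 0) (𝓝 0) := by
    have : Continuous fun ε : ℝ => -(ε * (L.b - L.a)) := by fun_prop
    simpa using (this.tendsto 0).mono_left nhdsWithin_le_nhds
  have := le_of_tendsto hlim (by filter_upwards [self_mem_nhdsWithin] with ε hε using key ε hε)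
  linarith

/-- The derivative of the interaction potential generated by a map. -/
lemma hasDerivAt_interaction {x : ℝ → ℝ} (hx : Continuous x) (y : ℝ) :
    HasDerivAt (fun y => ∫ Y in L.a..L.b, L.W y (x Y) * L.ρ Y)
      (∫ Y in L.a..L.b, L.W₁ y (x Y) * L.ρ Y) y := by
  have hρ := H.continuous_ρ
  have hW := H.W.continuous
  have hW1 := H.continuous_W₁
  have c0 : ∀ y, Continuous fun Y => L.W y (x Y) * L.ρ Y := fun y =>
    (hW.comp (by fun_prop : Continuous fun Y => (y, x Y))).mul hρ
  have c1 : ∀ y, Continuous fun Y => L.W₁ y (x Y) * L.ρ Y := fun y =>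
    (hW1.comp (by fun_prop : Continuous fun Y => (y, x Y))).mul hρ
  have c2 : Continuous fun z : ℝ × ℝ => L.W₁ z.1 (x z.2) * L.ρ z.2 :=
    (hW1.comp (by fun_prop : Continuous fun z : ℝ × ℝ => (z.1, x z.2))).mul (by fun_prop)
  obtain ⟨C, hC⟩ := ((isCompact_closedBall y 1).prod
    (isCompact_uIcc (a := L.a) (b := L.b))).exists_bound_of_continuousOn c2.continuousOn
  refine (hasDerivAt_integral_of_dominated_loc_of_deriv_le (bound := fun _ => C)
    (Metric.closedBall_mem_nhds y one_pos) (.of_forall fun y => (c0 y).aestronglyMeasurable)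
    ((c0 y).intervalIntegrable _ _) (c1 y).aestronglyMeasurable
    (.of_forall fun Y hY z hz => hC (z, Y) ⟨hz, uIoc_subset_uIcc hY⟩) (by simp)
    (.of_forall fun Y _ z _ => ?_)).2
  have h1 : HasDerivAt (fun y : ℝ => (y, x Y)) ((1, 0) : ℝ × ℝ) z :=
    (hasDerivAt_id z).prodMk (hasDerivAt_const z _)
  exact (HasFDerivAt.comp_hasDerivAt (l := fun p : ℝ × ℝ => L.W p.1 p.2) z
    (H.W.differentiable one_ne_zero (z, x Y)).hasFDerivAt h1).mul_const _

/-- The residual of the scheme is the residual of the balance of stress and force. -/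
lemma exists_hasDerivAt_stress {x : ℝ → ℝ} (hx : ContDiff ℝ 2 x)
    (hpos : ∀ X ∈ Ioo L.a L.b, 0 < deriv x X) {X : ℝ} (hX : X ∈ Ioo L.a L.b) :
    ∃ g' m', HasDerivAt
      (fun X => L.pressure (L.ρ X / deriv x X) + L.τ * (deriv x X - deriv L.cur X)) g' X ∧
      HasDerivAt (fun X => deriv L.U (L.ρ X / deriv x X) + L.V (x X) +
        ∫ Y in L.a..L.b, L.W (x X) (x Y) * L.ρ Y) m' X ∧
      L.ρ X / (L.τ * (1 + L.r)) * L.bdf x X - L.τ * (deriv (deriv x) X - deriv (deriv L.cur) X) +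
        L.ρ X * (m' / deriv x X) = L.inertiaForce x X + L.potentialForce x X - g' := by
  have hXp := hpos X hX
  have hR := H.ρ_pos X (Ioo_subset_Icc_self hX)
  have hs := div_pos hR hXp
  have hxd : HasDerivAt x (deriv x X) X := (hx.differentiable (by norm_num) X).hasDerivAt
  have hxdd : HasDerivAt (deriv x) (deriv (deriv x) X) X :=
    ((hx.iterate_deriv' 1 1).differentiable one_ne_zero X).hasDerivAt
  have hcd : HasDerivAt (deriv L.cur) (deriv (deriv L.cur) X) X :=
    ((H.cur.iterate_deriv' 1 1).differentiable one_ne_zero X).hasDerivAt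
  have hρd : HasDerivAt L.ρ (deriv L.ρ X) X := (H.ρ.differentiable one_ne_zero X).hasDerivAt
  have hVd : HasDerivAt L.V (deriv L.V (x X)) (x X) :=
    (H.V.differentiable one_ne_zero _).hasDerivAt
  obtain ⟨s', hs'⟩ : ∃ s', HasDerivAt (fun X => L.ρ X / deriv x X) s' X :=
    ⟨_, hρd.div hxdd hXp.ne'⟩
  have hp := (H.hasDerivAt_pressure hs).comp X hs'
  have hu := (H.hasDerivAt_deriv_U hs).comp X hs'
  have hW := (H.hasDerivAt_interaction hx.continuous (x X)).comp X hxd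
  refine ⟨_, _, hp.add ((hxdd.sub hcd).const_mul L.τ), (hu.add (hVd.comp X hxd)).add hW, ?_⟩
  simp only [inertiaForce, potentialForce]
  have hτ := H.τ_pos.ne'
  have hr : 1 + L.r ≠ 0 := by linarith [H.r_pos]
  field_simp
  ring

/-- The one-dimensional theorem. -/
theorem main (hE : ConvexOn ℝ L.dom L.energy) : ConvexOn ℝ L.dom L.functional ∧
    ∃ x, L.IsEquilibrium x ∧ (∀ y, L.IsEquilibrium y → EqOn y x (Icc L.a L.b)) ∧
      x ∈ L.dom ∧ IsMinOn L.functional L.dom x ∧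
      ∀ y ∈ L.dom, IsMinOn L.functional L.dom y → EqOn y x (Icc L.a L.b) := by
  have hU : ∀ s, 0 < s → 0 ≤ deriv (deriv L.U) s := fun s hs => H.deriv2_U_nonneg hE hs
  obtain ⟨x, hx⟩ := H.exists_isEquilibrium hU
  have hxd := H.mem_dom_of_isEquilibrium hU hx
  have hxm := H.isMinOn_of_isEquilibrium hE hx
  exact ⟨H.convexOn_functional hE, x, hx, fun y hy => H.eqOn_of_isMinOn hE hxd
    (H.mem_dom_of_isEquilibrium hU hy) hxm (H.isMinOn_of_isEquilibrium hE hy), hxd, hxm,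
    fun y hy hym => H.eqOn_of_isMinOn hE hxd hy hxm hym⟩

end Regular
end LineData
end WassersteinBDF2

/-! ### In dimension at least two the energy domain is not convex. -/

namespace WassersteinBDF2

open Set

/-- A regular map with positive Jacobian determinant up to the boundary has finite energy. -/
lemma mem_energyDomain {d : ℕ} {D : FlowData d} (hΩ : IsOpen D.Ω) (hbdd : Bornology.IsBounded D.Ω)
    (hρ : ContDiff ℝ 1 D.ρ₀) (hpos : ∀ X ∈ closure D.Ω, 0 < D.ρ₀ X)
    (hU : ContDiffOn ℝ 2 D.U (Ioi 0)) {x : Space d → Space d} (hx : IsDirichletMap D.Ω x)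
    (hj : ∀ X, 0 < jac x X) : x ∈ energyDomain D := by
  have hc : Continuous (jac x) :=
    ContinuousLinearMap.continuous_det.comp (hx.1.continuous_fderiv (by norm_num))
  refine ⟨hx, (ae_restrict_iff' hΩ.measurableSet).2 (.of_forall fun X _ => hj X), ?_⟩
  have : ContinuousOn (internalDensity D x) (closure D.Ω) := by
    refine ContinuousOn.mul ?_ hc.continuousOn
    exact hU.continuousOn.comp (hρ.continuous.div hc fun X => (hj X).ne').continuousOn
      fun X hX => div_pos (hpos X hX) (hj X)
  exact (this.integrableOn_compact hbdd.isCompact_closure).mono_set subset_closure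

section Rotation

variable {d : ℕ} (i j : Fin d)

/-- The projection to the coordinate plane of `i` and `j`. -/
noncomputable def planeProj : Space d →L[ℝ] Space d :=
  (EuclideanSpace.proj i).smulRight (EuclideanSpace.single i (1 : ℝ)) +
    (EuclideanSpace.proj j).smulRight (EuclideanSpace.single j (1 : ℝ))

/-- The infinitesimal rotation in the coordinate plane of `i` and `j`. -/
noncomputable def planeGen : Space d →L[ℝ] Space d :=
  (EuclideanSpace.proj i).smulRight (EuclideanSpace.single j (1 : ℝ)) -
    (EuclideanSpace.proj j).smulRight (EuclideanSpace.single i (1 : ℝ))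

/-- The rotation in the coordinate plane of `i` and `j`. -/
noncomputable def planeRot (θ : ℝ) : Space d →L[ℝ] Space d :=
  ContinuousLinearMap.id ℝ (Space d) + (Real.cos θ - 1) • planeProj i j + Real.sin θ • planeGen i j

lemma planeRot_zero : planeRot i j 0 = ContinuousLinearMap.id ℝ (Space d) := by
  ext v k; simp [planeRot]

lemma det_comp_eq (f g : Space d →L[ℝ] Space d) : (f ∘L g).det = f.det * g.det :=
  LinearMap.det_comp _ _

variable {i j} (hij : i ≠ j)
include hij

lemma planeProj_comp_planeProj : planeProj i j ∘L planeProj i j = planeProj i j := by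
  ext v k; simp [planeProj, hij, hij.symm]

lemma planeProj_comp_planeGen : planeProj i j ∘L planeGen i j = planeGen i j := by
  ext v k; simp [planeProj, planeGen, hij, hij.symm, sub_eq_add_neg]; try ring

lemma planeGen_comp_planeProj : planeGen i j ∘L planeProj i j = planeGen i j := by
  ext v k; simp [planeProj, planeGen, hij, hij.symm, sub_eq_add_neg]

lemma planeGen_comp_planeGen : planeGen i j ∘L planeGen i j = -planeProj i j := by
  ext v k; simp [planeProj, planeGen, hij, hij.symm]; ring

lemma planeRot_comp (α β : ℝ) :
    planeRot i j α ∘L planeRot i j β = planeRot i j (α + β) := by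
  simp only [planeRot, ContinuousLinearMap.comp_add, ContinuousLinearMap.add_comp,
    ContinuousLinearMap.comp_smul, ContinuousLinearMap.smul_comp, ContinuousLinearMap.comp_id,
    ContinuousLinearMap.id_comp, planeProj_comp_planeProj hij, planeProj_comp_planeGen hij,
    planeGen_comp_planeProj hij, planeGen_comp_planeGen hij, Real.cos_add, Real.sin_add]
  module

lemma planeRot_comp_planeGen (α : ℝ) : planeRot i j α ∘L planeGen i j =
    -Real.sin α • planeProj i j + Real.cos α • planeGen i j := by
  simp only [planeRot, ContinuousLinearMap.add_comp, ContinuousLinearMap.smul_comp,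
    ContinuousLinearMap.id_comp, planeProj_comp_planeGen hij, planeGen_comp_planeGen hij]
  module

/-- The determinant is the square of that of the half-angle rotation, which is invertible. -/
lemma det_planeRot_pos (α : ℝ) : 0 < (planeRot i j α).det := by
  have h1 : (planeRot i j α).det = (planeRot i j (α / 2)).det ^ 2 := by
    rw [sq, ← det_comp_eq, planeRot_comp hij, add_halves]
  have h2 : (planeRot i j (α / 2)).det * (planeRot i j (-(α / 2))).det = 1 := by
    rw [← det_comp_eq, planeRot_comp hij, add_neg_cancel, planeRot_zero]
    exact LinearMap.det_id
  rw [h1]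
  exact (sq_nonneg _).lt_of_ne (pow_ne_zero 2 (left_ne_zero_of_mul_eq_one h2)).symm

omit hij in
lemma inner_planeGen_self (v : Space d) : inner ℝ v (planeGen i j v) = 0 := by
  simp [planeGen, inner_sub_right, inner_smul_right, EuclideanSpace.inner_single_right]
  ring

omit hij in
lemma hasDerivAt_planeRot (α : ℝ) : HasDerivAt (planeRot i j)
    (-Real.sin α • planeProj i j + Real.cos α • planeGen i j) α :=
  ((((Real.hasDerivAt_cos α).sub_const 1).smul_const (planeProj i j)).const_add
    (ContinuousLinearMap.id ℝ (Space d))).add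
    ((Real.hasDerivAt_sin α).smul_const (planeGen i j))

variable (i j) in
/-- The map that rotates spheres about `c` by the angle `ψ (‖X - c‖ ^ 2)`. -/
noncomputable def twist (c : Space d) (ψ : ℝ → ℝ) (X : Space d) : Space d :=
  c + planeRot i j (ψ (‖X - c‖ ^ 2)) (X - c)

omit hij in
lemma contDiff_twist {c : Space d} {ψ : ℝ → ℝ} (hψ : ContDiff ℝ 2 ψ) :
    ContDiff ℝ 2 (twist i j c ψ) := by
  have h1 : ContDiff ℝ 2 fun X : Space d => X - c := contDiff_id.sub contDiff_const
  have h2 : ContDiff ℝ 2 fun X : Space d => ψ (‖X - c‖ ^ 2) := hψ.comp (h1.norm_sq ℝ)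
  have h3 : ContDiff ℝ 2 (planeRot i j) := by
    unfold planeRot
    exact (contDiff_const.add ((Real.contDiff_cos.sub contDiff_const).smul contDiff_const)).add
      (Real.contDiff_sin.smul contDiff_const)
  exact contDiff_const.add ((h3.comp h2).clm_apply h1)

/-- The derivative is the rotation composed with `id + dθ ⊗ (planeGen v)`. As `dθ` is a multiple of
the inner product with `v`, it annihilates `planeGen v`, and the second factor is a transvection of
determinant `1`. -/
lemma jac_twist_pos {c : Space d} {ψ : ℝ → ℝ} (hψ : ContDiff ℝ 2 ψ) (X : Space d) :
    0 < jac (twist i j c ψ) X := by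
  set v := X - c with hv
  set θ := ψ (‖X - c‖ ^ 2) with hθ
  have h1 : HasFDerivAt (fun X : Space d => X - c) (ContinuousLinearMap.id ℝ (Space d)) X :=
    (hasFDerivAt_id X).sub_const c
  have h2 : HasFDerivAt (fun X : Space d => ‖X - c‖ ^ 2) (2 • innerSL ℝ v) X := by
    have := (hasStrictFDerivAt_norm_sq (F := Space d) v).hasFDerivAt.comp X h1
    exact this.congr_fderiv (by ext1; simp)
  have h3 := (hψ.differentiable (by norm_num) (‖X - c‖ ^ 2)).hasDerivAt.comp_hasFDerivAt X h2
  set dθ : Space d →L[ℝ] ℝ := deriv ψ (‖X - c‖ ^ 2) • (2 • innerSL ℝ v) with hdθ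
  have h4 := (hasDerivAt_planeRot (i := i) (j := j) θ).hasFDerivAt.comp X h3
  have h5 := (h4.clm_apply h1).const_add c
  have h6 : HasFDerivAt (twist i j c ψ) (planeRot i j θ ∘L
      (ContinuousLinearMap.id ℝ (Space d) + dθ.smulRight (planeGen i j v))) X := by
    refine h5.congr_fderiv ?_
    rw [← planeRot_comp_planeGen hij]
    ext1 h
    simp [hθ, hv, hdθ]
    module
  have h7 : dθ (planeGen i j v) = 0 := by
    simp [hdθ, inner_planeGen_self]
  have h8 : (ContinuousLinearMap.id ℝ (Space d) + dθ.smulRight (planeGen i j v)).det = 1 := by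
    have : ((ContinuousLinearMap.id ℝ (Space d) + dθ.smulRight (planeGen i j v) :
        Space d →L[ℝ] Space d) : Space d →ₗ[ℝ] Space d) =
        LinearMap.transvection (dθ : Space d →ₗ[ℝ] ℝ) (planeGen i j v) := by
      ext1 h; rfl
    rw [ContinuousLinearMap.det, this, LinearMap.transvection.det]
    simp [h7]
  rw [jac, h6.fderiv, det_comp_eq, h8, mul_one]
  exact det_planeRot_pos hij θ

lemma det_id_sub_planeProj :
    (ContinuousLinearMap.id ℝ (Space d) - planeProj i j).det = 0 := by
  refine LinearMap.det_eq_zero_iff_ker_ne_bot.2 fun h => ?_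
  have h1 : EuclideanSpace.single i (1 : ℝ) ∈
      LinearMap.ker ((ContinuousLinearMap.id ℝ (Space d) - planeProj i j : Space d →L[ℝ] Space d) :
        Space d →ₗ[ℝ] Space d) := by
    rw [LinearMap.mem_ker]
    simp [planeProj, hij.symm]
  rw [h, Submodule.mem_bot] at h1
  have h2 := congrArg (fun v : Space d => v i) h1
  simp at h2

end Rotation

/-- In dimension at least two the maps of finite energy do not form a convex set. -/
theorem not_convex_energyDomain {d : ℕ} (hd : 2 ≤ d) {D : FlowData d} (hΩ : IsOpen D.Ω)
    (hne : D.Ω.Nonempty) (hbdd : Bornology.IsBounded D.Ω)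
    (hρ : ContDiff ℝ 1 D.ρ₀) (hpos : ∀ X ∈ closure D.Ω, 0 < D.ρ₀ X)
    (hU : ContDiffOn ℝ 2 D.U (Ioi 0)) : ¬ Convex ℝ (energyDomain D) := by
  intro hconv
  obtain ⟨c, hc⟩ := hne
  obtain ⟨δ, hδ, hball⟩ := Metric.isOpen_iff.1 hΩ c hc
  let i : Fin d := ⟨0, by omega⟩
  let j : Fin d := ⟨1, by omega⟩
  have hij : i ≠ j := by simp [i, j]
  -- As a function of the squared radius: angle `π` up to `δ² / 2`, angle `0` from `δ²` on, so the
  -- twist is trivial on the boundary.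
  let ψ : ℝ → ℝ := fun s => Real.pi * Real.smoothTransition (2 - 2 * s / δ ^ 2)
  have hψ : ContDiff ℝ 2 ψ := contDiff_const.mul
    (Real.smoothTransition.contDiff.comp (by fun_prop))
  have hψ0 : ∀ s, δ ^ 2 ≤ s → ψ s = 0 := fun s hs => by
    have : 2 - 2 * s / δ ^ 2 ≤ 0 := by
      rw [sub_nonpos, le_div_iff₀ (by positivity)]; linarith
    simp only [ψ, Real.smoothTransition.zero_of_nonpos this, mul_zero]
  have hψ1 : ∀ s, s ≤ δ ^ 2 / 2 → ψ s = Real.pi := fun s hs => by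
    have : 1 ≤ 2 - 2 * s / δ ^ 2 := by
      have : 2 * s / δ ^ 2 ≤ 1 := by rw [div_le_one (by positivity)]; linarith
      linarith
    simp only [ψ, Real.smoothTransition.one_of_one_le this, mul_one]
  have hid : (id : Space d → Space d) ∈ energyDomain D := by
    refine mem_energyDomain hΩ hbdd hρ hpos hU ⟨contDiff_id, fun X _ => rfl⟩ fun X => ?_
    rw [jac, fderiv_id]
    change (0 : ℝ) < LinearMap.det (LinearMap.id : Space d →ₗ[ℝ] Space d)
    rw [LinearMap.det_id]
    exact one_pos
  have htw : twist i j c ψ ∈ energyDomain D := by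
    refine mem_energyDomain hΩ hbdd hρ hpos hU ⟨contDiff_twist hψ, fun X hX => ?_⟩
      (jac_twist_pos hij hψ)
    have h1 : X ∉ Metric.ball c δ := fun h =>
      (hΩ.frontier_eq ▸ hX).2 (hball h)
    rw [Metric.mem_ball, not_lt, dist_eq_norm] at h1
    rw [twist, hψ0 _ (pow_le_pow_left₀ hδ.le h1 2), planeRot_zero]
    simp
  have hmid := hconv hid htw (by norm_num : (0 : ℝ) ≤ 1 / 2) (by norm_num : (0 : ℝ) ≤ 1 / 2)
    (by norm_num)
  set m := (1 / 2 : ℝ) • (id : Space d → Space d) + (1 / 2 : ℝ) • twist i j c ψ with hm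
  -- At angle `π` the rotation about `c` is `id - 2 * planeProj`, so the midpoint with the identity
  -- is `id - planeProj`, which is singular.
  have hjac : ∀ X ∈ Metric.ball c (δ / 2), jac m X = 0 := by
    intro X hX
    have hev : m =ᶠ[𝓝 X] fun Y =>
        (ContinuousLinearMap.id ℝ (Space d) - planeProj i j) (Y - c) + c := by
      filter_upwards [Metric.isOpen_ball.mem_nhds hX] with Y hY
      have h1 : ‖Y - c‖ ^ 2 ≤ δ ^ 2 / 2 := by
        rw [Metric.mem_ball, dist_eq_norm] at hY
        nlinarith [norm_nonneg (Y - c)]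
      simp only [hm, Pi.add_apply, Pi.smul_apply, id, twist, hψ1 _ h1, planeRot, Real.cos_pi,
        Real.sin_pi, _root_.add_apply, _root_.smul_apply, _root_.sub_apply,
        ContinuousLinearMap.id_apply]
      module
    have hd : HasFDerivAt (fun Y =>
        (ContinuousLinearMap.id ℝ (Space d) - planeProj i j) (Y - c) + c)
        (ContinuousLinearMap.id ℝ (Space d) - planeProj i j) X := by
      have := ((ContinuousLinearMap.id ℝ (Space d) - planeProj i j).hasFDerivAt
        (x := X - c)).comp X ((hasFDerivAt_id X).sub_const c)
      exact this.add_const c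
    rw [jac, (hd.congr_of_eventuallyEq hev).fderiv]
    exact det_id_sub_planeProj hij
  have hae := hmid.2.1
  rw [ae_restrict_iff' hΩ.measurableSet] at hae
  have hz : volume (Metric.ball c (δ / 2)) = 0 :=
    measure_mono_null (t := {X | ¬(X ∈ D.Ω → 0 < jac m X)})
      (fun X hX hc => (hc (hball (Metric.ball_subset_ball (by linarith) hX))).ne' (hjac X hX))
      (ae_iff.1 hae)
  exact (Metric.measure_ball_pos volume c (half_pos hδ)).ne' hz

end WassersteinBDF2

/-! ### Transfer between one-dimensional Euclidean space and the real line. -/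

namespace WassersteinBDF2

open Set

/-- The isometry of the real line with one-dimensional Euclidean space. -/
noncomputable def lineIso : ℝ ≃ₗᵢ[ℝ] Space 1 := (OrthonormalBasis.singleton (Fin 1) ℝ).repr

/-- A self-map of one-dimensional Euclidean space, read on the real line. -/
noncomputable def lineMap : (Space 1 → Space 1) ≃ₗ[ℝ] (ℝ → ℝ) where
  toFun x t := lineIso.symm (x (lineIso t))
  invFun y X := lineIso (y (lineIso.symm X))
  left_inv x := by ext1 X; simp
  right_inv y := by ext1 t; simp
  map_add' x y := by ext1 t; simp
  map_smul' c x := by ext1 t; simp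

lemma lineMap_apply (x : Space 1 → Space 1) (t : ℝ) :
    lineMap x t = lineIso.symm (x (lineIso t)) := rfl

lemma lineIso_lineMap (x : Space 1 → Space 1) (t : ℝ) : lineIso (lineMap x t) = x (lineIso t) := by
  simp [lineMap_apply]

lemma eq_lineIso_comp_lineMap (x : Space 1 → Space 1) :
    x = fun X => lineIso (lineMap x (lineIso.symm X)) := by
  ext1 X; simp [lineMap_apply]

lemma contDiff_lineMap {x : Space 1 → Space 1} {n : WithTop ℕ∞} :
    ContDiff ℝ n (lineMap x) ↔ ContDiff ℝ n x := by
  refine ⟨fun h => ?_, fun h => lineIso.symm.contDiff.comp (h.comp lineIso.contDiff)⟩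
  rw [eq_lineIso_comp_lineMap x]
  exact lineIso.contDiff.comp (h.comp lineIso.symm.contDiff)

lemma deriv_lineMap (x : Space 1 → Space 1) (t : ℝ) :
    deriv (lineMap x) t = lineIso.symm (fderiv ℝ x (lineIso t) (lineIso 1)) := by
  have h : lineMap x = lineIso.symm ∘ (x ∘ lineIso.toContinuousLinearEquiv) := rfl
  rw [h, ← fderiv_apply_one_eq_deriv, LinearIsometryEquiv.comp_fderiv,
    ContinuousLinearEquiv.comp_right_fderiv]
  rfl

lemma lineIso_smul_one (X : Space 1) : X = lineIso.symm X • lineIso 1 := by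
  rw [← map_smul, smul_eq_mul, mul_one, LinearIsometryEquiv.apply_symm_apply]

lemma fderiv_eq_smul_id (x : Space 1 → Space 1) (t : ℝ) :
    fderiv ℝ x (lineIso t) = deriv (lineMap x) t • ContinuousLinearMap.id ℝ (Space 1) := by
  ext1 v
  rw [deriv_lineMap]
  conv_lhs => rw [lineIso_smul_one v, map_smul]
  conv_rhs => rw [lineIso_smul_one v]
  set w := fderiv ℝ x (lineIso t) (lineIso 1)
  simp only [_root_.smul_apply, ContinuousLinearMap.id_apply]
  rw [smul_comm, ← lineIso_smul_one w]

lemma jac_eq_deriv (x : Space 1 → Space 1) (t : ℝ) : jac x (lineIso t) = deriv (lineMap x) t := by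
  rw [jac, fderiv_eq_smul_id, ContinuousLinearMap.det]
  simp

lemma laplacian_eq_deriv_deriv {u : Space 1 → Space 1} (hu : ContDiff ℝ 2 u) (t : ℝ) :
    (Δ u) (lineIso t) = lineIso (deriv (deriv (lineMap u)) t) := by
  rw [congrFun (InnerProductSpace.laplacian_eq_iteratedFDeriv_orthonormalBasis u
    ((OrthonormalBasis.singleton (Fin 1) ℝ).map lineIso)) (lineIso t)]
  have h1 : HasDerivAt (deriv (lineMap u)) (deriv (deriv (lineMap u)) t) t :=
    (((contDiff_lineMap.2 hu).iterate_deriv' 1 1).differentiable one_ne_zero t).hasDerivAt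
  have h2 : HasFDerivAt (fun X => deriv (lineMap u) (lineIso.symm X))
      (deriv (deriv (lineMap u)) t • (lineIso.symm : Space 1 →L[ℝ] ℝ)) (lineIso t) := by
    refine HasDerivAt.comp_hasFDerivAt (h₂ := deriv (lineMap u)) (lineIso t) ?_
      lineIso.symm.hasFDerivAt
    simpa using h1
  have h3 : fderiv ℝ u = fun X => deriv (lineMap u) (lineIso.symm X) •
      ContinuousLinearMap.id ℝ (Space 1) := by
    ext1 X
    rw [← fderiv_eq_smul_id, LinearIsometryEquiv.apply_symm_apply]
  have h4 := h2.smul_const (ContinuousLinearMap.id ℝ (Space 1))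
  simp only [iteratedFDeriv_two_apply]
  rw [h3, h4.fderiv]
  simp only [Finset.univ_unique, Finset.sum_singleton]
  simp [mul_comm]
  rw [← map_smul]; simp

/-- In one dimension the derivative of `x` is a scalar multiple of the identity, so it is its own
adjoint and its inverse divides by the slope. -/
lemma eulerianGradient_eq {x : Space 1 → Space 1} {f : Space 1 → ℝ} {t m : ℝ}
    (hx : deriv (lineMap x) t ≠ 0) (hf : HasDerivAt (fun s => f (lineIso s)) m t) :
    eulerianGradient x f (lineIso t) = lineIso (m / deriv (lineMap x) t) := by
  have h1 : HasGradientAt f (lineIso m) (lineIso t) := by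
    rw [hasGradientAt_iff_hasFDerivAt]
    have h2 : HasFDerivAt (fun X => f (lineIso (lineIso.symm X)))
        (m • (lineIso.symm : Space 1 →L[ℝ] ℝ)) (lineIso t) := by
      refine HasDerivAt.comp_hasFDerivAt (h₂ := fun s => f (lineIso s)) (lineIso t) ?_
        lineIso.symm.hasFDerivAt
      simpa using hf
    simp only [LinearIsometryEquiv.apply_symm_apply] at h2
    refine h2.congr_fderiv ?_
    ext1 v
    have := lineIso.inner_map_map m (lineIso.symm v)
    rw [LinearIsometryEquiv.apply_symm_apply] at this
    simp [this, mul_comm]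
  rw [eulerianGradient, h1.gradient, fderiv_eq_smul_id]
  have h5 : ContinuousLinearMap.adjoint (deriv (lineMap x) t • ContinuousLinearMap.id ℝ (Space 1)) =
      deriv (lineMap x) t • ContinuousLinearMap.id ℝ (Space 1) := by
    rw [map_smulₛₗ, ContinuousLinearMap.adjoint_id]; rfl
  rw [h5, ContinuousLinearMap.inverse_eq
    (g := (deriv (lineMap x) t)⁻¹ • ContinuousLinearMap.id ℝ (Space 1))
    (by ext1 v; simp [smul_smul, hx]) (by ext1 v; simp [smul_smul, hx])]
  simp only [_root_.smul_apply, ContinuousLinearMap.id_apply, ← map_smul, smul_eq_mul]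
  rw [div_eq_inv_mul]

/-- The data on the real line of a one-dimensional problem on an interval. -/
noncomputable def lineData (D : FlowData 1) (S : StepData 1) (a b : ℝ) : LineData where
  a := a
  b := b
  τ := S.τ
  r := S.r
  ρ t := D.ρ₀ (lineIso t)
  U := D.U
  V t := D.V (lineIso t)
  W s t := D.W (lineIso s) (lineIso t)
  prev := lineMap S.xPrev
  cur := lineMap S.xCur

lemma exists_Ioo_of_isConnected {s : Set ℝ} (ho : IsOpen s) (hc : IsConnected s)
    (hb : Bornology.IsBounded s) : ∃ a b, a < b ∧ s = Ioo a b := by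
  have h1 := hc.Ioo_csInf_csSup_subset hb.bddBelow hb.bddAbove
  have h2 : s ⊆ Ioo (sInf s) (sSup s) := fun t ht => by
    obtain ⟨ε, hε, h⟩ := Metric.isOpen_iff.1 ho t ht
    have h3 := csInf_le hb.bddBelow (h (show t - ε / 2 ∈ _ by
      rw [Metric.mem_ball, Real.dist_eq, abs_lt]; constructor <;> linarith))
    have h4 := le_csSup hb.bddAbove (h (show t + ε / 2 ∈ _ by
      rw [Metric.mem_ball, Real.dist_eq, abs_lt]; constructor <;> linarith))
    constructor <;> linarith
  obtain ⟨t, ht⟩ := hc.nonempty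
  exact ⟨_, _, (h2 ht).1.trans (h2 ht).2, h2.antisymm h1⟩

section Transfer

variable {D : FlowData 1} {S : StepData 1} {a b : ℝ} (hab : a < b)
  (hΩ : lineIso ⁻¹' D.Ω = Ioo a b)

lemma measurableEmbedding_lineIso : MeasurableEmbedding lineIso :=
  lineIso.toHomeomorph.measurableEmbedding

include hΩ

lemma mem_domain_iff {t : ℝ} : lineIso t ∈ D.Ω ↔ t ∈ Ioo a b := by rw [← hΩ]; rfl

lemma forall_domain {p : Space 1 → Prop} : (∀ X ∈ D.Ω, p X) ↔ ∀ t ∈ Ioo a b, p (lineIso t) := by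
  refine ⟨fun h t ht => h _ ((mem_domain_iff hΩ).2 ht), fun h X hX => ?_⟩
  have := h (lineIso.symm X) ((mem_domain_iff hΩ).1 (by simpa using hX))
  simpa using this

lemma ae_domain {p : Space 1 → Prop} : (∀ᵐ X ∂(volume.restrict D.Ω), p X) ↔
    ∀ᵐ t ∂(volume.restrict (Ioo a b)), p (lineIso t) := by
  rw [← hΩ, ← (lineIso.measurePreserving.restrict_preimage_emb measurableEmbedding_lineIso
    D.Ω).map_eq, measurableEmbedding_lineIso.ae_map_iff]

lemma integrableOn_domain {f : Space 1 → ℝ} :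
    IntegrableOn f D.Ω ↔ IntegrableOn (fun t => f (lineIso t)) (Ioo a b) := by
  rw [← hΩ]
  exact (lineIso.measurePreserving.integrableOn_comp_preimage measurableEmbedding_lineIso).symm

include hab

lemma setIntegral_domain (f : Space 1 → ℝ) : ∫ X in D.Ω, f X = ∫ t in a..b, f (lineIso t) := by
  rw [intervalIntegral.integral_of_le hab.le, integral_Ioc_eq_integral_Ioo, ← hΩ]
  exact (lineIso.measurePreserving.setIntegral_preimage_emb measurableEmbedding_lineIso f _).symm

lemma forall_closure {p : Space 1 → Prop} :
    (∀ X ∈ closure D.Ω, p X) ↔ ∀ t ∈ Icc a b, p (lineIso t) := by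
  have h : lineIso ⁻¹' closure D.Ω = Icc a b := by
    rw [← closure_Ioo hab.ne, ← hΩ]
    exact lineIso.toHomeomorph.preimage_closure D.Ω
  refine ⟨fun H t ht => H _ (by rw [← h] at ht; exact ht), fun H X hX => ?_⟩
  have := H (lineIso.symm X) (by rw [← h]; simpa using hX)
  simpa using this

lemma forall_frontier {p : Space 1 → Prop} :
    (∀ X ∈ frontier D.Ω, p X) ↔ p (lineIso a) ∧ p (lineIso b) := by
  have h : lineIso ⁻¹' frontier D.Ω = {a, b} := by
    rw [← frontier_Ioo hab, ← hΩ]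
    exact lineIso.toHomeomorph.preimage_frontier D.Ω
  refine ⟨fun H => ⟨H _ ?_, H _ ?_⟩, fun H X hX => ?_⟩
  · exact (by rw [h]; simp : a ∈ lineIso ⁻¹' frontier D.Ω)
  · exact (by rw [h]; simp : b ∈ lineIso ⁻¹' frontier D.Ω)
  · have : lineIso.symm X ∈ lineIso ⁻¹' frontier D.Ω := by simpa using hX
    rw [h] at this
    rcases this with h | h
    · simpa [← h] using H.1
    · simpa [← mem_singleton_iff.1 h] using H.2

lemma isDirichletMap_iff {x : Space 1 → Space 1} : IsDirichletMap D.Ω x ↔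
    ContDiff ℝ 2 (lineMap x) ∧ lineMap x a = a ∧ lineMap x b = b := by
  rw [IsDirichletMap, forall_frontier hab hΩ, contDiff_lineMap]
  simp only [lineMap_apply, lineIso.symm_apply_eq]

lemma eqOn_closure_iff {x y : Space 1 → Space 1} :
    EqOn x y (closure D.Ω) ↔ EqOn (lineMap x) (lineMap y) (Icc a b) := by
  rw [EqOn, forall_closure hab hΩ]
  simp only [EqOn, lineMap_apply, EmbeddingLike.apply_eq_iff_eq]

lemma mem_energyDomain_iff {x : Space 1 → Space 1} :
    x ∈ energyDomain D ↔ lineMap x ∈ (lineData D S a b).dom := by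
  rw [energyDomain, LineData.dom, mem_ofPred_eq, mem_ofPred_eq, isDirichletMap_iff hab hΩ,
    ae_domain hΩ, integrableOn_domain hΩ]
  simp only [internalDensity, jac_eq_deriv]
  rfl

lemma energy_eq (x : Space 1 → Space 1) :
    energy D x = (lineData D S a b).energy (lineMap x) := by
  rw [energy, LineData.energy, LineData.potentialEnergy]
  simp only [setIntegral_domain hab hΩ, internalDensity, jac_eq_deriv]
  simp only [lineData, LineData.internal, lineIso_lineMap]
  ring

lemma stepFunctional_eq {x : Space 1 → Space 1} (hx : ContDiff ℝ 2 x)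
    (hc : ContDiff ℝ 2 S.xCur) :
    stepFunctional D S x = (lineData D S a b).functional (lineMap x) := by
  have h1 (t : ℝ) : ‖bdf2 S x (lineIso t)‖ ^ 2 = (lineData D S a b).bdf (lineMap x) t ^ 2 := by
    rw [← lineIso.symm.norm_map, Real.norm_eq_abs, sq_abs]
    simp [bdf2, LineData.bdf, lineData, lineMap_apply]
  have h2 (t : ℝ) : gradNormSq (fun Y => x Y - S.xCur Y) (lineIso t) =
      (deriv (lineMap x) t - deriv (lineMap S.xCur) t) ^ 2 := by
    have h3 : deriv (lineMap fun Y => x Y - S.xCur Y) t =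
        deriv (lineMap x) t - deriv (lineMap S.xCur) t := by
      have h4 : (lineMap fun Y => x Y - S.xCur Y) = lineMap x - lineMap S.xCur :=
        map_sub lineMap x S.xCur
      rw [h4, deriv_sub ((contDiff_lineMap.2 hx).differentiable (by norm_num) t)
        ((contDiff_lineMap.2 hc).differentiable (by norm_num) t)]
    simp [gradNormSq, fderiv_eq_smul_id, norm_smul, h3]
  rw [stepFunctional, LineData.functional, LineData.inertia, ← energy_eq hab hΩ]
  simp only [setIntegral_domain hab hΩ, h1, h2]
  rfl

end Transfer

end WassersteinBDF2

/-! ### The scheme in dimension one, the Eulerian density, and the conclusion. -/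

namespace WassersteinBDF2

open Set

/-- A map that fixes the endpoints of an interval and whose derivative does not vanish inside has
positive derivative. -/
lemma deriv_pos_of_ne_zero {x : ℝ → ℝ} {a b : ℝ} (hab : a < b) (hx : ContDiff ℝ 2 x)
    (ha : x a = a) (hb : x b = b) (h : ∀ t ∈ Ioo a b, deriv x t ≠ 0) :
    ∀ t ∈ Ioo a b, 0 < deriv x t := by
  obtain ⟨c, hc, hcx⟩ := exists_deriv_eq_slope x hab hx.continuous.continuousOn
    (hx.differentiable (by norm_num)).differentiableOn
  rw [ha, hb, div_self (sub_pos.2 hab).ne'] at hcx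
  intro t ht
  by_contra! hn
  have hcont : Continuous (deriv x) := hx.continuous_deriv (by norm_num)
  obtain ⟨s, hs, hs0⟩ := isPreconnected_Ioo.intermediate_value ht hc hcont.continuousOn
    (show (0 : ℝ) ∈ Icc _ _ from ⟨hn, by rw [hcx]; exact zero_le_one⟩)
  exact h s hs hs0

section Line

variable {D : FlowData 1} {S : StepData 1} {a b : ℝ} (hab : a < b)
  (hΩ : lineIso ⁻¹' D.Ω = Ioo a b)

include hab hΩ

/-- In one dimension, the scheme is the balance of stress and force. -/
lemma exists_hasDerivAt_momentum (H : (lineData D S a b).Regular)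
    {x : Space 1 → Space 1} {ρ : Space 1 → ℝ} (hx : ContDiff ℝ 2 x) (hc : ContDiff ℝ 2 S.xCur)
    (hpos : ∀ t ∈ Ioo a b, 0 < deriv (lineMap x) t)
    (hρ : ∀ X ∈ D.Ω, ρ X = D.ρ₀ X / jac x X) {t : ℝ} (ht : t ∈ Ioo a b) :
    ∃ g', HasDerivAt (fun s => (lineData D S a b).pressure
        ((lineData D S a b).ρ s / deriv (lineMap x) s) +
          (lineData D S a b).τ * (deriv (lineMap x) s - deriv (lineData D S a b).cur s)) g' t ∧
      (D.ρ₀ (lineIso t) / (S.τ * (1 + S.r))) • bdf2 S x (lineIso t)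
        - S.τ • (Δ (fun Y => x Y - S.xCur Y)) (lineIso t)
        + D.ρ₀ (lineIso t) • eulerianGradient x (potential D x ρ) (lineIso t) =
      lineIso ((lineData D S a b).inertiaForce (lineMap x) t +
        (lineData D S a b).potentialForce (lineMap x) t - g') := by
  obtain ⟨g', m', h1, h2, h3⟩ := H.exists_hasDerivAt_stress (contDiff_lineMap.2 hx) hpos ht
  refine ⟨g', h1, ?_⟩
  rw [← h3]
  have h4 : HasDerivAt (fun s => potential D x ρ (lineIso s)) m' t := by
    refine h2.congr_of_eventuallyEq ?_
    filter_upwards [isOpen_Ioo.mem_nhds ht] with s hs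
    simp only [potential, setIntegral_domain hab hΩ, hρ _ ((mem_domain_iff hΩ).2 hs), jac_eq_deriv]
    simp only [lineData, lineIso_lineMap]
  have h5 : (lineMap fun Y => x Y - S.xCur Y) = lineMap x - lineMap S.xCur :=
    map_sub lineMap x S.xCur
  have h6 : deriv (deriv (lineMap fun Y => x Y - S.xCur Y)) t =
      deriv (deriv (lineMap x)) t - deriv (deriv (lineMap S.xCur)) t := by
    have h7 : deriv (lineMap x - lineMap S.xCur) = deriv (lineMap x) - deriv (lineMap S.xCur) := by
      ext1 s
      exact deriv_sub ((contDiff_lineMap.2 hx).differentiable (by norm_num) s)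
        ((contDiff_lineMap.2 hc).differentiable (by norm_num) s)
    rw [h5, h7]
    exact deriv_sub
      (((contDiff_lineMap.2 hx).iterate_deriv' 1 1).differentiable one_ne_zero t)
      (((contDiff_lineMap.2 hc).iterate_deriv' 1 1).differentiable one_ne_zero t)
  have h8 : bdf2 S x (lineIso t) = lineIso ((lineData D S a b).bdf (lineMap x) t) := by
    rw [← lineIso.symm_apply_eq]
    simp [bdf2, LineData.bdf, lineData, lineMap_apply]
  rw [eulerianGradient_eq (hpos t ht).ne' h4, laplacian_eq_deriv_deriv (hx.sub hc), h6, h8,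
    ← map_smul, ← map_smul, ← map_smul, ← map_sub, ← map_add]
  rfl

/-- The fixed endpoints upgrade a nonvanishing slope to a positive one. The momentum residual is
then the image of force minus derivative of stress under an isometry, so its vanishing is the
balance. -/
lemma IsSchemeSolution.isEquilibrium (H : (lineData D S a b).Regular) (hc : ContDiff ℝ 2 S.xCur)
    {x : Space 1 → Space 1} {ρ : Space 1 → ℝ} (h : IsSchemeSolution D S x ρ) :
    (lineData D S a b).IsEquilibrium (lineMap x) := by
  obtain ⟨hx, ha, hb⟩ := (isDirichletMap_iff hab hΩ).1 h.dirichlet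
  have hpos := deriv_pos_of_ne_zero hab hx ha hb fun t ht => by
    rw [← jac_eq_deriv]; exact h.jac_ne_zero _ ((mem_domain_iff hΩ).2 ht)
  refine ⟨hx, ha, hb, hpos, fun t ht => ?_⟩
  obtain ⟨g', h1, h2⟩ := exists_hasDerivAt_momentum hab hΩ H h.dirichlet.1 hc hpos h.density ht
  rw [h.momentum _ ((mem_domain_iff hΩ).2 ht), eq_comm, map_eq_zero_iff _ lineIso.injective,
    sub_eq_zero] at h2
  rwa [h2]

lemma isSchemeSolution_of_isEquilibrium (H : (lineData D S a b).Regular)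
    (hc : ContDiff ℝ 2 S.xCur) {x : Space 1 → Space 1}
    (h : (lineData D S a b).IsEquilibrium (lineMap x)) :
    IsSchemeSolution D S x (fun X => D.ρ₀ X / jac x X) := by
  have hd : IsDirichletMap D.Ω x := (isDirichletMap_iff hab hΩ).2 ⟨h.contDiff, h.left, h.right⟩
  refine ⟨hd, (forall_domain hΩ).2 fun t ht => ?_, (forall_domain hΩ).2 fun t ht => ?_,
    fun X _ => rfl⟩
  · rw [jac_eq_deriv]
    exact (h.pos t ht).ne'
  · obtain ⟨g', h1, h2⟩ :=
      exists_hasDerivAt_momentum hab hΩ H hd.1 hc h.pos (fun X _ => rfl) ht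
    rw [h2, h1.unique (h.balance t ht), sub_self, map_zero]

end Line

lemma injOn_of_deriv_pos {D : FlowData 1} {a b : ℝ} (hΩ : lineIso ⁻¹' D.Ω = Ioo a b)
    {x : Space 1 → Space 1} (hx : ContDiff ℝ 2 x)
    (hpos : ∀ t ∈ Ioo a b, 0 < deriv (lineMap x) t) : InjOn x D.Ω := by
  have h : InjOn (lineMap x) (Ioo a b) := (strictMonoOn_of_deriv_pos (convex_Ioo a b)
    (contDiff_lineMap.2 hx).continuous.continuousOn fun t ht => hpos t
      (by rwa [interior_Ioo] at ht)).injOn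
  intro X hX Y hY hXY
  refine lineIso.symm.injective (h ?_ ?_ (by simp [lineMap_apply, hXY]))
  · exact (mem_domain_iff hΩ).1 (by simpa using hX)
  · exact (mem_domain_iff hΩ).1 (by simpa using hY)

/-- The Eulerian density of an injective flow map is positive and has the mass of the initial
density. -/
lemma eulerianDensity_pos_and_mass {d : ℕ} {Ω : Set (Space d)} (hΩ : IsOpen Ω)
    (hbdd : Bornology.IsBounded Ω) {ρ₀ : Space d → ℝ} (hρ : Continuous ρ₀)
    (hρ₀ : ∀ X ∈ Ω, 0 < ρ₀ X) {x : Space d → Space d} (hx : IsFlowMap Ω x) (hi : InjOn x Ω) :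
    (∀ y ∈ x '' Ω, 0 < eulerianDensity Ω x (fun X => ρ₀ X / jac x X) y) ∧
      IntegrableOn (eulerianDensity Ω x (fun X => ρ₀ X / jac x X)) (x '' Ω) ∧
      ∫ y in x '' Ω, eulerianDensity Ω x (fun X => ρ₀ X / jac x X) y = ∫ X in Ω, ρ₀ X := by
  have h1 : ∀ X ∈ Ω, eulerianDensity Ω x (fun X => ρ₀ X / jac x X) (x X) = ρ₀ X / jac x X :=
    fun X hX => by rw [eulerianDensity, hi.leftInvOn_invFunOn hX]
  have hd : ∀ X ∈ Ω, HasFDerivWithinAt x (fderiv ℝ x X) Ω X := fun X _ =>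
    (hx.1.1.differentiable (by norm_num) X).hasFDerivAt.hasFDerivWithinAt
  have h2 : EqOn (fun X => |(fderiv ℝ x X).det| •
      eulerianDensity Ω x (fun X => ρ₀ X / jac x X) (x X)) ρ₀ Ω := fun X hX => by
    have hj := hx.2 X hX
    simp only [h1 X hX, smul_eq_mul]
    rw [← jac, abs_of_pos hj, mul_div_cancel₀ _ hj.ne']
  refine ⟨?_, ?_, ?_⟩
  · rintro _ ⟨X, hX, rfl⟩
    rw [h1 X hX]
    exact div_pos (hρ₀ X hX) (hx.2 X hX)
  · rw [integrableOn_image_iff_integrableOn_abs_det_fderiv_smul volume hΩ.measurableSet hd hi,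
      integrableOn_congr_fun h2 hΩ.measurableSet]
    exact (hρ.continuousOn.integrableOn_compact hbdd.isCompact_closure).mono_set subset_closure
  · rw [integral_image_eq_integral_abs_det_fderiv_smul volume hΩ.measurableSet hd hi,
      setIntegral_congr_fun hΩ.measurableSet h2]

/-- The one-dimensional case. -/
theorem exists_unique_solution_of_dim_one {D : FlowData 1} {S : StepData 1}
    (hΩ_open : IsOpen D.Ω) (hΩ_conn : IsConnected D.Ω) (hΩ_bdd : Bornology.IsBounded D.Ω)
    (hρ₀ : ContDiff ℝ 1 D.ρ₀) (hρ₀_pos : ∀ X ∈ closure D.Ω, 0 < D.ρ₀ X)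
    (hU : ContDiffOn ℝ 2 D.U (Ioi 0))
    (hU_superlinear : Tendsto (fun s => D.U s / s) atTop atTop)
    (hV : ContDiff ℝ 1 D.V)
    (hW : ContDiff ℝ 1 (fun p : Space 1 × Space 1 => D.W p.1 p.2))
    (hW_symm : ∀ x y, D.W x y = D.W y x)
    (hτ : 0 < S.τ) (hr : 0 < S.r)
    (hxPrev : IsFlowMap D.Ω S.xPrev)
    (hxCur : IsFlowMap D.Ω S.xCur)
    (hE : ConvexOn ℝ (energyDomain D) (energy D)) :
    ConvexOn ℝ (energyDomain D) (stepFunctional D S) ∧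
    ∃ (x : Space 1 → Space 1) (ρ : Space 1 → ℝ),
      IsSchemeSolution D S x ρ ∧
      (∀ y σ, IsSchemeSolution D S y σ →
        EqOn y x (closure D.Ω) ∧ EqOn σ ρ D.Ω) ∧
      x ∈ energyDomain D ∧
      IsMinOn (stepFunctional D S) (energyDomain D) x ∧
      (∀ y ∈ energyDomain D,
        IsMinOn (stepFunctional D S) (energyDomain D) y →
          EqOn y x (closure D.Ω)) ∧
      IsFlowMap D.Ω x ∧
      (∀ X ∈ D.Ω, 0 < ρ X) ∧
      InjOn x D.Ω ∧
      (∀ y ∈ x '' D.Ω, 0 < eulerianDensity D.Ω x ρ y) ∧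
      IntegrableOn (eulerianDensity D.Ω x ρ) (x '' D.Ω) ∧
      ∫ y in x '' D.Ω, eulerianDensity D.Ω x ρ y = ∫ X in D.Ω, D.ρ₀ X := by
  have himg : lineIso ⁻¹' D.Ω = lineIso.symm '' D.Ω :=
    (lineIso.symm.toEquiv.image_eq_preimage_symm D.Ω).symm
  obtain ⟨a, b, hab, hΩ⟩ := exists_Ioo_of_isConnected (hΩ_open.preimage lineIso.continuous)
    (by rw [himg]; exact hΩ_conn.image _ lineIso.symm.continuous.continuousOn)
    (by rw [himg]; exact lineIso.symm.lipschitz.isBounded_image hΩ_bdd)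
  have hc := hxCur.1.1
  have H : (lineData D S a b).Regular :=
    { lt := hab
      τ_pos := hτ
      r_pos := hr
      ρ := hρ₀.comp lineIso.contDiff
      ρ_pos := (forall_closure hab hΩ).1 hρ₀_pos
      U := hU
      superlinear := hU_superlinear
      V := hV.comp lineIso.contDiff
      W := hW.comp (lineIso.contDiff.prodMap lineIso.contDiff)
      symm := fun s t => hW_symm _ _
      prev := (contDiff_lineMap.2 hxPrev.1.1).continuous
      cur := contDiff_lineMap.2 hc }
  have hdom : energyDomain D = lineMap ⁻¹' (lineData D S a b).dom := by
    ext x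
    exact mem_energyDomain_iff hab hΩ
  have hstep : EqOn ((lineData D S a b).functional ∘ lineMap) (stepFunctional D S)
      (energyDomain D) := fun x hx => (stepFunctional_eq hab hΩ hx.1.1 hc).symm
  have hE' : ConvexOn ℝ (lineData D S a b).dom (lineData D S a b).energy := by
    have h := hE.comp_linearMap lineMap.symm.toLinearMap
    have h1 : ⇑lineMap.symm.toLinearMap ⁻¹' energyDomain D = (lineData D S a b).dom := by
      ext x; simp [hdom]
    rw [h1] at h
    exact h.congr fun x _ => by simp [energy_eq (S := S) hab hΩ]
  obtain ⟨hconv, z, hz, hz_unique, hz_dom, hz_min, hz_min_unique⟩ := H.main hE'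
  obtain ⟨x, rfl⟩ := lineMap.surjective z
  have hsol := isSchemeSolution_of_isEquilibrium hab hΩ H hc hz
  have hflow : IsFlowMap D.Ω x := ⟨hsol.dirichlet, (forall_domain hΩ).2 fun t ht => by
    rw [jac_eq_deriv]; exact hz.pos t ht⟩
  have hρ_pos : ∀ X ∈ D.Ω, 0 < D.ρ₀ X := fun X hX => hρ₀_pos X (subset_closure hX)
  have hinj := injOn_of_deriv_pos hΩ hsol.dirichlet.1 hz.pos
  obtain ⟨hpos, hint, hmass⟩ :=
    eulerianDensity_pos_and_mass hΩ_open hΩ_bdd hρ₀.continuous hρ_pos hflow hinj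
  have hx_dom : x ∈ energyDomain D := hdom ▸ hz_dom
  refine ⟨?_, x, _, hsol, fun y σ h => ?_, hx_dom, ?_, fun y hy hmin => ?_, hflow,
    fun X hX => div_pos (hρ_pos X hX) (hflow.2 X hX), hinj, hpos, hint, hmass⟩
  · refine ConvexOn.congr ?_ hstep
    rw [hdom]
    exact hconv.comp_linearMap lineMap.toLinearMap
  · have hyx : EqOn y x (closure D.Ω) :=
      (eqOn_closure_iff hab hΩ).2 (hz_unique _ (h.isEquilibrium hab hΩ H hc))
    refine ⟨hyx, fun X hX => ?_⟩
    -- Equality on the open set `Ω` gives equality of derivatives there, hence of Jacobians and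
    -- densities.
    have hX' : y =ᶠ[𝓝 X] x := by
      filter_upwards [hΩ_open.mem_nhds hX] with Y hY using hyx (subset_closure hY)
    rw [h.density X hX, jac, hX'.fderiv_eq, ← jac]
  · intro y hy
    have h := hz_min (mem_preimage.1 (hdom ▸ hy))
    rw [mem_ofPred_eq] at h ⊢
    rwa [← hstep hx_dom, ← hstep hy]
  · refine (eqOn_closure_iff hab hΩ).2
      (hz_min_unique _ (mem_preimage.1 (hdom ▸ hy)) fun w hw => ?_)
    obtain ⟨w, rfl⟩ := lineMap.surjective w
    have hw' : w ∈ energyDomain D := hdom ▸ hw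
    have h := hmin hw'
    rw [mem_ofPred_eq] at h ⊢
    rwa [← hstep hy, ← hstep hw'] at h

end WassersteinBDF2

theorem mainTheorem6 {d : ℕ} (hd : 1 ≤ d)
    (D : WassersteinBDF2.FlowData d) (S : WassersteinBDF2.StepData d)
    (hΩ_open : IsOpen D.Ω) (hΩ_conn : IsConnected D.Ω) (hΩ_bdd : Bornology.IsBounded D.Ω)
    (hρ₀ : ContDiff ℝ 1 D.ρ₀) (hρ₀_pos : ∀ X ∈ closure D.Ω, 0 < D.ρ₀ X)
    (hU : ContDiffOn ℝ 2 D.U (Set.Ioi 0))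
    (hU_superlinear : Filter.Tendsto (fun s => D.U s / s) Filter.atTop Filter.atTop)
    (hV : ContDiff ℝ 1 D.V)
    (hW : ContDiff ℝ 1 (fun p : WassersteinBDF2.Space d × WassersteinBDF2.Space d => D.W p.1 p.2))
    (hW_symm : ∀ x y, D.W x y = D.W y x)
    (hτ : 0 < S.τ) (hr : 0 < S.r)
    (hxPrev : WassersteinBDF2.IsFlowMap D.Ω S.xPrev)
    (hxCur : WassersteinBDF2.IsFlowMap D.Ω S.xCur)
    (hE : ConvexOn ℝ (WassersteinBDF2.energyDomain D) (WassersteinBDF2.energy D)) :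
    -- the variational problem is convex
    ConvexOn ℝ (WassersteinBDF2.energyDomain D) (WassersteinBDF2.stepFunctional D S) ∧
    ∃ (x : WassersteinBDF2.Space d → WassersteinBDF2.Space d) (ρ : WassersteinBDF2.Space d → ℝ),
      -- the scheme has the solution `(x, ρ)` and no other
      WassersteinBDF2.IsSchemeSolution D S x ρ ∧
      (∀ y σ, WassersteinBDF2.IsSchemeSolution D S y σ →
        Set.EqOn y x (closure D.Ω) ∧ Set.EqOn σ ρ D.Ω) ∧
      -- `x` is the unique minimizer of the variational problem
      x ∈ WassersteinBDF2.energyDomain D ∧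
      IsMinOn (WassersteinBDF2.stepFunctional D S) (WassersteinBDF2.energyDomain D) x ∧
      (∀ y ∈ WassersteinBDF2.energyDomain D,
        IsMinOn (WassersteinBDF2.stepFunctional D S) (WassersteinBDF2.energyDomain D) y →
          Set.EqOn y x (closure D.Ω)) ∧
      -- positivity, and conservation of mass for the density in Eulerian coordinates
      WassersteinBDF2.IsFlowMap D.Ω x ∧
      (∀ X ∈ D.Ω, 0 < ρ X) ∧
      Set.InjOn x D.Ω ∧
      (∀ y ∈ x '' D.Ω, 0 < WassersteinBDF2.eulerianDensity D.Ω x ρ y) ∧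
      MeasureTheory.IntegrableOn (WassersteinBDF2.eulerianDensity D.Ω x ρ) (x '' D.Ω) ∧
      ∫ y in x '' D.Ω, WassersteinBDF2.eulerianDensity D.Ω x ρ y = ∫ X in D.Ω, D.ρ₀ X := by
  -- For `d ≥ 2` the convexity hypothesis already fails for the domain of the energy.
  obtain hd2 | rfl : 2 ≤ d ∨ d = 1 := by omega
  · exact absurd hE.1 (WassersteinBDF2.not_convex_energyDomain hd2 hΩ_open hΩ_conn.nonempty
      hΩ_bdd hρ₀ hρ₀_pos hU)
  · exact WassersteinBDF2.exists_unique_solution_of_dim_one hΩ_open hΩ_conn hΩ_bdd hρ₀ hρ₀_pos hU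
      hU_superlinear hV hW hW_symm hτ hr hxPrev hxCur hE
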